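/- Let $X$ be a compact complex manifold of (pure) dimension $n$, and let $$\widetilde X = X_N \xrightarrow{\mu_{N-1}} X_{N-1} \to \cdots \to X_1 \xrightarrow{\mu_0} X_0 = X$$ be a tower of blow-ups with smooth centres: each $X_j$ is a compact complex manifold of dimension $n$, and $\mu_j : X_{j+1} \to X_j$ is the blow-up of $X_j$ along a closed complex submanifold $Y_j \subset X_j$ that is everywhere of positive codimension. A Hermitian metric, identified with its fundamental form $\omega$ (a smooth real positive definite $(1,1)$-form), is said to satisfy assumption $(*)$ if $\partial\bar\partial\omega^k = 0$ for every $k \in \{1, \dots, n-1\}$, and it is called a Gauduchon metric if $\partial\bar\partial\omega^{n-1} = 0$. If $X$ carries a Hermitian metric $\omega$ satisfying assumption $(*)$, then $\widetilde X$ carries a Gauduchon metric $\Omega$ satisfying assumption $(*)$. -/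

import Mathlib

open scoped Manifold ContDiff LinearAlgebra.Projectivization

noncomputable section

namespace HermitianBlowUp

/-- The model space `ℂⁿ`. -/
abbrev Cn (n : ℕ) : Type := EuclideanSpace ℂ (Fin n)

section Wedge

variable {V : Type*} [AddCommGroup V] [Module ℝ V] [TopologicalSpace V]

/-- The product `(v₁, …, v_{p+q}) ↦ α(v₁, …, v_p) β(v_{p+1}, …, v_{p+q})`. -/
def formMul {p q : ℕ} (α : V [⋀^Fin p]→L[ℝ] ℂ) (β : V [⋀^Fin q]→L[ℝ] ℂ) :
    ContinuousMultilinearMap ℝ (fun _ : Fin (p + q) => V) ℂ where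
  toMultilinearMap := ((LinearMap.mul' ℝ ℂ).compMultilinearMap
    (α.toMultilinearMap.domCoprod β.toMultilinearMap)).domDomCongr finSumFinEquiv
  cont := by
    change Continuous fun v : Fin (p + q) → V =>
      α (fun i => v (finSumFinEquiv (Sum.inl i))) * β (fun i => v (finSumFinEquiv (Sum.inr i)))
    exact (α.cont.comp (by fun_prop)).mul (β.cont.comp (by fun_prop))

theorem formMul_apply {p q : ℕ} (α : V [⋀^Fin p]→L[ℝ] ℂ) (β : V [⋀^Fin q]→L[ℝ] ℂ)
    (v : Fin (p + q) → V) :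
    formMul α β v = α (fun i => v (Fin.castAdd q i)) * β (fun i => v (Fin.natAdd p i)) := rfl

/-- The wedge product of complex-valued real-multilinear alternating forms,
`(α ∧ β)(v) = (1 / (p! q!)) ∑_σ sgn(σ) α(v_{σ 1}, …, v_{σ p}) β(v_{σ (p+1)}, …, v_{σ (p+q)})`. -/
def wedge {p q : ℕ} (α : V [⋀^Fin p]→L[ℝ] ℂ) (β : V [⋀^Fin q]→L[ℝ] ℂ) :
    V [⋀^Fin (p + q)]→L[ℝ] ℂ :=
  ((1 : ℝ) / (p.factorial * q.factorial)) •
    ContinuousMultilinearMap.alternatization (formMul α β)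

/-- The wedge power `α^k = α ∧ ⋯ ∧ α` of a `2`-form; `α^0 = 1`. -/
def wedgePow (α : V [⋀^Fin 2]→L[ℝ] ℂ) : (k : ℕ) → V [⋀^Fin (2 * k)]→L[ℝ] ℂ
  | 0 => ContinuousAlternatingMap.constOfIsEmpty ℝ V (Fin 0) 1
  | k + 1 => wedge (wedgePow α k) α

end Wedge

section Flat

variable {n k : ℕ}

/-- The complex-linear part `v ↦ (T v - i T(i v)) / 2` of a real-linear map. -/
def linPart {F : Type*} [NormedAddCommGroup F] [NormedSpace ℂ F] (T : Cn n →L[ℝ] F) :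
    Cn n →L[ℝ] F :=
  (1 / 2 : ℂ) • (T - Complex.I • T.comp (Complex.I • ContinuousLinearMap.id ℝ (Cn n)))

/-- The conjugate-linear part `v ↦ (T v + i T(i v)) / 2` of a real-linear map. -/
def conjPart {F : Type*} [NormedAddCommGroup F] [NormedSpace ℂ F] (T : Cn n →L[ℝ] F) :
    Cn n →L[ℝ] F :=
  (1 / 2 : ℂ) • (T + Complex.I • T.comp (Complex.I • ContinuousLinearMap.id ℝ (Cn n)))

/-- `∂` on `ℂⁿ`: `∂(f dz_I ∧ dz̄_J) = ∑_j (∂f/∂z_j) dz_j ∧ dz_I ∧ dz̄_J`, that is, the exterior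
derivative with the derivative of the coefficients replaced by its complex-linear part. -/
def flatDel (α : Cn n → Cn n [⋀^Fin k]→L[ℝ] ℂ) (z : Cn n) : Cn n [⋀^Fin (k + 1)]→L[ℝ] ℂ :=
  ContinuousAlternatingMap.alternatizeUncurryFin (linPart (fderiv ℝ α z))

/-- `∂̄` on `ℂⁿ`: `∂̄(f dz_I ∧ dz̄_J) = ∑_j (∂f/∂z̄_j) dz̄_j ∧ dz_I ∧ dz̄_J`, that is, the exterior
derivative with the derivative of the coefficients replaced by its conjugate-linear part. -/
def flatDelbar (α : Cn n → Cn n [⋀^Fin k]→L[ℝ] ℂ) (z : Cn n) : Cn n [⋀^Fin (k + 1)]→L[ℝ] ℂ :=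
  ContinuousAlternatingMap.alternatizeUncurryFin (conjPart (fderiv ℝ α z))

end Flat

section Manifold

variable {n k : ℕ} {X X' : Type*}
  [TopologicalSpace X] [ChartedSpace (Cn n) X]
  [TopologicalSpace X'] [ChartedSpace (Cn n) X']

/-- Complex-valued differential forms of degree `k` on `X` (not necessarily smooth). -/
abbrev DForm (n : ℕ) (X : Type*) [TopologicalSpace X] [ChartedSpace (Cn n) X] (k : ℕ) :=
  ∀ x : X, TangentSpace 𝓘(ℂ, Cn n) x [⋀^Fin k]→L[ℝ] ℂ

/-- The expression `(e⁻¹)^* η` of a form `η` in the chart `e`; it is meaningful on `e.target`. -/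
def chartRep (e : OpenPartialHomeomorph X (Cn n)) (η : DForm n X k) :
    Cn n → Cn n [⋀^Fin k]→L[ℝ] ℂ := fun z =>
  (η (e.symm z)).compContinuousLinearMap
    ((mfderiv 𝓘(ℂ, Cn n) 𝓘(ℂ, Cn n) e.symm z).restrictScalars ℝ)

/-- A form is smooth when its expression in every holomorphic chart is `C^∞` in the real sense. -/
def IsSmoothForm (η : DForm n X k) : Prop :=
  ∀ e ∈ IsManifold.maximalAtlas 𝓘(ℂ, Cn n) ω X, ContDiffOn ℝ ∞ (chartRep e η) e.target

/-- The operator `∂` on `X`, computed at `x` in the preferred chart at `x`. -/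
def del (η : DForm n X k) : DForm n X (k + 1) := fun x =>
  (flatDel (chartRep (chartAt (Cn n) x) η) (chartAt (Cn n) x x)).compContinuousLinearMap
    ((mfderiv 𝓘(ℂ, Cn n) 𝓘(ℂ, Cn n) (chartAt (Cn n) x) x).restrictScalars ℝ)

/-- The operator `∂̄` on `X`, computed at `x` in the preferred chart at `x`. -/
def delbar (η : DForm n X k) : DForm n X (k + 1) := fun x =>
  (flatDelbar (chartRep (chartAt (Cn n) x) η) (chartAt (Cn n) x x)).compContinuousLinearMap
    ((mfderiv 𝓘(ℂ, Cn n) 𝓘(ℂ, Cn n) (chartAt (Cn n) x) x).restrictScalars ℝ)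

/-- The power `η^k` of a `2`-form on `X`. -/
def formPow (η : DForm n X 2) (k : ℕ) : DForm n X (2 * k) := fun x => wedgePow (η x) k

/-- `η` is (the fundamental form of) a Hermitian metric on `X`: a smooth, real, positive definite
`(1,1)`-form. A real `2`-form is of type `(1,1)` exactly when it is invariant under
multiplication by `i`. -/
structure IsHermitianMetric (η : DForm n X 2) : Prop where
  smooth : IsSmoothForm η
  real : ∀ x v, (η x v).im = 0
  type_one_one : ∀ x (v w : TangentSpace 𝓘(ℂ, Cn n) x),
    η x ![Complex.I • v, Complex.I • w] = η x ![v, w]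
  pos : ∀ x (v : TangentSpace 𝓘(ℂ, Cn n) x), v ≠ 0 → 0 < (η x ![v, Complex.I • v]).re

/-- The Gauduchon condition `∂∂̄ η^{n-1} = 0`. -/
def IsGauduchon (η : DForm n X 2) : Prop :=
  ∀ k : ℕ, k + 1 = n → del (delbar (formPow η k)) = 0

/-- The assumption `(*)`: `∂∂̄ η^k = 0` for every `k ∈ {1, …, n-1}`. -/
def SatisfiesStar (η : DForm n X 2) : Prop :=
  ∀ k : ℕ, 1 ≤ k → k + 1 ≤ n → del (delbar (formPow η k)) = 0

end Manifold

section BlowUp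

variable {n : ℕ}

/-- The blow-up of `ℂⁿ` along the coordinate subspace `{z_i = 0 for i ∈ S}`: the set of all
pairs `(z, ℓ)`, where `ℓ` is a line in `ℂ^S` that contains `(z_i)_{i ∈ S}`. -/
def stdBlowUp (S : Finset (Fin n)) : Set (Cn n × ℙ ℂ (S → ℂ)) :=
  {p | (fun i : S => p.1 i) ∈ p.2.submodule}

/-- The vector `(u_i)_{i ∈ S}` with its `k`-th entry replaced by `1`. -/
def affineDir (S : Finset (Fin n)) (k : S) (u : Cn n) : S → ℂ :=
  Function.update (fun i : S => u i) k 1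

theorem affineDir_ne_zero (S : Finset (Fin n)) (k : S) (u : Cn n) : affineDir S k u ≠ 0 := by
  intro h
  have := congrFun h k
  simp [affineDir] at this

/-- The `k`-th standard affine chart of the blow-up of `ℂⁿ` along `{z_i = 0 for i ∈ S}`, as a
parametrization: `z_k = u_k`, `z_i = u_k u_i` for `i ∈ S` other than `k`, `z_i = u_i` for `i ∉ S`,
and `ℓ` is spanned by `(u_i)_{i ∈ S}` with the `k`-th entry replaced by `1`. -/
def affineChart (S : Finset (Fin n)) (k : S) (u : Cn n) : Cn n × ℙ ℂ (S → ℂ) :=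
  (WithLp.toLp 2 fun i => if i ∈ S ∧ i ≠ k then u k * u i else u i,
    Projectivization.mk ℂ (affineDir S k u) (affineDir_ne_zero S k u))

variable {X X' : Type*}
  [TopologicalSpace X] [ChartedSpace (Cn n) X]
  [TopologicalSpace X'] [ChartedSpace (Cn n) X']

/-- `μ : X' → X` is the blow-up of the complex manifold `X` along the closed complex submanifold
`Y` (nowhere of codimension `0`, possibly with components of different dimensions): `μ` is
holomorphic, it is biholomorphic over the complement of `Y`, and every point of `Y` has a
holomorphic chart `e` in which `Y` is a coordinate subspace and over whose domain `μ` is the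
blow-up of the open set `e.target` along that coordinate subspace. The biholomorphism `Φ` over
`e.source` with this standard blow-up is expressed through the standard affine charts. -/
structure IsBlowUp (μ : X' → X) (Y : Set X) : Prop where
  isClosed_center : IsClosed Y
  holomorphic : ContMDiff 𝓘(ℂ, Cn n) 𝓘(ℂ, Cn n) ω μ
  bijOn_compl : Set.BijOn μ (μ ⁻¹' Yᶜ) Yᶜ
  isLocalDiffeomorphOn_compl :
    IsLocalDiffeomorphOn 𝓘(ℂ, Cn n) 𝓘(ℂ, Cn n) ω μ (μ ⁻¹' Yᶜ)
  local_model : ∀ y ∈ Y, ∃ e ∈ IsManifold.maximalAtlas 𝓘(ℂ, Cn n) ω X,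
    ∃ S : Finset (Fin n), S.Nonempty ∧ y ∈ e.source ∧
      (∀ x ∈ e.source, x ∈ Y ↔ ∀ i ∈ S, e x i = 0) ∧
      ∃ Φ : X' → Cn n × ℙ ℂ (S → ℂ),
        Set.BijOn Φ (μ ⁻¹' e.source) {p | p ∈ stdBlowUp S ∧ p.1 ∈ e.target} ∧
        (∀ p ∈ μ ⁻¹' e.source, (Φ p).1 = e (μ p)) ∧
        ∀ k : S, ∃ c ∈ IsManifold.maximalAtlas 𝓘(ℂ, Cn n) ω X',
          c.source ⊆ μ ⁻¹' e.source ∧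
          c.target = {u | (affineChart S k u).1 ∈ e.target} ∧
          ∀ u ∈ c.target, Φ (c.symm u) = affineChart S k u

end BlowUp

end HermitianBlowUp

end

/-! By induction along the tower it suffices to treat one blow-up `μ : X' → X` with centre `Y`. The
new metric is `C μ^*η + θ`, where `θ` is a real `(1,1)`-form on `X'` that is locally `i∂∂̄f` and is
positive on the nonzero vectors of the kernel of `dμ`, and `C` is a large constant.

Why `(*)` survives: if `∂∂̄a = 0`, then `∂∂̄a² = 2 ∂a ∧ ∂̄a`, and `∂∂̄a^k` is a combination of terms
containing `∂∂̄a` or `∂a ∧ ∂̄a`. So the cases `k = 1, 2` of `(*)` imply all the others. These two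
conditions only involve `∂a`, `∂̄a` and `∂∂̄a`, which are unchanged by adding a form killed by `∂`
and `∂̄`. They also pass to pullbacks, since `∂` and `∂̄` commute with pullback by a holomorphic map
(`flatD_pullback`). This is `flatD_flatD_wedgePow_add_eq_zero`, globalized in
`satisfiesStar_smul_pullForm_add`.

Where `θ` comes from: a partition of unity glues the sums of squares of local equations of `Y` into
a function `Ψ ≥ 0` on `X` vanishing exactly on `Y`. Upstairs, near the exceptional divisor `u_k =
0`, it factors as `Ψ ∘ μ = |u_k|² g` with `g > 0` smooth (`exists_local_potential`), and `θ = i∂∂̄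
log g` there, `θ = i∂∂̄ log (Ψ ∘ μ)` elsewhere. Two such potentials differ by some `log |h|²`, which
is pluriharmonic off the divisor; density and continuity make the local forms agree
(`leviForm_eq_of_isPotentialAt`). Along a fibre, `g` is a weighted sum of squared norms of affine
functions that are not all proportional, so `log g` is strictly subharmonic there: this is the
Fubini-Study computation.

Why the sum is positive: `μ^*η` is semipositive and degenerates exactly on the kernel of `dμ`, where
`θ` is positive. Compactness of `X'` then gives one `ε > 0` with `μ^*η + ε θ > 0`
(`exists_pos_add_smul`), and `C = ε⁻¹`. -/

namespace HermitianBlowUp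

/-! ### Alternating forms as elements of a complex Grassmann algebra. -/

section Grassmann

variable {V : Type*} [NormedAddCommGroup V] [NormedSpace ℝ V] {ι : Type*} [Fintype ι]
  [DecidableEq ι] (b : Module.Basis ι ℝ V)

section Generators

variable {ι : Type*} [DecidableEq ι]

/-- The generator of the complex Grassmann algebra with index `i`. -/
noncomputable def gen (i : ι) : ExteriorAlgebra ℂ (ι → ℂ) :=
  ExteriorAlgebra.ι ℂ (Pi.single i (1 : ℂ))

/-- The product of the generators with indices `I 0, …, I (p - 1)`. -/
noncomputable def genMulti {p : ℕ} (I : Fin p → ι) : ExteriorAlgebra ℂ (ι → ℂ) :=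
  ExteriorAlgebra.ιMulti ℂ p fun a => Pi.single (I a) (1 : ℂ)

theorem gen_mul_gen_swap (i j : ι) : gen i * gen j = -(gen j * gen i) :=
  eq_neg_of_add_eq_zero_left (ExteriorAlgebra.ι_add_mul_swap _ _)

theorem genMulti_comp_perm {p : ℕ} (I : Fin p → ι) (σ : Equiv.Perm (Fin p)) :
    genMulti (I ∘ σ) = Equiv.Perm.sign σ • genMulti I :=
  (ExteriorAlgebra.ιMulti ℂ (M := ι → ℂ) p).map_perm (fun a => Pi.single (I a) (1 : ℂ)) σ

theorem genMulti_cons {p : ℕ} (i : ι) (I : Fin p → ι) :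
    genMulti (Fin.cons i I) = gen i * genMulti I := by
  rw [genMulti, ExteriorAlgebra.ιMulti_succ_apply]
  rfl

theorem genMulti_insertNth {p : ℕ} (k : Fin (p + 1)) (i : ι) (I : Fin p → ι) :
    genMulti (k.insertNth i I) = (-1 : ℂ) ^ (k : ℕ) • (gen i * genMulti I) := by
  have h := (ExteriorAlgebra.ιMulti ℂ (M := ι → ℂ) (p + 1)).map_insertNth k
    (Pi.single i (1 : ℂ)) (fun a => Pi.single (I a) (1 : ℂ))
  rw [genMulti]
  have e : (fun a => Pi.single ((k.insertNth i I : Fin (p + 1) → ι) a) (1 : ℂ)) =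
      (k.insertNth (Pi.single i (1 : ℂ)) (fun a => Pi.single (I a) (1 : ℂ)) :
        Fin (p + 1) → ι → ℂ) := by
    funext a
    refine Fin.succAboveCases k ?_ (fun a => ?_) a <;> simp
  rw [e, h, ExteriorAlgebra.ιMulti_succ_apply]
  have h2 : ∀ x : ExteriorAlgebra ℂ (ι → ℂ), (-1 : ℤ) ^ (k : ℕ) • x = (-1 : ℂ) ^ (k : ℕ) • x := by
    intro x
    rcases neg_one_pow_eq_or ℤ (k : ℕ) with h | h
    · rcases Nat.even_or_odd (k : ℕ) with h' | h' <;> simp [h'.neg_one_pow]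
    · rcases Nat.even_or_odd (k : ℕ) with h' | h' <;> simp [h'.neg_one_pow]
  first
  | rfl
  | (rw [← h2]; rfl)

theorem genMulti_append {p q : ℕ} (I : Fin p → ι) (J : Fin q → ι) :
    genMulti (Fin.append I J) = genMulti I * genMulti J := by
  rw [genMulti, genMulti, genMulti, ExteriorAlgebra.ιMulti_mul_ιMulti]
  congr 1
  funext a
  refine Fin.addCases (fun a => ?_) (fun a => ?_) a <;> simp

end Generators

/-- The element `∑ T(b_{I 0}, …, b_{I (p - 1)}) θ_{I 0} ⋯ θ_{I (p - 1)}` of the Grassmann algebra. -/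
noncomputable def preSymbol {p : ℕ} (T : (Fin p → V) → ℂ) : ExteriorAlgebra ℂ (ι → ℂ) :=
  ∑ I : Fin p → ι, T (fun a => b (I a)) • genMulti I

/-- The symbol of an alternating form in the complex Grassmann algebra. -/
noncomputable def symbol {p : ℕ} (α : V [⋀^Fin p]→L[ℝ] ℂ) : ExteriorAlgebra ℂ (ι → ℂ) :=
  ((p.factorial : ℂ)⁻¹) • preSymbol b α

theorem symbol_add {p : ℕ} (α β : V [⋀^Fin p]→L[ℝ] ℂ) :
    symbol b (α + β) = symbol b α + symbol b β := by
  simp [symbol, preSymbol, add_smul, Finset.sum_add_distrib]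

theorem symbol_smul {p : ℕ} (c : ℂ) (α : V [⋀^Fin p]→L[ℝ] ℂ) :
    symbol b (c • α) = c • symbol b α := by
  simp only [symbol, preSymbol, ContinuousAlternatingMap.smul_apply, smul_assoc, 
    ← Finset.smul_sum]
  rw [smul_comm]

theorem symbol_zero {p : ℕ} : symbol b (0 : V [⋀^Fin p]→L[ℝ] ℂ) = 0 := by
  simp [symbol, preSymbol]

theorem preSymbol_mul {p q : ℕ} (α : V [⋀^Fin p]→L[ℝ] ℂ) (β : V [⋀^Fin q]→L[ℝ] ℂ) :
    preSymbol b (formMul α β) = preSymbol b α * preSymbol b β := by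
  simp only [preSymbol, Finset.sum_mul_sum]
  rw [← Finset.sum_product', Finset.univ_product_univ,
    ← Equiv.sum_comp (Fin.appendEquiv p q)]
  refine Finset.sum_congr rfl fun x _ => ?_
  have : Fin.appendEquiv p q x = Fin.append x.1 x.2 := rfl
  rw [this, genMulti_append, formMul_apply]
  rw [smul_mul_smul_comm]
  simp

/-- Permuting the arguments of `T` amounts to permuting the generators, which restores the sign; all
`p!` permutations thus contribute equally. -/
theorem preSymbol_alternatization {p : ℕ} (T : ContinuousMultilinearMap ℝ (fun _ : Fin p => V) ℂ) :
    preSymbol b (ContinuousMultilinearMap.alternatization T) =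
      (p.factorial : ℂ) • preSymbol b T := by
  have h1 : preSymbol b (ContinuousMultilinearMap.alternatization T) =
      ∑ σ : Equiv.Perm (Fin p), ∑ I : Fin p → ι,
        (Equiv.Perm.sign σ • T (fun a => b (I (σ a)))) • genMulti I := by
    rw [Finset.sum_comm, preSymbol]
    refine Finset.sum_congr rfl fun I _ => ?_
    rw [ContinuousMultilinearMap.alternatization_apply_apply, Finset.sum_smul]
    rfl
  have h2 : ∀ σ : Equiv.Perm (Fin p), ∑ I : Fin p → ι,
      (Equiv.Perm.sign σ • T (fun a => b (I (σ a)))) • genMulti I = preSymbol b T := by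
    intro σ
    rw [preSymbol, ← Equiv.sum_comp (Equiv.arrowCongr σ (Equiv.refl ι))]
    refine Finset.sum_congr rfl fun I _ => ?_
    have : (Equiv.arrowCongr σ (Equiv.refl ι)) I = I ∘ σ.symm := rfl
    rw [this, genMulti_comp_perm, Equiv.Perm.sign_symm]
    rcases Int.units_eq_one_or (Equiv.Perm.sign σ) with h | h <;> simp [h]
  rw [h1, Finset.sum_congr rfl fun σ _ => h2 σ]
  simp [Fintype.card_perm, Nat.cast_smul_eq_nsmul]

/-- The factor `(p + q)!` produced by alternatization cancels the normalization of `symbol`. Through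
this lemma the Leibniz computations below take place in one associative algebra, free of casts
between degrees. -/
theorem symbol_wedge {p q : ℕ} (α : V [⋀^Fin p]→L[ℝ] ℂ) (β : V [⋀^Fin q]→L[ℝ] ℂ) :
    symbol b (wedge α β) = symbol b α * symbol b β := by
  have h : symbol b (wedge α β) = (1 / (p.factorial * q.factorial) : ℂ) •
      symbol b (ContinuousMultilinearMap.alternatization (formMul α β)) := by
    rw [← symbol_smul, wedge]
    congr 1
    ext v
    simp
  rw [h, symbol, preSymbol_alternatization, smul_smul, smul_smul, symbol, symbol,
    preSymbol_mul, smul_mul_smul_comm]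
  congr 1
  have := Nat.cast_ne_zero (R := ℂ).2 (Nat.factorial_ne_zero (p + q))
  field_simp

theorem symbol_one : symbol b (ContinuousAlternatingMap.constOfIsEmpty ℝ V (Fin 0) (1 : ℂ)) = 1 := by
  simp [symbol, preSymbol, genMulti]

theorem symbol_wedgePow (α : V [⋀^Fin 2]→L[ℝ] ℂ) (k : ℕ) :
    symbol b (wedgePow α k) = symbol b α ^ k := by
  induction k with
  | zero => rw [pow_zero]; exact symbol_one b
  | succ k ih => rw [wedgePow, symbol_wedge, ih, pow_succ]

/-- Moving the `k`-th generator to the front costs `(-1)^k`, the sign already present in the `k`-th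
summand. The `p + 1` summands are therefore equal and turn `1/(p+1)!` into `1/p!`. -/
theorem symbol_alternatizeUncurryFin {p : ℕ} (T : V →L[ℝ] V [⋀^Fin p]→L[ℝ] ℂ) :
    symbol b (ContinuousAlternatingMap.alternatizeUncurryFin T) =
      ∑ j, gen j * symbol b (T (b j)) := by
  have h1 : preSymbol b (ContinuousAlternatingMap.alternatizeUncurryFin T) =
      ∑ k : Fin (p + 1), ∑ I : Fin (p + 1) → ι,
        ((-1) ^ (k : ℕ) * T (b (I k)) (fun a => b (k.removeNth I a))) • genMulti I := by
    rw [Finset.sum_comm, preSymbol]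
    refine Finset.sum_congr rfl fun I _ => ?_
    rw [ContinuousAlternatingMap.alternatizeUncurryFin_apply, Finset.sum_smul]
    refine Finset.sum_congr rfl fun k _ => ?_
    congr 1
    simp
    rfl
  have h2 : ∀ k : Fin (p + 1), ∑ I : Fin (p + 1) → ι,
        ((-1) ^ (k : ℕ) * T (b (I k)) (fun a => b (k.removeNth I a))) • genMulti I =
      ∑ j, gen j * preSymbol b (T (b j)) := by
    intro k
    rw [← Equiv.sum_comp (Fin.insertNthEquiv (fun _ => ι) k), ← Finset.univ_product_univ,
      Finset.sum_product]
    refine Finset.sum_congr rfl fun j _ => ?_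
    rw [preSymbol, Finset.mul_sum]
    refine Finset.sum_congr rfl fun I _ => ?_
    have e : Fin.insertNthEquiv (fun _ => ι) k (j, I) = k.insertNth j I := rfl
    rw [e, genMulti_insertNth, smul_smul, mul_smul_comm]
    simp only [Fin.insertNth_apply_same, Fin.removeNth_insertNth]
    congr 1
    rw [mul_right_comm, ← pow_add, Even.neg_one_pow ⟨_, rfl⟩, one_mul]
  rw [symbol, h1, Finset.sum_congr rfl fun k _ => h2 k]
  simp only [symbol, mul_smul_comm, ← Finset.smul_sum, Finset.sum_const, Finset.card_univ,
    Fintype.card_fin, ← Nat.cast_smul_eq_nsmul ℂ, smul_smul]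
  congr 1
  rw [Nat.factorial_succ]
  have := Nat.cast_ne_zero (R := ℂ).2 (Nat.factorial_ne_zero p)
  have : ((p : ℂ) + 1) ≠ 0 := Nat.cast_add_one_ne_zero p
  push_cast
  field_simp

/-- For each multi-index `J`, the minor with columns `J` defines a linear functional on the
Grassmann algebra that extracts `p! α(b_J)` from `preSymbol b α`. Hence identities between forms may
be checked on symbols. -/
theorem eq_zero_of_symbol_eq_zero {p : ℕ} {α : V [⋀^Fin p]→L[ℝ] ℂ} (h : symbol b α = 0) :
    α = 0 := by
  have hf := Nat.cast_ne_zero (R := ℂ).2 (Nat.factorial_ne_zero p)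
  have h0 : preSymbol b α = 0 := by
    rw [symbol, smul_eq_zero] at h
    exact h.resolve_left (inv_ne_zero hf)
  have key : ∀ J : Fin p → ι, α (fun a => b (J a)) = 0 := by
    intro J
    let D : (ι → ℂ) [⋀^Fin p]→ₗ[ℂ] ℂ :=
      (Matrix.detRowAlternating (R := ℂ) (n := Fin p)).compLinearMap
        (LinearMap.pi fun a => LinearMap.proj (J a))
    -- The functional is the determinant `D` in degree `p` and zero in every other degree.
    let L : ExteriorAlgebra ℂ (ι → ℂ) →ₗ[ℂ] ℂ :=
      ExteriorAlgebra.liftAlternating fun q => if hq : q = p then hq ▸ D else 0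
    have hL : ∀ I : Fin p → ι, L (genMulti I) =
        ∑ σ : Equiv.Perm (Fin p), if I = J ∘ σ then ((Equiv.Perm.sign σ : ℤ) : ℂ) else 0 := by
      intro I
      have : L (genMulti I) = D (fun a => Pi.single (I a) (1 : ℂ)) := by
        simp [L, genMulti, ExteriorAlgebra.liftAlternating_apply_ιMulti]
      rw [this]
      change Matrix.det (Matrix.of fun a c => (Pi.single (I a) (1 : ℂ) : ι → ℂ) (J c)) = _
      rw [← Matrix.det_transpose, Matrix.det_apply']
      refine Finset.sum_congr rfl fun σ _ => ?_
      split_ifs with hI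
      · rw [hI]; simp [Matrix.transpose]
      · obtain ⟨a, ha⟩ : ∃ a, I a ≠ J (σ a) := by
          by_contra hc
          push Not at hc
          exact hI (funext hc)
        rw [Finset.prod_eq_zero (Finset.mem_univ a), mul_zero]
        simp [Matrix.transpose, Pi.single_apply, ha.symm]
    have h1 : L (preSymbol b α) = (p.factorial : ℂ) * α (fun a => b (J a)) := by
      rw [preSymbol, map_sum]
      simp only [map_smul, hL, smul_eq_mul, Finset.mul_sum]
      rw [Finset.sum_comm]
      have : ∀ σ : Equiv.Perm (Fin p), ∑ I : Fin p → ι, (α (fun a => b (I a)) *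
          if I = J ∘ σ then ((Equiv.Perm.sign σ : ℤ) : ℂ) else 0) = α (fun a => b (J a)) := by
        intro σ
        rw [Finset.sum_eq_single (J ∘ σ) (by intro I _ hI; simp [hI]) (by simp)]
        have := α.toAlternatingMap.map_perm (fun a => b (J a)) σ
        have h2 : α (fun a => b ((J ∘ σ) a)) = Equiv.Perm.sign σ • α (fun a => b (J a)) := this
        rw [h2]
        rcases Int.units_eq_one_or (Equiv.Perm.sign σ) with h | h <;> simp [h]
      rw [Finset.sum_congr rfl fun σ _ => this σ]
      simp [Fintype.card_perm]
    rw [h0, map_zero] at h1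
    exact (mul_eq_zero.1 h1.symm).resolve_left hf
  apply ContinuousAlternatingMap.toAlternatingMap_injective
  exact Module.Basis.ext_alternating b fun v _ => key v

end Grassmann

/-! ### Smooth families of forms: evaluation, pullback and wedge products. -/

section FormSpaces

theorem wedge_apply {V : Type*} [NormedAddCommGroup V] [NormedSpace ℝ V] {p q : ℕ}
    (α : V [⋀^Fin p]→L[ℝ] ℂ) (β : V [⋀^Fin q]→L[ℝ] ℂ)
    (v : Fin (p + q) → V) : wedge α β v = ((1 : ℝ) / (p.factorial * q.factorial)) •
      ∑ σ : Equiv.Perm (Fin (p + q)), Equiv.Perm.sign σ •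
        (α (fun i => v (σ (Fin.castAdd q i))) * β (fun i => v (σ (Fin.natAdd p i)))) := by
  rw [wedge, ContinuousAlternatingMap.smul_apply,
    ContinuousMultilinearMap.alternatization_apply_apply]
  rfl

variable {V : Type*} [NormedAddCommGroup V] [NormedSpace ℝ V] [FiniteDimensional ℝ V]

instance finiteDimensional_forms (p : ℕ) : FiniteDimensional ℝ (V [⋀^Fin p]→L[ℝ] ℂ) := by
  let L : (V [⋀^Fin p]→L[ℝ] ℂ) →ₗ[ℝ] MultilinearMap ℝ (fun _ : Fin p => V) ℂ :=
    { toFun := fun α => α.toMultilinearMap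
      map_add' := fun _ _ => rfl
      map_smul' := fun _ _ => rfl }
  refine FiniteDimensional.of_injective L fun α β h => ?_
  ext v
  exact congrArg (fun T : MultilinearMap ℝ (fun _ : Fin p => V) ℂ => T v) h

/-- A form is determined by its finitely many values on basis tuples, so the evaluation map has a
linear left inverse, which is continuous in finite dimension. -/
theorem contDiffAt_form {E : Type*} [NormedAddCommGroup E] [NormedSpace ℝ E] {p : ℕ}
    {α : E → V [⋀^Fin p]→L[ℝ] ℂ} {m : WithTop ℕ∞} {z : E}
    (h : ∀ v, ContDiffAt ℝ m (fun y => α y v) z) : ContDiffAt ℝ m α z := by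
  let b := Module.finBasis ℝ V
  let L : (V [⋀^Fin p]→L[ℝ] ℂ) →ₗ[ℝ] ((Fin p → Fin (Module.finrank ℝ V)) → ℂ) :=
    { toFun := fun α I => α fun a => b (I a)
      map_add' := fun _ _ => rfl
      map_smul' := fun _ _ => rfl }
  have hL : LinearMap.ker L = ⊥ := by
    rw [LinearMap.ker_eq_bot']
    intro β hβ
    apply ContinuousAlternatingMap.toAlternatingMap_injective
    exact Module.Basis.ext_alternating b fun v _ => congrFun hβ v
  obtain ⟨R, hR⟩ := L.exists_leftInverse_of_injective hL
  have h1 : ContDiffAt ℝ m (fun y => L (α y)) z := contDiffAt_pi.2 fun I => h _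
  have h2 := (LinearMap.toContinuousLinearMap R).contDiff.contDiffAt.comp z h1
  have h3 : (LinearMap.toContinuousLinearMap R ∘ fun y => L (α y)) = α := by
    funext y
    exact LinearMap.congr_fun hR (α y)
  rwa [h3] at h2

theorem contDiffAt_form_apply {E : Type*} [NormedAddCommGroup E] [NormedSpace ℝ E] {p : ℕ}
    {α : E → V [⋀^Fin p]→L[ℝ] ℂ} {m : WithTop ℕ∞} {z : E} (hα : ContDiffAt ℝ m α z)
    (v : Fin p → V) : ContDiffAt ℝ m (fun y => α y v) z := by
  let ev : (V [⋀^Fin p]→L[ℝ] ℂ) →ₗ[ℝ] ℂ :=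
    { toFun := fun β => β v
      map_add' := fun _ _ => rfl
      map_smul' := fun _ _ => rfl }
  exact (LinearMap.toContinuousLinearMap ev).contDiff.contDiffAt.comp z hα

theorem contDiffAt_pullback {E V' : Type*} [NormedAddCommGroup E] [NormedSpace ℝ E]
    [NormedAddCommGroup V'] [NormedSpace ℝ V'] [FiniteDimensional ℝ V'] {p : ℕ}
    {α : E → V' [⋀^Fin p]→L[ℝ] ℂ} {L : E → V →L[ℝ] V'} {m : WithTop ℕ∞} {z : E}
    (hα : ContDiffAt ℝ m α z) (hL : ContDiffAt ℝ m L z) :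
    ContDiffAt ℝ m (fun y => (α y).compContinuousLinearMap (L y)) z := by
  refine contDiffAt_form fun v => ?_
  let b := Module.finBasis ℝ V'
  have h1 : ∀ y, (α y).compContinuousLinearMap (L y) v =
      ∑ I : Fin p → Fin (Module.finrank ℝ V'),
        (∏ a, b.repr (L y (v a)) (I a)) • α y (fun a => b (I a)) := by
    intro y
    have : (α y).compContinuousLinearMap (L y) v = (α y).toMultilinearMap
        fun a => ∑ i, b.repr (L y (v a)) i • b i := by
      simp only [b.sum_repr]
      rfl
    rw [this, MultilinearMap.map_sum]
    refine Finset.sum_congr rfl fun I _ => ?_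
    rw [MultilinearMap.map_smul_univ]
    rfl
  simp only [h1]
  refine ContDiffAt.sum fun I _ => ?_
  have hsm : ∀ {f : E → ℝ} {g : E → ℂ}, ContDiffAt ℝ m f z → ContDiffAt ℝ m g z →
      ContDiffAt ℝ m (fun y => f y • g y) z := fun hf hg => hf.smul hg
  refine hsm (contDiffAt_prod fun a _ => ?_) ?_
  · have h2 : ContDiffAt ℝ m (fun y => L y (v a)) z := hL.clm_apply contDiffAt_const
    exact (LinearMap.toContinuousLinearMap (b.coord (I a))).contDiff.contDiffAt.comp z h2
  · exact contDiffAt_form_apply hα _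

/-- The wedge product as a continuous bilinear map. -/
noncomputable def wedgeL (p q : ℕ) : (V [⋀^Fin p]→L[ℝ] ℂ) →L[ℝ] (V [⋀^Fin q]→L[ℝ] ℂ) →L[ℝ]
    (V [⋀^Fin (p + q)]→L[ℝ] ℂ) :=
  (LinearMap.mk₂ ℝ wedge
    (by intro α α' β; ext v
        simp [wedge_apply, add_mul, Finset.sum_add_distrib])
    (by intro c α β; ext v
        simp only [wedge_apply, ContinuousAlternatingMap.smul_apply, smul_mul_assoc,
          smul_comm _ c, ← Finset.smul_sum])
    (by intro α β β'; ext v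
        simp [wedge_apply, mul_add, Finset.sum_add_distrib])
    (by intro c α β; ext v
        simp only [wedge_apply, ContinuousAlternatingMap.smul_apply, mul_smul_comm,
          smul_comm _ c, ← Finset.smul_sum])).toContinuousBilinearMap

theorem wedgeL_apply {p q : ℕ} (α : V [⋀^Fin p]→L[ℝ] ℂ) (β : V [⋀^Fin q]→L[ℝ] ℂ) :
    wedgeL p q α β = wedge α β := rfl

theorem smul_wedge {V : Type*} [NormedAddCommGroup V] [NormedSpace ℝ V] {p q : ℕ} (c : ℂ)
    (α : V [⋀^Fin p]→L[ℝ] ℂ) (β : V [⋀^Fin q]→L[ℝ] ℂ) :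
    wedge (c • α) β = c • wedge α β := by
  ext v
  simp only [wedge_apply, ContinuousAlternatingMap.smul_apply, smul_mul_assoc,
    smul_comm _ c, ← Finset.smul_sum]

theorem wedge_smul {V : Type*} [NormedAddCommGroup V] [NormedSpace ℝ V] {p q : ℕ} (c : ℂ)
    (α : V [⋀^Fin p]→L[ℝ] ℂ) (β : V [⋀^Fin q]→L[ℝ] ℂ) :
    wedge α (c • β) = c • wedge α β := by
  ext v
  simp only [wedge_apply, ContinuousAlternatingMap.smul_apply, mul_smul_comm,
    smul_comm _ c, ← Finset.smul_sum]

theorem wedge_add_left {p q : ℕ} (α α' : V [⋀^Fin p]→L[ℝ] ℂ) (β : V [⋀^Fin q]→L[ℝ] ℂ) :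
    wedge (α + α') β = wedge α β + wedge α' β := by
  simp only [← wedgeL_apply, map_add, add_apply]

theorem wedge_add_right {p q : ℕ} (α : V [⋀^Fin p]→L[ℝ] ℂ) (β β' : V [⋀^Fin q]→L[ℝ] ℂ) :
    wedge α (β + β') = wedge α β + wedge α β' := by
  simp only [← wedgeL_apply, map_add]

theorem wedge_compContinuousLinearMap {V V' : Type*} [NormedAddCommGroup V] [NormedSpace ℝ V]
    [NormedAddCommGroup V'] [NormedSpace ℝ V'] {p q : ℕ} (α : V [⋀^Fin p]→L[ℝ] ℂ)
    (β : V [⋀^Fin q]→L[ℝ] ℂ) (L : V' →L[ℝ] V) :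
    (wedge α β).compContinuousLinearMap L =
      wedge (α.compContinuousLinearMap L) (β.compContinuousLinearMap L) := by
  ext v
  rw [wedge_apply, ContinuousAlternatingMap.compContinuousLinearMap_apply, wedge_apply]
  rfl

theorem wedgePow_compContinuousLinearMap {V V' : Type*} [NormedAddCommGroup V] [NormedSpace ℝ V]
    [NormedAddCommGroup V'] [NormedSpace ℝ V']
    (α : V [⋀^Fin 2]→L[ℝ] ℂ) (L : V' →L[ℝ] V) (k : ℕ) :
    (wedgePow α k).compContinuousLinearMap L = wedgePow (α.compContinuousLinearMap L) k := by
  induction k with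
  | zero => rfl
  | succ k ih => rw [wedgePow, wedgePow, wedge_compContinuousLinearMap, ih]

theorem contDiffAt_wedge {E : Type*} [NormedAddCommGroup E] [NormedSpace ℝ E] {p q : ℕ}
    {α : E → V [⋀^Fin p]→L[ℝ] ℂ} {β : E → V [⋀^Fin q]→L[ℝ] ℂ} {m : WithTop ℕ∞} {z : E}
    (hα : ContDiffAt ℝ m α z) (hβ : ContDiffAt ℝ m β z) :
    ContDiffAt ℝ m (fun y => wedge (α y) (β y)) z := by
  refine contDiffAt_form fun v => ?_
  simp only [wedge_apply]
  suffices hs : ContDiffAt ℝ m (fun y => ∑ σ : Equiv.Perm (Fin (p + q)), Equiv.Perm.sign σ •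
      (α y (fun i => v (σ (Fin.castAdd q i))) * β y (fun i => v (σ (Fin.natAdd p i))))) z from
    hs.const_smul _
  refine ContDiffAt.sum fun σ _ => ?_
  have h := (contDiffAt_form_apply hα fun i => v (σ (Fin.castAdd q i))).mul
    (contDiffAt_form_apply hβ fun i => v (σ (Fin.natAdd p i)))
  rcases Int.units_eq_one_or (Equiv.Perm.sign σ) with hσ | hσ
  · rw [hσ]
    simpa only [one_smul] using h
  · rw [hσ]
    simpa only [Units.neg_smul, one_smul] using h.neg

theorem contDiffAt_wedgePow {E : Type*} [NormedAddCommGroup E] [NormedSpace ℝ E]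
    {α : E → V [⋀^Fin 2]→L[ℝ] ℂ} {m : WithTop ℕ∞} {z : E} (h : ContDiffAt ℝ m α z) (k : ℕ) :
    ContDiffAt ℝ m (fun y => wedgePow (α y) k) z := by
  induction k with
  | zero => exact contDiffAt_const
  | succ k ih => exact contDiffAt_wedge ih h

end FormSpaces

/-! ### The directional operators behind `∂` (`c = -i`) and `∂̄` (`c = i`). -/

section TypePart

variable {n : ℕ} {F G : Type*} [NormedAddCommGroup F] [NormedSpace ℝ F] [NormedSpace ℂ F]
  [NormedAddCommGroup G] [NormedSpace ℝ G] [NormedSpace ℂ G]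

/-- Multiplication by `i` as a real-linear map. -/
noncomputable def mulI (n : ℕ) : Cn n →L[ℝ] Cn n := Complex.I • ContinuousLinearMap.id ℝ (Cn n)

theorem mulI_apply (v : Cn n) : mulI n v = Complex.I • v := rfl

/-- The part `v ↦ (T v + c T(i v)) / 2` of a real-linear map. -/
noncomputable def typePart (c : ℂ) (T : Cn n →L[ℝ] F) : Cn n →L[ℝ] F :=
  (1 / 2 : ℂ) • (T + c • T.comp (mulI n))

theorem typePart_apply (c : ℂ) (T : Cn n →L[ℝ] F) (v : Cn n) :
    typePart c T v = (1 / 2 : ℂ) • (T v + c • T (Complex.I • v)) := rfl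

/-- The differential operator `(∂_v + c ∂_{i v}) / 2`. -/
noncomputable def pd (c : ℂ) (v : Cn n) (f : Cn n → F) (z : Cn n) : F :=
  typePart c (fderiv ℝ f z) v

theorem pd_eq (c : ℂ) (v : Cn n) (f : Cn n → F) (z : Cn n) :
    pd c v f z = (1 / 2 : ℂ) • (fderiv ℝ f z v + c • fderiv ℝ f z (Complex.I • v)) := rfl

theorem pd_add {c : ℂ} {v : Cn n} {f g : Cn n → F} {z : Cn n} (hf : DifferentiableAt ℝ f z)
    (hg : DifferentiableAt ℝ g z) : pd c v (f + g) z = pd c v f z + pd c v g z := by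
  simp only [pd_eq, fderiv_add hf hg, add_apply, smul_add]
  abel

theorem pd_clm (L : F →L[ℝ] G) (hL : ∀ (c : ℂ) x, L (c • x) = c • L x) {c : ℂ} {v : Cn n}
    {f : Cn n → F} {z : Cn n} (hf : DifferentiableAt ℝ f z) :
    pd c v (fun y => L (f y)) z = L (pd c v f z) := by
  have : fderiv ℝ (fun y => L (f y)) z = L.comp (fderiv ℝ f z) :=
    (L.hasFDerivAt.comp z hf.hasFDerivAt).fderiv
  simp [pd_eq, this, hL]

theorem contDiffAt_pd {c : ℂ} {v : Cn n} {f : Cn n → F} {z : Cn n} {m m' : WithTop ℕ∞}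
    (hf : ContDiffAt ℝ m f z) (hm : m' + 1 ≤ m) : ContDiffAt ℝ m' (pd c v f) z := by
  have h := hf.fderiv_right hm
  simp only [funext (pd_eq c v f)]
  exact ((h.clm_apply contDiffAt_const).add
    ((h.clm_apply contDiffAt_const).const_smul c)).const_smul _

theorem pd_pd {c d : ℂ} {v w : Cn n} {f : Cn n → F} {z : Cn n} (hf : ContDiffAt ℝ 2 f z) :
    pd c v (pd d w f) z = (1 / 4 : ℂ) • (fderiv ℝ (fderiv ℝ f) z v w +
      d • fderiv ℝ (fderiv ℝ f) z v (Complex.I • w) +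
      c • fderiv ℝ (fderiv ℝ f) z (Complex.I • v) w +
      (c * d) • fderiv ℝ (fderiv ℝ f) z (Complex.I • v) (Complex.I • w)) := by
  have hd : DifferentiableAt ℝ (fderiv ℝ f) z :=
    (hf.fderiv_right (m := 1) (by norm_num)).differentiableAt (by norm_num)
  let E : (Cn n →L[ℝ] F) →L[ℝ] F := (1 / 2 : ℂ) •
    (ContinuousLinearMap.apply ℝ F w + d • ContinuousLinearMap.apply ℝ F (Complex.I • w))
  have h1 : pd d w f = fun y => E (fderiv ℝ f y) := rfl
  have h2 : fderiv ℝ (fun y => E (fderiv ℝ f y)) z = E.comp (fderiv ℝ (fderiv ℝ f) z) :=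
    (E.hasFDerivAt.comp z hd.hasFDerivAt).fderiv
  rw [h1, pd_eq, h2]
  simp only [E, ContinuousLinearMap.comp_apply, smul_apply,
    add_apply, ContinuousLinearMap.apply_apply]
  module

theorem pd_pd_swap {c d : ℂ} {v w : Cn n} {f : Cn n → F} {z : Cn n} (hf : ContDiffAt ℝ 2 f z) :
    pd c v (pd d w f) z = pd d w (pd c v f) z := by
  have hs := hf.isSymmSndFDerivAt (by simp)
  rw [pd_pd hf, pd_pd hf, hs.eq w v, hs.eq (Complex.I • w) v, hs.eq w (Complex.I • v),
    hs.eq (Complex.I • w) (Complex.I • v)]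
  module

end TypePart

/-! ### The operators `∂` and `∂̄` on `ℂⁿ`, treated uniformly in the parameter `c`. -/

section FlatD

variable {n p q : ℕ}

/-- The operator `d` with the derivative of the coefficients replaced by its part `typePart c`. -/
noncomputable def flatD (c : ℂ) (α : Cn n → Cn n [⋀^Fin p]→L[ℝ] ℂ) (z : Cn n) :
    Cn n [⋀^Fin (p + 1)]→L[ℝ] ℂ :=
  ContinuousAlternatingMap.alternatizeUncurryFin (typePart c (fderiv ℝ α z))

theorem flatDel_eq (α : Cn n → Cn n [⋀^Fin p]→L[ℝ] ℂ) : flatDel α = flatD (-Complex.I) α := by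
  funext z
  rw [flatDel, flatD]
  congr 1
  ext v : 1
  simp only [linPart, typePart, neg_smul, ← sub_eq_add_neg]
  rfl

theorem alternatizeUncurryFin_smul_complex (c : ℂ) (T : Cn n →L[ℝ] Cn n [⋀^Fin p]→L[ℝ] ℂ) :
    ContinuousAlternatingMap.alternatizeUncurryFin (c • T) =
      c • ContinuousAlternatingMap.alternatizeUncurryFin T := by
  ext v
  simp [ContinuousAlternatingMap.alternatizeUncurryFin_apply, Finset.mul_sum]

theorem flatD_congr {c : ℂ} {α β : Cn n → Cn n [⋀^Fin p]→L[ℝ] ℂ} {z : Cn n}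
    (h : α =ᶠ[nhds z] β) : flatD c α z = flatD c β z := by
  rw [flatD, flatD, h.fderiv_eq]

theorem flatD_add {c : ℂ} {α β : Cn n → Cn n [⋀^Fin p]→L[ℝ] ℂ} {z : Cn n}
    (hα : DifferentiableAt ℝ α z) (hβ : DifferentiableAt ℝ β z) :
    flatD c (fun y => α y + β y) z = flatD c α z + flatD c β z := by
  rw [flatD, fderiv_fun_add hα hβ]
  ext v
  simp only [flatD, ContinuousAlternatingMap.alternatizeUncurryFin_apply, typePart_apply,
    add_apply, ContinuousAlternatingMap.add_apply,
    ContinuousAlternatingMap.smul_apply, ← Finset.sum_add_distrib]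
  refine Finset.sum_congr rfl fun i _ => ?_
  module

theorem flatD_const_smul {c : ℂ} (a : ℂ) {α : Cn n → Cn n [⋀^Fin p]→L[ℝ] ℂ} {z : Cn n}
    (hα : DifferentiableAt ℝ α z) : flatD c (fun y => a • α y) z = a • flatD c α z := by
  rw [flatD, fderiv_fun_const_smul hα, flatD, ← alternatizeUncurryFin_smul_complex]
  congr 1
  ext v : 1
  simp only [typePart_apply, smul_apply]
  module

theorem contDiffAt_flatD {c : ℂ} {α : Cn n → Cn n [⋀^Fin p]→L[ℝ] ℂ} {z : Cn n}
    {m m' : WithTop ℕ∞} (hα : ContDiffAt ℝ m α z) (hm : m' + 1 ≤ m) :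
    ContDiffAt ℝ m' (flatD c α) z := by
  have h := hα.fderiv_right hm
  have h1 : ContDiffAt ℝ m' (fun y => typePart c (fderiv ℝ α y)) z :=
    (h.add ((h.clm_comp contDiffAt_const).const_smul c)).const_smul _
  exact (ContinuousAlternatingMap.alternatizeUncurryFinCLM ℝ (Cn n) ℂ).contDiff.contDiffAt.comp z h1

theorem flatD_flatD {c d : ℂ} {α : Cn n → Cn n [⋀^Fin p]→L[ℝ] ℂ} {z : Cn n}
    (hα : ContDiffAt ℝ 2 α z) (v : Cn n) :
    pd c v (flatD d α) z = ContinuousAlternatingMap.alternatizeUncurryFin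
      (pd c v (fun y => typePart d (fderiv ℝ α y)) z) := by
  have h := hα.fderiv_right (m := 1) (by norm_num)
  have h1 : ContDiffAt ℝ 1 (fun y => typePart d (fderiv ℝ α y)) z :=
    (h.add ((h.clm_comp contDiffAt_const).const_smul d)).const_smul _
  have h2 := pd_clm (c := c) (v := v)
    (ContinuousAlternatingMap.alternatizeUncurryFinCLM ℝ (Cn n) ℂ (n := p))
    (by simp) (h1.differentiableAt (by norm_num))
  exact h2

theorem pd_typePart_fderiv_apply {c d : ℂ} {α : Cn n → Cn n [⋀^Fin p]→L[ℝ] ℂ} {z : Cn n}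
    (hα : ContDiffAt ℝ 2 α z) (v w : Cn n) :
    pd c v (fun y => typePart d (fderiv ℝ α y)) z w = pd c v (pd d w α) z := by
  have h := hα.fderiv_right (m := 1) (by norm_num)
  have h1 : ContDiffAt ℝ 1 (fun y => typePart d (fderiv ℝ α y)) z :=
    (h.add ((h.clm_comp contDiffAt_const).const_smul d)).const_smul _
  exact (pd_clm (ContinuousLinearMap.apply ℝ _ w) (fun _ _ => rfl)
    (h1.differentiableAt (by norm_num))).symm

end FlatD

/-! ### Leibniz rules for symbols and the stability of `∂∂̄a^k = 0` under adding a closed form. -/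

section SymbolCalculus

variable {n p q : ℕ} {ι : Type*} [Fintype ι] [DecidableEq ι] (b : Module.Basis ι ℝ (Cn n))

theorem commute_symbol {x : ExteriorAlgebra ℂ (ι → ℂ)} (hx : ∀ j, Commute (gen j) x)
    (β : Cn n [⋀^Fin p]→L[ℝ] ℂ) : Commute x (symbol b β) := by
  have h : ∀ {q : ℕ} (I : Fin q → ι), Commute x (genMulti I) := by
    intro q
    induction q with
    | zero => intro I; simp [genMulti]
    | succ q ih =>
      intro I
      rw [← Fin.cons_self_tail I, genMulti_cons]
      exact (hx _).symm.mul_right (ih _)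
  exact (Commute.sum_right _ _ _ fun I _ => (h I).smul_right _).smul_right _

theorem gen_commute_symbol_of_even (hp : Even p) (j : ι) (α : Cn n [⋀^Fin p]→L[ℝ] ℂ) :
    Commute (gen j) (symbol b α) := by
  have h : ∀ {q : ℕ} (I : Fin q → ι),
      gen j * genMulti I = (-1 : ℂ) ^ q • (genMulti I * gen j) := by
    intro q
    induction q with
    | zero => intro I; simp [genMulti]
    | succ q ih =>
      intro I
      rw [← Fin.cons_self_tail I, genMulti_cons, ← mul_assoc, gen_mul_gen_swap, neg_mul, mul_assoc,
        ih, mul_smul_comm, pow_succ, mul_neg_one, neg_smul, mul_assoc]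
  refine (Commute.sum_right _ _ _ fun I _ => Commute.smul_right ?_ _).smul_right _
  have := h I
  rwa [hp.neg_one_pow, one_smul] at this

theorem symbol_flatD (c : ℂ) (α : Cn n → Cn n [⋀^Fin p]→L[ℝ] ℂ) (z : Cn n) :
    symbol b (flatD c α z) = ∑ j, gen j * symbol b (pd c (b j) α z) :=
  symbol_alternatizeUncurryFin b _

theorem symbol_flatD_flatD {c d : ℂ} {α : Cn n → Cn n [⋀^Fin p]→L[ℝ] ℂ} {z : Cn n}
    (hα : ContDiffAt ℝ 2 α z) : symbol b (flatD c (flatD d α) z) =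
      ∑ j, ∑ l, gen j * gen l * symbol b (pd c (b j) (pd d (b l) α) z) := by
  rw [symbol_flatD]
  refine Finset.sum_congr rfl fun j _ => ?_
  rw [flatD_flatD hα, symbol_alternatizeUncurryFin, Finset.mul_sum]
  refine Finset.sum_congr rfl fun l _ => ?_
  rw [pd_typePart_fderiv_apply hα, mul_assoc]

/-- The directional operators commute by the symmetry of the second derivative, whereas the
generators anticommute. -/
theorem flatD_flatD_swap {c d : ℂ} {α : Cn n → Cn n [⋀^Fin p]→L[ℝ] ℂ} {z : Cn n}
    (hα : ContDiffAt ℝ 2 α z) : flatD c (flatD d α) z = -flatD d (flatD c α) z := by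
  rw [eq_neg_iff_add_eq_zero]
  apply eq_zero_of_symbol_eq_zero (Module.finBasis ℝ (Cn n))
  rw [symbol_add, symbol_flatD_flatD _ hα, symbol_flatD_flatD _ hα, add_comm, Finset.sum_comm,
    ← Finset.sum_add_distrib]
  refine Finset.sum_eq_zero fun j _ => ?_
  rw [← Finset.sum_add_distrib]
  refine Finset.sum_eq_zero fun l _ => ?_
  rw [pd_pd_swap hα, gen_mul_gen_swap, neg_mul, neg_add_cancel]

theorem flatD_flatD_self {c : ℂ} {α : Cn n → Cn n [⋀^Fin p]→L[ℝ] ℂ} {z : Cn n}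
    (hα : ContDiffAt ℝ 2 α z) : flatD c (flatD c α) z = 0 := by
  have h : flatD c (flatD c α) z = -flatD c (flatD c α) z := flatD_flatD_swap hα
  ext v
  have h2 := congrArg (fun T : Cn n [⋀^Fin (p + 1 + 1)]→L[ℝ] ℂ => T v) h
  exact self_eq_neg.1 h2

theorem pd_wedge {c : ℂ} {v : Cn n} {α : Cn n → Cn n [⋀^Fin p]→L[ℝ] ℂ}
    {β : Cn n → Cn n [⋀^Fin q]→L[ℝ] ℂ} {z : Cn n} (hα : DifferentiableAt ℝ α z)
    (hβ : DifferentiableAt ℝ β z) : pd c v (fun y => wedge (α y) (β y)) z =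
      wedge (pd c v α z) (β z) + wedge (α z) (pd c v β z) := by
  have h : ∀ u, fderiv ℝ (fun y => wedge (α y) (β y)) z u =
      wedge (α z) (fderiv ℝ β z u) + wedge (fderiv ℝ α z u) (β z) := fun u =>
    congrArg (fun T : Cn n →L[ℝ] Cn n [⋀^Fin (p + q)]→L[ℝ] ℂ => T u)
      ((wedgeL p q).hasFDerivAt_of_bilinear hα.hasFDerivAt hβ.hasFDerivAt).fderiv
  rw [pd_eq, pd_eq, pd_eq, h, h, smul_wedge, wedge_smul, wedge_add_left, wedge_add_right,
    smul_wedge, wedge_smul]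
  ext u
  simp only [ContinuousAlternatingMap.smul_apply, ContinuousAlternatingMap.add_apply, smul_eq_mul]
  ring

theorem symbol_flatD_wedge (hp : Even p) {c : ℂ} {α : Cn n → Cn n [⋀^Fin p]→L[ℝ] ℂ}
    {β : Cn n → Cn n [⋀^Fin q]→L[ℝ] ℂ} {z : Cn n} (hα : DifferentiableAt ℝ α z)
    (hβ : DifferentiableAt ℝ β z) : symbol b (flatD c (fun y => wedge (α y) (β y)) z) =
      symbol b (flatD c α z) * symbol b (β z) + symbol b (α z) * symbol b (flatD c β z) := by
  simp only [symbol_flatD, pd_wedge hα hβ, symbol_add, symbol_wedge, Finset.sum_mul,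
    Finset.mul_sum, mul_add, Finset.sum_add_distrib]
  congr 1
  · exact Finset.sum_congr rfl fun j _ => (mul_assoc _ _ _).symm
  · refine Finset.sum_congr rfl fun j _ => ?_
    rw [← mul_assoc, (gen_commute_symbol_of_even b hp j (α z)).eq, mul_assoc]

theorem symbol_flatD_flatD_wedge (hp : Even p) {c d : ℂ} {α : Cn n → Cn n [⋀^Fin p]→L[ℝ] ℂ}
    {β : Cn n → Cn n [⋀^Fin q]→L[ℝ] ℂ} {z : Cn n} (hα : ContDiffAt ℝ 2 α z)
    (hβ : ContDiffAt ℝ 2 β z) :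
    symbol b (flatD c (flatD d (fun y => wedge (α y) (β y))) z) =
      symbol b (flatD c (flatD d α) z) * symbol b (β z) +
        symbol b (flatD c α z) * symbol b (flatD d β z) -
        symbol b (flatD d α z) * symbol b (flatD c β z) +
        symbol b (α z) * symbol b (flatD c (flatD d β) z) := by
  have hw : ContDiffAt ℝ 2 (fun y => wedge (α y) (β y)) z :=
    contDiffAt_wedge hα hβ
  have hα1 := hα.differentiableAt (by norm_num)
  have hβ1 := hβ.differentiableAt (by norm_num)
  have hP : ∀ v w, pd c v (pd d w (fun y => wedge (α y) (β y))) z =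
      wedge (pd c v (pd d w α) z) (β z) + wedge (pd d w α z) (pd c v β z) +
        (wedge (pd c v α z) (pd d w β z) + wedge (α z) (pd c v (pd d w β) z)) := by
    intro v w
    have hev : pd d w (fun y => wedge (α y) (β y)) =ᶠ[nhds z]
        (fun y => wedge (pd d w α y) (β y)) + fun y => wedge (α y) (pd d w β y) := by
      filter_upwards [hα.eventually (by norm_num), hβ.eventually (by norm_num)] with y h1 h2
      exact pd_wedge (h1.differentiableAt (by norm_num)) (h2.differentiableAt (by norm_num))
    have hα2 : DifferentiableAt ℝ (pd d w α) z :=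
      (contDiffAt_pd (m' := 1) hα (by norm_num)).differentiableAt (by norm_num)
    have hβ2 : DifferentiableAt ℝ (pd d w β) z :=
      (contDiffAt_pd (m' := 1) hβ (by norm_num)).differentiableAt (by norm_num)
    have h1 : DifferentiableAt ℝ (fun y => wedge (pd d w α y) (β y)) z :=
      ((wedgeL p q).hasFDerivAt_of_bilinear hα2.hasFDerivAt hβ1.hasFDerivAt).differentiableAt
    have h2 : DifferentiableAt ℝ (fun y => wedge (α y) (pd d w β y)) z :=
      ((wedgeL p q).hasFDerivAt_of_bilinear hα1.hasFDerivAt hβ2.hasFDerivAt).differentiableAt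
    rw [pd, hev.fderiv_eq, ← pd, pd_add h1 h2, pd_wedge hα2 hβ1, pd_wedge hα1 hβ2]
  have e1 : ∑ j, ∑ l, gen j * gen l * (symbol b (pd d (b l) α z) * symbol b (pd c (b j) β z)) =
      -(symbol b (flatD d α z) * symbol b (flatD c β z)) := by
    rw [symbol_flatD, symbol_flatD, Finset.sum_mul_sum, Finset.sum_comm, ← Finset.sum_neg_distrib]
    refine Finset.sum_congr rfl fun l _ => ?_
    rw [← Finset.sum_neg_distrib]
    refine Finset.sum_congr rfl fun j _ => ?_
    rw [gen_mul_gen_swap, neg_mul, mul_assoc, mul_assoc, ← mul_assoc (gen j),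
      (gen_commute_symbol_of_even b hp j _).eq, mul_assoc]
  have e2 : ∑ j, ∑ l, gen j * gen l * (symbol b (pd c (b j) α z) * symbol b (pd d (b l) β z)) =
      symbol b (flatD c α z) * symbol b (flatD d β z) := by
    rw [symbol_flatD, symbol_flatD, Finset.sum_mul_sum]
    refine Finset.sum_congr rfl fun j _ => Finset.sum_congr rfl fun l _ => ?_
    rw [mul_assoc, mul_assoc, ← mul_assoc (gen l),
      (gen_commute_symbol_of_even b hp l _).eq, mul_assoc]
  have e3 : ∑ j, ∑ l, gen j * gen l * (symbol b (pd c (b j) (pd d (b l) α) z) * symbol b (β z)) =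
      symbol b (flatD c (flatD d α) z) * symbol b (β z) := by
    simp only [symbol_flatD_flatD b hα, Finset.sum_mul, mul_assoc]
  have e4 : ∑ j, ∑ l, gen j * gen l * (symbol b (α z) * symbol b (pd c (b j) (pd d (b l) β) z)) =
      symbol b (α z) * symbol b (flatD c (flatD d β) z) := by
    simp only [symbol_flatD_flatD b hβ, Finset.mul_sum]
    refine Finset.sum_congr rfl fun j _ => Finset.sum_congr rfl fun l _ => ?_
    rw [← mul_assoc, (((gen_commute_symbol_of_even b hp j (α z)).mul_left
      (gen_commute_symbol_of_even b hp l (α z)))).eq, mul_assoc]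
  rw [symbol_flatD_flatD b hw]
  simp only [hP, symbol_add, symbol_wedge, mul_add, Finset.sum_add_distrib, e1, e2, e3, e4]
  abel

theorem flatD_constForm {c : ℂ} (β : Cn n [⋀^Fin p]→L[ℝ] ℂ) (z : Cn n) :
    flatD c (fun _ => β) z = 0 := by
  apply eq_zero_of_symbol_eq_zero (Module.finBasis ℝ (Cn n))
  rw [symbol_flatD]
  refine Finset.sum_eq_zero fun j _ => ?_
  simp [pd_eq, symbol_zero]

theorem symbol_flatD_flatD_wedgePow_one {c d : ℂ} {α : Cn n → Cn n [⋀^Fin 2]→L[ℝ] ℂ} {z : Cn n}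
    (hα : ContDiffAt ℝ 2 α z) : symbol b (flatD c (flatD d (fun y => wedgePow (α y) 1)) z) =
      symbol b (flatD c (flatD d α) z) := by
  have h0 : ContDiffAt ℝ 2 (fun y => wedgePow (α y) 0) z := contDiffAt_wedgePow hα 0
  have h := symbol_flatD_flatD_wedge b (c := c) (d := d) ⟨0, rfl⟩ h0 hα
  have h1 : ∀ e, flatD e (fun y => wedgePow (α y) 0) = fun _ => 0 :=
    fun e => funext fun y => flatD_constForm _ y
  rw [h1, h1, flatD_constForm, symbol_wedgePow] at h
  refine Eq.trans h ?_
  simp [symbol_zero]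

/-- The Leibniz rule leaves `d_cα d_dα - d_dα d_cα`, and these two symbols of degree 3 anticommute.
-/
theorem symbol_flatD_flatD_wedgePow_two {c d : ℂ} {α : Cn n → Cn n [⋀^Fin 2]→L[ℝ] ℂ} {z : Cn n}
    (hα : ContDiffAt ℝ 2 α z) (h1 : flatD c (flatD d α) z = 0) :
    symbol b (flatD c (flatD d (fun y => wedgePow (α y) 2)) z) =
      (2 : ℂ) • (symbol b (flatD c α z) * symbol b (flatD d α z)) := by
  have hα1 := hα.differentiableAt (by norm_num)
  have h := symbol_flatD_flatD_wedge b (c := c) (d := d) (by decide)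
    (contDiffAt_wedgePow hα 1) hα
  have hs : ∀ e, symbol b (flatD e (fun y => wedgePow (α y) 1) z) = symbol b (flatD e α z) := by
    intro e
    have := symbol_flatD_wedge b (p := 2 * 0) (c := e) ⟨0, rfl⟩
      (α := fun y => wedgePow (α y) 0) (differentiableAt_const _) hα1
    have h0 : flatD e (fun y => wedgePow (α y) 0) z = 0 := flatD_constForm _ _
    rw [h0, symbol_wedgePow] at this
    refine Eq.trans this ?_
    simp [symbol_zero]
  rw [symbol_flatD_flatD_wedgePow_one b hα, hs, hs, h1] at h
  have hc : symbol b (flatD d α z) * symbol b (flatD c α z) =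
      -(symbol b (flatD c α z) * symbol b (flatD d α z)) := by
    rw [symbol_flatD, symbol_flatD, Finset.sum_mul_sum, Finset.sum_mul_sum, Finset.sum_comm,
      ← Finset.sum_neg_distrib]
    refine Finset.sum_congr rfl fun j _ => ?_
    rw [← Finset.sum_neg_distrib]
    refine Finset.sum_congr rfl fun l _ => ?_
    have hg : ∀ (x : Cn n [⋀^Fin 2]→L[ℝ] ℂ) i, gen i * symbol b x = symbol b x * gen i :=
      fun x i => gen_commute_symbol_of_even b even_two i x
    have hx : ∀ x y : Cn n [⋀^Fin 2]→L[ℝ] ℂ, symbol b x * symbol b y = symbol b y * symbol b x :=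
      fun x y => commute_symbol b (fun i => hg x i) y
    calc gen l * symbol b (pd d (b l) α z) * (gen j * symbol b (pd c (b j) α z))
        = gen l * (symbol b (pd d (b l) α z) * gen j) * symbol b (pd c (b j) α z) := by
          simp only [mul_assoc]
      _ = gen l * gen j * (symbol b (pd d (b l) α z) * symbol b (pd c (b j) α z)) := by
          rw [← hg]; simp only [mul_assoc]
      _ = -(gen j * (gen l * symbol b (pd c (b j) α z)) * symbol b (pd d (b l) α z)) := by
          rw [gen_mul_gen_swap, hx]; simp only [mul_assoc, neg_mul]
      _ = _ := by rw [hg]; simp only [mul_assoc]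
  rw [hc, symbol_zero] at h
  have h2 : (fun y => wedgePow (α y) 2) = fun y => wedge (wedgePow (α y) 1) (α y) := rfl
  rw [h2, h, two_smul]
  simp

/-- In the Leibniz expansion of `α^k ∧ α` every term contains `d_c d_d α^k`, `d_c d_d α`, or a
product of `d_cα` and `d_dα` in one of the two orders. -/
theorem symbol_flatD_flatD_wedgePow_eq_zero {c d : ℂ} {α : Cn n → Cn n [⋀^Fin 2]→L[ℝ] ℂ}
    {z : Cn n} (hα : ContDiffAt ℝ 2 α z) (h1 : flatD c (flatD d α) z = 0)
    (h2 : symbol b (flatD c α z) * symbol b (flatD d α z) = 0)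
    (h3 : symbol b (flatD d α z) * symbol b (flatD c α z) = 0) (k : ℕ) :
    symbol b (flatD c (flatD d (fun y => wedgePow (α y) k)) z) = 0 := by
  have hα1 := hα.differentiableAt (by norm_num)
  -- Morally `Q = k α^(k-1)`. It is essential that the same `Q` serves for all `e`.
  have hQ : ∀ k : ℕ, ∃ Q, ∀ e, symbol b (flatD e (fun y => wedgePow (α y) k) z) =
      Q * symbol b (flatD e α z) := by
    intro k
    induction k with
    | zero =>
      refine ⟨0, fun e => ?_⟩
      have h0 : flatD e (fun y => wedgePow (α y) 0) z = 0 := flatD_constForm _ _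
      rw [h0, symbol_zero, zero_mul]
    | succ k ih =>
      obtain ⟨Q, hQ⟩ := ih
      refine ⟨Q * symbol b (α z) + symbol b (α z) ^ k, fun e => ?_⟩
      have := symbol_flatD_wedge b (c := e) (even_two_mul k)
        ((contDiffAt_wedgePow hα k).differentiableAt (by norm_num)) hα1
      rw [hQ, symbol_wedgePow] at this
      have hc : symbol b (flatD e α z) * symbol b (α z) = symbol b (α z) * symbol b (flatD e α z) :=
        (commute_symbol b (fun i => gen_commute_symbol_of_even b even_two i (α z)) _).symm
      rw [mul_assoc, hc] at this
      rw [add_mul, mul_assoc]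
      exact this
  induction k with
  | zero =>
    have h0 : flatD d (fun y => wedgePow (α y) 0) = fun _ => 0 :=
      funext fun y => flatD_constForm _ y
    rw [h0, flatD_constForm, symbol_zero]
  | succ k ih =>
    obtain ⟨Q, hQ⟩ := hQ k
    have := symbol_flatD_flatD_wedge b (c := c) (d := d) (even_two_mul k)
      (contDiffAt_wedgePow hα k) hα
    rw [ih, hQ, hQ, h1, symbol_zero, mul_assoc, mul_assoc, h2, h3] at this
    refine Eq.trans this ?_
    simp

/-- If `∂∂̄ a = 0`, `∂∂̄ a² = 0` and `t` is closed, then `∂∂̄ (C a + t)^k = 0`. -/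
theorem flatD_flatD_wedgePow_add_eq_zero {c d : ℂ} {a t : Cn n → Cn n [⋀^Fin 2]→L[ℝ] ℂ} {z : Cn n}
    (ha : ContDiffAt ℝ 2 a z) (ht : ContDiffAt ℝ 2 t z) (C : ℂ) {k m : ℕ} (hk : 1 ≤ k)
    (hkm : k ≤ m)
    (h : ∀ k, 1 ≤ k → k ≤ m → flatD c (flatD d (fun y => wedgePow (a y) k)) z = 0)
    (hc : flatD c t z = 0) (hd : flatD d t =ᶠ[nhds z] 0) :
    flatD c (flatD d (fun y => wedgePow (C • a y + t y) k)) z = 0 := by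
  let b := Module.finBasis ℝ (Cn n)
  have hat : ContDiffAt ℝ 2 (fun y => C • a y + t y) z := (ha.const_smul C).add ht
  have ha0 : flatD c (flatD d a) z = 0 := by
    apply eq_zero_of_symbol_eq_zero b
    rw [← symbol_flatD_flatD_wedgePow_one b ha, h 1 le_rfl (hk.trans hkm), symbol_zero]
  have hev : flatD d (fun y => C • a y + t y) =ᶠ[nhds z] fun y => C • flatD d a y := by
    filter_upwards [hd, ha.eventually (by norm_num), ht.eventually (by norm_num)] with y h1 h2 h3
    have h2' := h2.differentiableAt (by norm_num)
    rw [flatD_add (h2'.fun_const_smul C) (h3.differentiableAt (by norm_num)), flatD_const_smul C h2',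
      h1]
    simp
  have h1 : flatD c (flatD d (fun y => C • a y + t y)) z = 0 := by
    rw [flatD_congr hev, flatD_const_smul C
      ((contDiffAt_flatD (m' := 1) ha (by norm_num)).differentiableAt (by norm_num)), ha0]
    ext v
    simp
  apply eq_zero_of_symbol_eq_zero b
  -- The case `k = 1` is separate: when `m = 1` nothing is assumed about `a²`, and nothing is
  -- needed.
  rcases eq_or_lt_of_le hk with rfl | hk2
  · rw [symbol_flatD_flatD_wedgePow_one b hat, h1, symbol_zero]
  have hcd : symbol b (flatD c a z) * symbol b (flatD d a z) = 0 := by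
    have h2 := symbol_flatD_flatD_wedgePow_two b ha ha0
    rw [h 2 (by norm_num) (le_trans hk2 hkm), symbol_zero] at h2
    exact (smul_eq_zero.1 h2.symm).resolve_left two_ne_zero
  -- Exchanging `c` and `d` only changes the sign of `d_c d_d`, so the same argument gives the
  -- product in the opposite order.
  have hdc : symbol b (flatD d a z) * symbol b (flatD c a z) = 0 := by
    have ha0' : flatD d (flatD c a) z = 0 := by rw [flatD_flatD_swap ha, ha0, neg_zero]
    have h2 := symbol_flatD_flatD_wedgePow_two b ha ha0'
    rw [flatD_flatD_swap (contDiffAt_wedgePow ha 2), h 2 (by norm_num) (le_trans hk2 hkm),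
      neg_zero, symbol_zero] at h2
    exact (smul_eq_zero.1 h2.symm).resolve_left two_ne_zero
  have hfc : flatD c (fun y => C • a y + t y) z = C • flatD c a z := by
    have h2' := ha.differentiableAt (by norm_num)
    rw [flatD_add (h2'.fun_const_smul C) (ht.differentiableAt (by norm_num)), flatD_const_smul C h2',
      hc, add_zero]
  refine symbol_flatD_flatD_wedgePow_eq_zero b hat h1 ?_ ?_ k
  · rw [hfc, hev.eq_of_nhds, symbol_smul, symbol_smul, smul_mul_smul_comm, hcd, smul_zero]
  · rw [hfc, hev.eq_of_nhds, symbol_smul, symbol_smul, smul_mul_smul_comm, hdc, smul_zero]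

end SymbolCalculus

/-! ### `∂` and `∂̄` commute with holomorphic pullback. -/

section Pullback

variable {n p : ℕ}

/-- The derivative of the pulled-back form has a term with the second derivative `S` of `τ`. It
enters through `S(v, w)` and `S(iv, w)`. Both are symmetric, the latter because `S` is complex
linear in its second argument by holomorphy, so alternatization kills them. -/
theorem flatD_pullback {c : ℂ} {α : Cn n → Cn n [⋀^Fin p]→L[ℝ] ℂ} {τ : Cn n → Cn n} {z : Cn n}
    (hα : DifferentiableAt ℝ α (τ z)) (hτ : ContDiffAt ℂ 2 τ z) :
    flatD c (fun y => (α (τ y)).compContinuousLinearMap (fderiv ℝ τ y)) z =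
      (flatD c α (τ z)).compContinuousLinearMap (fderiv ℝ τ z) := by
  have hτR : ContDiffAt ℝ 2 τ z := hτ.restrict_scalars ℝ
  have hdτ := hτR.differentiableAt (by norm_num)
  have hd2 : DifferentiableAt ℝ (fderiv ℝ τ) z :=
    (hτR.fderiv_right (m := 1) (by norm_num)).differentiableAt (by norm_num)
  have hI : ∀ᶠ y in nhds z, ∀ v, fderiv ℝ τ y (Complex.I • v) = Complex.I • fderiv ℝ τ y v := by
    filter_upwards [hτ.eventually (by norm_num)] with y hy v
    have h := hy.differentiableAt (by norm_num)
    have h' : fderiv ℝ τ y = (fderiv ℂ τ y).restrictScalars ℝ := h.fderiv_restrictScalars ℝ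
    rw [h']
    exact (fderiv ℂ τ y).map_smul Complex.I v
  have hsym := hτR.isSymmSndFDerivAt (by simp)
  have hS : ∀ v w, fderiv ℝ (fderiv ℝ τ) z v (Complex.I • w) =
      Complex.I • fderiv ℝ (fderiv ℝ τ) z v w := by
    intro v w
    have h1 : fderiv ℝ (fun y => fderiv ℝ τ y (Complex.I • w)) z =
        (ContinuousLinearMap.apply ℝ (Cn n) (Complex.I • w)).comp (fderiv ℝ (fderiv ℝ τ) z) :=
      ((ContinuousLinearMap.apply ℝ (Cn n) (Complex.I • w)).hasFDerivAt.comp z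
        hd2.hasFDerivAt).fderiv
    have h2 : fderiv ℝ (fun y => Complex.I • fderiv ℝ τ y w) z =
        ((mulI n).comp (ContinuousLinearMap.apply ℝ (Cn n) w)).comp (fderiv ℝ (fderiv ℝ τ) z) :=
      (((mulI n).comp (ContinuousLinearMap.apply ℝ (Cn n) w)).hasFDerivAt.comp z
        hd2.hasFDerivAt).fderiv
    have h3 : (fun y => fderiv ℝ τ y (Complex.I • w)) =ᶠ[nhds z]
        fun y => Complex.I • fderiv ℝ τ y w := hI.mono fun y hy => hy w
    have h4 := h3.fderiv_eq (𝕜 := ℝ)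
    rw [h1, h2] at h4
    exact congrArg (fun T : Cn n →L[ℝ] Cn n => T v) h4
  set S := fderiv ℝ (fderiv ℝ τ) z with hSdef
  have hsI : ∀ v w, S.comp (mulI n) v w = S.comp (mulI n) w v := by
    intro v w
    change S (Complex.I • v) w = S (Complex.I • w) v
    have hs : ∀ x y, S x y = S y x := hsym.eq
    rw [hs, hS, hs w v, ← hS, hs]
  have hαc : fderiv ℝ (fun y => α (τ y)) z = (fderiv ℝ α (τ z)).comp (fderiv ℝ τ z) :=
    fderiv_comp z hα hdτ
  have hfd := fderiv_continuousAlternatingMapCompContinuousLinearMap (f := fun y => α (τ y))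
    (hα.comp z hdτ) hd2
  rw [flatD, hfd, hαc]
  have hsplit : typePart c (ContinuousAlternatingMap.compContinuousLinearMapCLM (fderiv ℝ τ z) ∘L
        (fderiv ℝ α (τ z)).comp (fderiv ℝ τ z) +
        (α (τ z)).fderivCompContinuousLinearMap (fderiv ℝ τ z) ∘L S) =
      (ContinuousAlternatingMap.compContinuousLinearMapCLM (fderiv ℝ τ z) ∘L
        (typePart c (fderiv ℝ α (τ z))).comp (fderiv ℝ τ z)) +
      (1 / 2 : ℂ) • ((α (τ z)).fderivCompContinuousLinearMap (fderiv ℝ τ z) ∘L S +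
        c • ((α (τ z)).fderivCompContinuousLinearMap (fderiv ℝ τ z) ∘L (S.comp (mulI n)))) := by
    ext v w
    simp [typePart_apply, mulI_apply, hI.self_of_nhds]
    ring
  rw [hsplit, ContinuousAlternatingMap.alternatizeUncurryFin_add, alternatizeUncurryFin_smul_complex,
    ContinuousAlternatingMap.alternatizeUncurryFin_add, alternatizeUncurryFin_smul_complex,
    ContinuousAlternatingMap.alternatizeUncurryFin_fderivCompContinuousLinearMap_eq_zero _ _ hsym.eq,
    ContinuousAlternatingMap.alternatizeUncurryFin_fderivCompContinuousLinearMap_eq_zero _ _ hsI]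
  simp only [smul_zero, add_zero]
  ext v
  simp +unfoldPartialApp [flatD, ContinuousAlternatingMap.alternatizeUncurryFin_apply,
    Fin.removeNth, Function.comp_def]

end Pullback

/-! ### Forms on manifolds: chart expressions, smoothness, and independence of the chart. -/

section Charts

variable {n k : ℕ} {X X' : Type*}
  [TopologicalSpace X] [ChartedSpace (Cn n) X]
  [TopologicalSpace X'] [ChartedSpace (Cn n) X']

/-- The pullback of a form under a map. -/
noncomputable def pullForm (μ : X' → X) (η : DForm n X k) : DForm n X' k := fun x =>
  (η (μ x)).compContinuousLinearMap ((mfderiv 𝓘(ℂ, Cn n) 𝓘(ℂ, Cn n) μ x).restrictScalars ℝ)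

theorem contDiffAt_chart {μ : X' → X} {c : OpenPartialHomeomorph X' (Cn n)}
    {e : OpenPartialHomeomorph X (Cn n)} (hc : c ∈ IsManifold.maximalAtlas 𝓘(ℂ, Cn n) ω X')
    (he : e ∈ IsManifold.maximalAtlas 𝓘(ℂ, Cn n) ω X) {u : Cn n} (hu : u ∈ c.target)
    (hμ : ContMDiffAt 𝓘(ℂ, Cn n) 𝓘(ℂ, Cn n) ω μ (c.symm u)) (hμu : μ (c.symm u) ∈ e.source) :
    ContDiffAt ℂ ω (fun y => e (μ (c.symm y))) u := by
  rw [← contMDiffAt_iff_contDiffAt]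
  have h1 : ContMDiffAt 𝓘(ℂ, Cn n) 𝓘(ℂ, Cn n) ω c.symm u :=
    (contMDiffOn_symm_of_mem_maximalAtlas hc).contMDiffAt (c.open_target.mem_nhds hu)
  have h2 : ContMDiffAt 𝓘(ℂ, Cn n) 𝓘(ℂ, Cn n) ω e (μ (c.symm u)) :=
    (contMDiffOn_of_mem_maximalAtlas he).contMDiffAt (e.open_source.mem_nhds hμu)
  exact h2.comp u (hμ.comp u h1)

theorem eventually_mem_source {X X' : Type*} [TopologicalSpace X] [TopologicalSpace X']
    {μ : X' → X} {c : OpenPartialHomeomorph X' (Cn n)}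
    {e : OpenPartialHomeomorph X (Cn n)} {u : Cn n} (hu : u ∈ c.target)
    (hμ : ContinuousAt μ (c.symm u)) (hμu : μ (c.symm u) ∈ e.source) :
    ∀ᶠ y in nhds u, y ∈ c.target ∧ μ (c.symm y) ∈ e.source :=
  Filter.Eventually.and (c.open_target.mem_nhds hu)
    ((ContinuousAt.comp (f := c.symm) hμ (c.continuousAt_symm hu)).eventually
      (e.open_source.mem_nhds hμu))

theorem chartRep_pullForm {μ : X' → X} (η : DForm n X k) {c : OpenPartialHomeomorph X' (Cn n)}
    {e : OpenPartialHomeomorph X (Cn n)} (hc : c ∈ IsManifold.maximalAtlas 𝓘(ℂ, Cn n) ω X')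
    (he : e ∈ IsManifold.maximalAtlas 𝓘(ℂ, Cn n) ω X) {u : Cn n} (hu : u ∈ c.target)
    (hμ : ContMDiffAt 𝓘(ℂ, Cn n) 𝓘(ℂ, Cn n) ω μ (c.symm u)) (hμu : μ (c.symm u) ∈ e.source) :
    chartRep c (pullForm μ η) u = (chartRep e η (e (μ (c.symm u)))).compContinuousLinearMap
      (fderiv ℝ (fun y => e (μ (c.symm y))) u) := by
  have hτ := contDiffAt_chart hc he hu hμ hμu
  have h1 : MDifferentiableAt 𝓘(ℂ, Cn n) 𝓘(ℂ, Cn n) c.symm u :=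
    ((contMDiffOn_symm_of_mem_maximalAtlas hc).contMDiffAt
      (c.open_target.mem_nhds hu)).mdifferentiableAt (by simp)
  have h2 : MDifferentiableAt 𝓘(ℂ, Cn n) 𝓘(ℂ, Cn n) e.symm (e (μ (c.symm u))) :=
    ((contMDiffOn_symm_of_mem_maximalAtlas he).contMDiffAt
      (e.open_target.mem_nhds (e.map_source hμu))).mdifferentiableAt (by simp)
  have h3 : DifferentiableAt ℂ (fun y => e (μ (c.symm y))) u := hτ.differentiableAt (by simp)
  have hev : e.symm ∘ (fun y => e (μ (c.symm y))) =ᶠ[nhds u] μ ∘ c.symm := by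
    filter_upwards [eventually_mem_source hu hμ.continuousAt hμu] with y hy
    exact e.left_inv hy.2
  have hd : fderiv ℝ (fun y => e (μ (c.symm y))) u =
      (fderiv ℂ (fun y => e (μ (c.symm y))) u).restrictScalars ℝ :=
    h3.fderiv_restrictScalars ℝ
  have key : (mfderiv 𝓘(ℂ, Cn n) 𝓘(ℂ, Cn n) e.symm (e (μ (c.symm u)))).comp
      (mfderiv 𝓘(ℂ, Cn n) 𝓘(ℂ, Cn n) (fun y => e (μ (c.symm y))) u) =
      ((mfderiv 𝓘(ℂ, Cn n) 𝓘(ℂ, Cn n) μ (c.symm u)).comp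
        (mfderiv 𝓘(ℂ, Cn n) 𝓘(ℂ, Cn n) c.symm u) : Cn n →L[ℂ] Cn n) := by
    have e1 := mfderiv_comp u h2 h3.mdifferentiableAt
    have e2 := mfderiv_comp u (hμ.mdifferentiableAt (by simp)) h1
    exact e1.symm.trans (hev.mfderiv_eq.trans e2)
  rw [mfderiv_eq_fderiv] at key
  -- All tangent spaces are definitionally the model space, so forms at `x` and `y` can be compared
  -- without transport; this sidesteps rewriting inside a dependent type.
  have hη : ∀ x y : X, x = y → (η x : Cn n [⋀^Fin k]→L[ℝ] ℂ) = η y := by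
    rintro x _ rfl; rfl
  ext v
  have hv : ∀ w : Cn n, mfderiv 𝓘(ℂ, Cn n) 𝓘(ℂ, Cn n) e.symm (e (μ (c.symm u)))
      (fderiv ℝ (fun y => e (μ (c.symm y))) u w) =
      mfderiv 𝓘(ℂ, Cn n) 𝓘(ℂ, Cn n) μ (c.symm u) (mfderiv 𝓘(ℂ, Cn n) 𝓘(ℂ, Cn n) c.symm u w) := by
    intro w
    rw [hd]
    exact congrArg (fun T : Cn n →L[ℂ] Cn n => T w) key
  change (η (μ (c.symm u)) : Cn n [⋀^Fin k]→L[ℝ] ℂ) (fun a =>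
      mfderiv 𝓘(ℂ, Cn n) 𝓘(ℂ, Cn n) μ (c.symm u) (mfderiv 𝓘(ℂ, Cn n) 𝓘(ℂ, Cn n) c.symm u (v a))) =
    (η (e.symm (e (μ (c.symm u)))) : Cn n [⋀^Fin k]→L[ℝ] ℂ) (fun a =>
      mfderiv 𝓘(ℂ, Cn n) 𝓘(ℂ, Cn n) e.symm (e (μ (c.symm u)))
      (fderiv ℝ (fun y => e (μ (c.symm y))) u (v a)))
  rw [hη _ _ (e.left_inv hμu)]
  exact congrArg (η (μ (c.symm u)) : Cn n [⋀^Fin k]→L[ℝ] ℂ) (funext fun a => (hv (v a)).symm)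

theorem pullForm_id (η : DForm n X k) : pullForm id η = η := by
  funext x
  rw [pullForm, mfderiv_id]
  rfl

/-- A change of charts is treated as the pullback under the identity map. -/
theorem chartRep_change (η : DForm n X k) {c e : OpenPartialHomeomorph X (Cn n)}
    (hc : c ∈ IsManifold.maximalAtlas 𝓘(ℂ, Cn n) ω X)
    (he : e ∈ IsManifold.maximalAtlas 𝓘(ℂ, Cn n) ω X) {u : Cn n} (hu : u ∈ c.target)
    (hue : c.symm u ∈ e.source) :
    chartRep c η u = (chartRep e η (e (c.symm u))).compContinuousLinearMap
      (fderiv ℝ (fun y => e (c.symm y)) u) := by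
  have := chartRep_pullForm (μ := id) η hc he hu contMDiffAt_id hue
  rwa [pullForm_id] at this

/-- Smoothness of a form at a point. -/
def SmoothFormAt (η : DForm n X k) (x : X) : Prop :=
  ∀ e ∈ IsManifold.maximalAtlas 𝓘(ℂ, Cn n) ω X, x ∈ e.source →
    ContDiffAt ℝ ∞ (chartRep e η) (e x)

theorem contDiffAt_chartRep_pullForm {μ : X' → X} {η : DForm n X k}
    {c : OpenPartialHomeomorph X' (Cn n)} {e : OpenPartialHomeomorph X (Cn n)}
    (hc : c ∈ IsManifold.maximalAtlas 𝓘(ℂ, Cn n) ω X')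
    (he : e ∈ IsManifold.maximalAtlas 𝓘(ℂ, Cn n) ω X) {u : Cn n} (hu : u ∈ c.target)
    (hμ : ContMDiff 𝓘(ℂ, Cn n) 𝓘(ℂ, Cn n) ω μ) (hμu : μ (c.symm u) ∈ e.source)
    (hη : ContDiffAt ℝ ∞ (chartRep e η) (e (μ (c.symm u)))) :
    ContDiffAt ℝ ∞ (chartRep c (pullForm μ η)) u := by
  have hτ : ContDiffAt ℝ ω (fun y => e (μ (c.symm y))) u :=
    (contDiffAt_chart hc he hu (hμ _) hμu).restrict_scalars ℝ
  have hev : chartRep c (pullForm μ η) =ᶠ[nhds u] fun y =>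
      (chartRep e η (e (μ (c.symm y)))).compContinuousLinearMap
        (fderiv ℝ (fun y => e (μ (c.symm y))) y) := by
    filter_upwards [eventually_mem_source hu (hμ _).continuousAt hμu] with y hy
    exact chartRep_pullForm η hc he hy.1 (hμ _) hy.2
  refine ContDiffAt.congr_of_eventuallyEq ?_ hev
  exact contDiffAt_pullback (hη.comp u (hτ.of_le (by simp))) (hτ.fderiv_right (by simp))

theorem smoothFormAt_of_chart {η : DForm n X k} {e : OpenPartialHomeomorph X (Cn n)}
    (he : e ∈ IsManifold.maximalAtlas 𝓘(ℂ, Cn n) ω X) {x : X} (hx : x ∈ e.source)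
    (h : ContDiffAt ℝ ∞ (chartRep e η) (e x)) : SmoothFormAt η x := by
  intro c hc hxc
  have := contDiffAt_chartRep_pullForm (μ := id) (η := η) hc he (c.map_source hxc) contMDiff_id
    (by rwa [id, c.left_inv hxc]) (by rwa [id, c.left_inv hxc])
  rwa [pullForm_id] at this

theorem SmoothFormAt.pullForm [IsManifold 𝓘(ℂ, Cn n) ω X] {μ : X' → X} {η : DForm n X k} {x : X'}
    (hμ : ContMDiff 𝓘(ℂ, Cn n) 𝓘(ℂ, Cn n) ω μ) (h : SmoothFormAt η (μ x)) :
    SmoothFormAt (pullForm μ η) x := by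
  intro c hc hxc
  have he := IsManifold.chart_mem_maximalAtlas (I := 𝓘(ℂ, Cn n)) (n := ω) (μ x)
  have hs := mem_chart_source (Cn n) (μ x)
  exact contDiffAt_chartRep_pullForm hc he (c.map_source hxc) hμ
    (by rwa [c.left_inv hxc]) (by rw [c.left_inv hxc]; exact h _ he hs)

theorem isSmoothForm_iff {η : DForm n X k} : IsSmoothForm η ↔ ∀ x, SmoothFormAt η x := by
  constructor
  · intro h x e he hx
    exact (h e he).contDiffAt (e.open_target.mem_nhds (e.map_source hx))
  · intro h e he z hz
    have := h (e.symm z) e he (e.map_target hz)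
    rw [e.right_inv hz] at this
    exact this.contDiffWithinAt

/-- The operator `flatD c` on a manifold, computed at `x` in the preferred chart at `x`. -/
noncomputable def formD (c : ℂ) (η : DForm n X k) : DForm n X (k + 1) := fun x =>
  (flatD c (chartRep (chartAt (Cn n) x) η) (chartAt (Cn n) x x)).compContinuousLinearMap
    ((mfderiv 𝓘(ℂ, Cn n) 𝓘(ℂ, Cn n) (chartAt (Cn n) x) x).restrictScalars ℝ)

theorem del_eq (η : DForm n X k) : del η = formD (-Complex.I) η := by
  funext x; rw [del, flatDel_eq]; rfl

theorem delbar_eq (η : DForm n X k) : delbar η = formD Complex.I η := rfl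

theorem mfderiv_chart_comp_symm {c e : OpenPartialHomeomorph X (Cn n)}
    (hc : c ∈ IsManifold.maximalAtlas 𝓘(ℂ, Cn n) ω X)
    (he : e ∈ IsManifold.maximalAtlas 𝓘(ℂ, Cn n) ω X) {z : Cn n} (hz : z ∈ c.target)
    (hze : c.symm z ∈ e.source) (w : Cn n) : mfderiv 𝓘(ℂ, Cn n) 𝓘(ℂ, Cn n) e (c.symm z)
      (mfderiv 𝓘(ℂ, Cn n) 𝓘(ℂ, Cn n) c.symm z w) = fderiv ℝ (fun y => e (c.symm y)) z w := by
  have h1 : MDifferentiableAt 𝓘(ℂ, Cn n) 𝓘(ℂ, Cn n) c.symm z :=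
    ((contMDiffOn_symm_of_mem_maximalAtlas hc).contMDiffAt
      (c.open_target.mem_nhds hz)).mdifferentiableAt (by simp)
  have h2 : MDifferentiableAt 𝓘(ℂ, Cn n) 𝓘(ℂ, Cn n) e (c.symm z) :=
    ((contMDiffOn_of_mem_maximalAtlas he).contMDiffAt
      (e.open_source.mem_nhds hze)).mdifferentiableAt (by simp)
  have h3 : DifferentiableAt ℂ (fun y => e (c.symm y)) z :=
    (contDiffAt_chart (μ := id) hc he hz contMDiffAt_id hze).differentiableAt (by simp)
  have hd : fderiv ℝ (fun y => e (c.symm y)) z =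
      (fderiv ℂ (fun y => e (c.symm y)) z).restrictScalars ℝ := h3.fderiv_restrictScalars ℝ
  have e1 := mfderiv_comp z h2 h1
  rw [hd, ← mfderiv_eq_fderiv]
  exact (congrArg (fun T : Cn n →L[ℂ] Cn n => T w) e1).symm

theorem mfderiv_symm_comp_chart {e : OpenPartialHomeomorph X (Cn n)}
    (he : e ∈ IsManifold.maximalAtlas 𝓘(ℂ, Cn n) ω X) {x : X} (hx : x ∈ e.source) (w : Cn n) :
    mfderiv 𝓘(ℂ, Cn n) 𝓘(ℂ, Cn n) e.symm (e x) (mfderiv 𝓘(ℂ, Cn n) 𝓘(ℂ, Cn n) e x w) = w := by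
  have h1 : MDifferentiableAt 𝓘(ℂ, Cn n) 𝓘(ℂ, Cn n) e.symm (e x) :=
    ((contMDiffOn_symm_of_mem_maximalAtlas he).contMDiffAt
      (e.open_target.mem_nhds (e.map_source hx))).mdifferentiableAt (by simp)
  have h2 : MDifferentiableAt 𝓘(ℂ, Cn n) 𝓘(ℂ, Cn n) e x :=
    ((contMDiffOn_of_mem_maximalAtlas he).contMDiffAt
      (e.open_source.mem_nhds hx)).mdifferentiableAt (by simp)
  have e1 := mfderiv_comp x h1 h2
  have hev : e.symm ∘ e =ᶠ[nhds x] id := by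
    filter_upwards [e.open_source.mem_nhds hx] with y hy
    exact e.left_inv hy
  rw [hev.mfderiv_eq, mfderiv_id] at e1
  exact (congrArg (fun T : Cn n →L[ℂ] Cn n => T w) e1).symm

theorem form_eq_chartRep (η : DForm n X k) {e : OpenPartialHomeomorph X (Cn n)}
    (he : e ∈ IsManifold.maximalAtlas 𝓘(ℂ, Cn n) ω X) {x : X} (hx : x ∈ e.source)
    (v : Fin k → Cn n) : (η x : Cn n [⋀^Fin k]→L[ℝ] ℂ) v =
      chartRep e η (e x) fun a => mfderiv 𝓘(ℂ, Cn n) 𝓘(ℂ, Cn n) e x (v a) := by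
  have hη : ∀ x y : X, x = y → (η x : Cn n [⋀^Fin k]→L[ℝ] ℂ) = η y := by
    rintro x _ rfl; rfl
  change _ = (η (e.symm (e x)) : Cn n [⋀^Fin k]→L[ℝ] ℂ) fun a =>
    mfderiv 𝓘(ℂ, Cn n) 𝓘(ℂ, Cn n) e.symm (e x) (mfderiv 𝓘(ℂ, Cn n) 𝓘(ℂ, Cn n) e x (v a))
  rw [hη _ _ (e.left_inv hx)]
  exact congrArg (η x : Cn n [⋀^Fin k]→L[ℝ] ℂ)
    (funext fun a => (mfderiv_symm_comp_chart he hx (v a)).symm)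

theorem form_eq_zero_of_chartRep {η : DForm n X k} {e : OpenPartialHomeomorph X (Cn n)}
    (he : e ∈ IsManifold.maximalAtlas 𝓘(ℂ, Cn n) ω X) {x : X} (hx : x ∈ e.source)
    (h : chartRep e η (e x) = 0) : η x = 0 := by
  ext v
  refine (form_eq_chartRep η he hx v).trans ?_
  rw [h]; rfl

/-- `formD` uses a chart that varies with the point. Since `flatD` commutes with holomorphic
transition maps, any fixed chart computes it, which is what allows the operators to be iterated. -/
theorem chartRep_formD [IsManifold 𝓘(ℂ, Cn n) ω X] {d : ℂ} {η : DForm n X k}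
    {c : OpenPartialHomeomorph X (Cn n)}
    (hc : c ∈ IsManifold.maximalAtlas 𝓘(ℂ, Cn n) ω X) {z : Cn n} (hz : z ∈ c.target)
    (hη : SmoothFormAt η (c.symm z)) : chartRep c (formD d η) z = flatD d (chartRep c η) z := by
  have he := IsManifold.chart_mem_maximalAtlas (I := 𝓘(ℂ, Cn n)) (n := ω) (c.symm z)
  have hs := mem_chart_source (Cn n) (c.symm z)
  have hη' := hη _ he hs
  set e := chartAt (Cn n) (c.symm z) with he_def
  have hτ : ContDiffAt ℂ ω (fun y => e (c.symm y)) z :=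
    contDiffAt_chart (μ := id) hc he hz contMDiffAt_id hs
  have hev : chartRep c η =ᶠ[nhds z] fun y => (chartRep e η (e (c.symm y))).compContinuousLinearMap
      (fderiv ℝ (fun y => e (c.symm y)) y) := by
    filter_upwards [eventually_mem_source (μ := id) hz continuousAt_id hs] with y hy
    exact chartRep_change η hc he hy.1 hy.2
  rw [flatD_congr hev, flatD_pullback (hη'.differentiableAt (by simp))
    (hτ.of_le (by simp))]
  ext v
  exact congrArg (flatD d (chartRep e η) (e (c.symm z)))
    (funext fun a => mfderiv_chart_comp_symm hc he hz hs (v a))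

theorem chartRep_formD_eventuallyEq [IsManifold 𝓘(ℂ, Cn n) ω X] {d : ℂ} {η : DForm n X k}
    {c : OpenPartialHomeomorph X (Cn n)}
    (hc : c ∈ IsManifold.maximalAtlas 𝓘(ℂ, Cn n) ω X) {x : X} (hx : x ∈ c.source)
    (hη : ∀ᶠ y in nhds x, SmoothFormAt η y) :
    chartRep c (formD d η) =ᶠ[nhds (c x)] flatD d (chartRep c η) := by
  have h1 : ∀ᶠ z in nhds (c x), SmoothFormAt η (c.symm z) :=
    (c.continuousAt_symm (c.map_source hx)).eventually (by rwa [c.left_inv hx])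
  filter_upwards [h1, c.open_target.mem_nhds (c.map_source hx)] with z hz hzt
  exact chartRep_formD hc hzt hz

theorem SmoothFormAt.formD [IsManifold 𝓘(ℂ, Cn n) ω X] {d : ℂ} {η : DForm n X k} {x : X}
    (hη : ∀ᶠ y in nhds x, SmoothFormAt η y) : SmoothFormAt (formD d η) x := by
  intro c hc hx
  exact (contDiffAt_flatD (hη.self_of_nhds c hc hx) (by simp)).congr_of_eventuallyEq
    (chartRep_formD_eventuallyEq hc hx hη)

theorem chartRep_formD_formD [IsManifold 𝓘(ℂ, Cn n) ω X] {d d' : ℂ} {η : DForm n X k}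
    {c : OpenPartialHomeomorph X (Cn n)}
    (hc : c ∈ IsManifold.maximalAtlas 𝓘(ℂ, Cn n) ω X) {x : X} (hx : x ∈ c.source)
    (hη : ∀ᶠ y in nhds x, SmoothFormAt η y) :
    chartRep c (HermitianBlowUp.formD d (HermitianBlowUp.formD d' η)) (c x) =
      flatD d (flatD d' (chartRep c η)) (c x) := by
  have h2 : SmoothFormAt (HermitianBlowUp.formD d' η) (c.symm (c x)) := by
    rw [c.left_inv hx]; exact SmoothFormAt.formD hη
  rw [chartRep_formD hc (c.map_source hx) h2,
    flatD_congr (chartRep_formD_eventuallyEq hc hx hη)]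

end Charts

/-! ### The form `i∂∂̄f` on `ℂⁿ` and the pluriharmonicity of `log |h|²`. -/

section FlatLevi

variable {n : ℕ}

/-- A function as a form of degree zero. -/
noncomputable def zeroFormFlat (g : Cn n → ℂ) (z : Cn n) : Cn n [⋀^Fin 0]→L[ℝ] ℂ :=
  ContinuousAlternatingMap.constOfIsEmpty ℝ (Cn n) (Fin 0) (g z)

theorem contDiffAt_zeroFormFlat {g : Cn n → ℂ} {z : Cn n} {m : WithTop ℕ∞}
    (hg : ContDiffAt ℝ m g z) : ContDiffAt ℝ m (zeroFormFlat g) z :=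
  contDiffAt_form fun _ => hg

theorem contDiffAt_of_zeroFormFlat {g : Cn n → ℂ} {z : Cn n} {m : WithTop ℕ∞}
    (hg : ContDiffAt ℝ m (zeroFormFlat g) z) : ContDiffAt ℝ m g z :=
  contDiffAt_form_apply hg ![]

theorem form_one_eq (T : Cn n →L[ℝ] Cn n [⋀^Fin 0]→L[ℝ] ℂ) (v : Fin 1 → Cn n) :
    ContinuousAlternatingMap.alternatizeUncurryFin T v = T (v 0) ![] := by
  rw [ContinuousAlternatingMap.alternatizeUncurryFin_apply]
  refine (Fin.sum_univ_one _).trans ?_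
  rw [Fin.val_zero, pow_zero, one_smul]
  congr 1
  exact Subsingleton.elim _ _

theorem flatD_flatD_zeroFormFlat {c d : ℂ} {g : Cn n → ℂ} {z : Cn n} (hg : ContDiffAt ℝ 2 g z)
    (v : Fin 2 → Cn n) : flatD c (flatD d (zeroFormFlat g)) z v =
      pd c (v 0) (pd d (v 1) g) z - pd c (v 1) (pd d (v 0) g) z := by
  have hα := contDiffAt_zeroFormFlat hg
  let ev : (Cn n [⋀^Fin 0]→L[ℝ] ℂ) →L[ℝ] ℂ := LinearMap.toContinuousLinearMap
    { toFun := fun β => β ![]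
      map_add' := fun _ _ => rfl
      map_smul' := fun _ _ => rfl }
  have hd : ∀ y w, DifferentiableAt ℝ (zeroFormFlat g) y →
      pd d w (zeroFormFlat g) y ![] = pd d w g y := fun y w hy =>
    (pd_clm ev (fun _ _ => rfl) hy).symm
  have h2 : ∀ u w, pd c u (flatD d (zeroFormFlat g)) z ![w] = pd c u (pd d w g) z := by
    intro u w
    rw [flatD_flatD hα, form_one_eq]
    change pd c u (fun y => typePart d (fderiv ℝ (zeroFormFlat g) y)) z w ![] = _
    rw [pd_typePart_fderiv_apply hα]
    have h3 : DifferentiableAt ℝ (pd d w (zeroFormFlat g)) z :=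
      (contDiffAt_pd (m' := 1) hα (by norm_num)).differentiableAt (by norm_num)
    refine (pd_clm ev (fun _ _ => rfl) h3).symm.trans ?_
    have hev : (fun y => ev (pd d w (zeroFormFlat g) y)) =ᶠ[nhds z] pd d w g := by
      filter_upwards [hα.eventually (by norm_num)] with y hy
      exact hd y w (hy.differentiableAt (by norm_num))
    rw [pd, hev.fderiv_eq (𝕜 := ℝ), ← pd]
  have h4 : flatD c (flatD d (zeroFormFlat g)) z v =
      pd c (v 0) (flatD d (zeroFormFlat g)) z ![v 1] -
        pd c (v 1) (flatD d (zeroFormFlat g)) z ![v 0] := by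
    have e0 : Fin.removeNth 0 v = ![v 1] := by
      funext i; fin_cases i; rfl
    have e1 : Fin.removeNth 1 v = ![v 0] := by
      funext i; fin_cases i; rfl
    rw [flatD, ContinuousAlternatingMap.alternatizeUncurryFin_apply, Fin.sum_univ_two, e0, e1]
    simp only [Fin.val_zero, pow_zero, one_smul, Fin.val_one, pow_one, neg_smul, sub_eq_add_neg]
    rfl
  rw [h4, h2, h2]

theorem fderiv_fderiv_ofReal {f : Cn n → ℝ} {z : Cn n} (hf : ContDiffAt ℝ 2 f z) (v w : Cn n) :
    fderiv ℝ (fderiv ℝ (fun y => (f y : ℂ))) z v w = (fderiv ℝ (fderiv ℝ f) z v w : ℝ) := by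
  have h1 : fderiv ℝ (fun y => (f y : ℂ)) =ᶠ[nhds z]
      fun y => Complex.ofRealCLM.comp (fderiv ℝ f y) := by
    filter_upwards [hf.eventually (by norm_num)] with y hy
    exact (Complex.ofRealCLM.hasFDerivAt.comp y
      (hy.differentiableAt (by norm_num)).hasFDerivAt).fderiv
  have hd : DifferentiableAt ℝ (fderiv ℝ f) z :=
    (hf.fderiv_right (m := 1) (by norm_num)).differentiableAt (by norm_num)
  have h2 : fderiv ℝ (fun y => Complex.ofRealCLM.comp (fderiv ℝ f y)) z =
      (ContinuousLinearMap.compL ℝ (Cn n) ℝ ℂ Complex.ofRealCLM).comp (fderiv ℝ (fderiv ℝ f) z) :=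
    ((ContinuousLinearMap.compL ℝ (Cn n) ℝ ℂ Complex.ofRealCLM).hasFDerivAt.comp z
      hd.hasFDerivAt).fderiv
  rw [h1.fderiv_eq, h2]
  rfl

/-- The values of `i ∂∂̄ f` in terms of the real second derivative of `f`. -/
theorem flatLevi_apply {f : Cn n → ℝ} {z : Cn n} (hf : ContDiffAt ℝ 2 f z)
    (v : Fin 2 → Cn n) :
    (Complex.I • flatD (-Complex.I) (flatD Complex.I (zeroFormFlat fun y => (f y : ℂ))) z) v =
      ((1 / 2 * (fderiv ℝ (fderiv ℝ f) z (Complex.I • v 0) (v 1) -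
        fderiv ℝ (fderiv ℝ f) z (v 0) (Complex.I • v 1)) : ℝ) : ℂ) := by
  have hg : ContDiffAt ℝ 2 (fun y => (f y : ℂ)) z := Complex.ofRealCLM.contDiff.contDiffAt.comp z hf
  have hs : ∀ x y, fderiv ℝ (fderiv ℝ f) z x y = fderiv ℝ (fderiv ℝ f) z y x :=
    (hf.isSymmSndFDerivAt (by simp)).eq
  rw [ContinuousAlternatingMap.smul_apply, flatD_flatD_zeroFormFlat hg, pd_pd hg, pd_pd hg]
  simp only [fderiv_fderiv_ofReal hf]
  rw [hs (v 1) (v 0), hs (v 1) (Complex.I • v 0), hs (Complex.I • v 1) (v 0),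
    hs (Complex.I • v 1) (Complex.I • v 0)]
  simp only [smul_eq_mul]
  push_cast
  linear_combination (((fderiv ℝ (fderiv ℝ f) z (v 0) (Complex.I • v 1) : ℝ) : ℂ) / 2 -
    ((fderiv ℝ (fderiv ℝ f) z (Complex.I • v 0) (v 1) : ℝ) : ℂ) / 2) * Complex.I_mul_I

/-- These are the Cauchy-Riemann equations. -/
theorem pd_holomorphic {L : Cn n → ℂ} {z : Cn n} (hL : DifferentiableAt ℂ L z) (w : Cn n) :
    pd Complex.I w L z = 0 := by
  have h : fderiv ℝ L z = (fderiv ℂ L z).restrictScalars ℝ := hL.fderiv_restrictScalars ℝ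
  have h1 : fderiv ℝ L z (Complex.I • w) = Complex.I * fderiv ℝ L z w := by
    rw [h]; exact (fderiv ℂ L z).map_smul Complex.I w
  rw [pd_eq, h1]
  simp only [smul_eq_mul]
  linear_combination (1 / 2 * fderiv ℝ L z w) * Complex.I_mul_I

theorem pd_conj_holomorphic {L : Cn n → ℂ} {z : Cn n} (hL : DifferentiableAt ℂ L z) (w : Cn n) :
    pd (-Complex.I) w (fun y => (starRingEnd ℂ) (L y)) z = 0 := by
  have h : fderiv ℝ (fun y => (starRingEnd ℂ) (L y)) z =
      Complex.conjCLE.toContinuousLinearMap.comp (fderiv ℝ L z) :=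
    (Complex.conjCLE.toContinuousLinearMap.hasFDerivAt.comp z
      (hL.restrictScalars ℝ).hasFDerivAt).fderiv
  have h0 := congrArg (starRingEnd ℂ) (pd_holomorphic hL w)
  rw [pd_eq, h]
  rw [pd_eq] at h0
  simpa using h0

/-- `log |h|²` is pluriharmonic where the holomorphic function `h` does not vanish. -/
theorem pd_pd_log_normSq {h : Cn n → ℂ} {z : Cn n} (hh : ContDiffAt ℂ ω h z) (hz : h z ≠ 0)
    (v w : Cn n) :
    pd (-Complex.I) v (pd Complex.I w fun y => ((Real.log (‖h y‖ ^ 2) : ℝ) : ℂ)) z = 0 := by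
  -- Dividing by `h z` keeps the argument near `1`, inside the domain of the principal logarithm.
  -- Near `z`, `log |h|²` is then a constant plus `L` plus its conjugate.
  let L : Cn n → ℂ := fun y => Complex.log (h y / h z)
  have hL : ContDiffAt ℂ ω L z := by
    refine (Complex.contDiffAt_log ?_).comp z (hh.div_const _)
    rw [div_self hz]
    exact Complex.one_mem_slitPlane
  have hLR : ContDiffAt ℝ 2 L z := (hL.restrict_scalars ℝ).of_le (by simp)
  have hcR : ContDiffAt ℝ 2 (fun y => (starRingEnd ℂ) (L y)) z :=
    Complex.conjCLE.contDiff.contDiffAt.comp z hLR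
  have hev : (fun y => ((Real.log (‖h y‖ ^ 2) : ℝ) : ℂ)) =ᶠ[nhds z]
      ((fun _ => ((Real.log (‖h z‖ ^ 2) : ℝ) : ℂ)) + L) + fun y => (starRingEnd ℂ) (L y) := by
    filter_upwards [hh.continuousAt.eventually_ne hz] with y hy
    have h1 : L y + (starRingEnd ℂ) (L y) = ((2 * Real.log (‖h y‖ / ‖h z‖) : ℝ) : ℂ) := by
      rw [Complex.add_conj, Complex.log_re, norm_div]
    simp only [Pi.add_apply, add_assoc, h1]
    rw [Real.log_div (norm_ne_zero_iff.2 hy) (norm_ne_zero_iff.2 hz), Real.log_pow, Real.log_pow,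
      ← Complex.ofReal_add]
    congr 1
    push_cast
    ring
  have hpd : ∀ᶠ y in nhds z, pd Complex.I w (fun y => ((Real.log (‖h y‖ ^ 2) : ℝ) : ℂ)) y =
      pd Complex.I w (fun y => (starRingEnd ℂ) (L y)) y := by
    filter_upwards [hev.eventuallyEq_nhds, hL.eventually (by simp), hLR.eventually (by norm_num),
      hcR.eventually (by norm_num)] with y h1 h2 h3 h4
    have d3 := h3.differentiableAt (by norm_num)
    rw [pd, h1.fderiv_eq (𝕜 := ℝ), ← pd, pd_add ((differentiableAt_const _).add d3)
      (h4.differentiableAt (by norm_num)), pd_add (differentiableAt_const _) d3,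
      pd_holomorphic (h2.differentiableAt (by simp))]
    simp [pd_eq]
  have hzero : pd (-Complex.I) v (fun y => (starRingEnd ℂ) (L y)) =ᶠ[nhds z] fun _ => 0 := by
    filter_upwards [hL.eventually (by simp)] with y h2
    exact pd_conj_holomorphic (h2.differentiableAt (by simp)) v
  have hpd' : pd Complex.I w (fun y => ((Real.log (‖h y‖ ^ 2) : ℝ) : ℂ)) =ᶠ[nhds z]
      pd Complex.I w (fun y => (starRingEnd ℂ) (L y)) := hpd
  rw [pd, hpd'.fderiv_eq (𝕜 := ℝ), ← pd, pd_pd_swap hcR, pd, hzero.fderiv_eq (𝕜 := ℝ)]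
  simp [typePart_apply]

/-- Taking logarithms, `f₁ - f₂` is a difference of two pluriharmonic functions `log |h|²`. -/
theorem flatLevi_eq_of_log_normSq {f₁ f₂ : Cn n → ℝ} {h₁ h₂ : Cn n → ℂ} {z : Cn n}
    (hf₁ : ContDiffAt ℝ 2 f₁ z) (hf₂ : ContDiffAt ℝ 2 f₂ z) (hh₁ : ContDiffAt ℂ ω h₁ z)
    (hh₂ : ContDiffAt ℂ ω h₂ z) (h₁z : h₁ z ≠ 0) (h₂z : h₂ z ≠ 0)
    (h : ∀ᶠ y in nhds z, ‖h₁ y‖ ^ 2 * Real.exp (f₁ y) = ‖h₂ y‖ ^ 2 * Real.exp (f₂ y)) :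
    flatD (-Complex.I) (flatD Complex.I (zeroFormFlat fun y => (f₁ y : ℂ))) z =
      flatD (-Complex.I) (flatD Complex.I (zeroFormFlat fun y => (f₂ y : ℂ))) z := by
  have hlog : ∀ {h : Cn n → ℂ}, ContDiffAt ℂ ω h z → h z ≠ 0 →
      ContDiffAt ℝ 2 (fun y => ((Real.log (‖h y‖ ^ 2) : ℝ) : ℂ)) z := by
    intro h hh hz
    have h1 : ContDiffAt ℝ 2 h z := (hh.restrict_scalars ℝ).of_le (by simp)
    exact Complex.ofRealCLM.contDiff.contDiffAt.comp z
      ((h1.norm_sq ℝ).log (pow_ne_zero 2 (norm_ne_zero_iff.2 hz)))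
  have hg₁ : ContDiffAt ℝ 2 (fun y => (f₁ y : ℂ)) z :=
    Complex.ofRealCLM.contDiff.contDiffAt.comp z hf₁
  have hg₂ : ContDiffAt ℝ 2 (fun y => (f₂ y : ℂ)) z :=
    Complex.ofRealCLM.contDiff.contDiffAt.comp z hf₂
  have hl₁ := hlog hh₁ h₁z
  have hl₂ := hlog hh₂ h₂z
  have hev : (fun y => (f₁ y : ℂ)) + (fun y => ((Real.log (‖h₁ y‖ ^ 2) : ℝ) : ℂ)) =ᶠ[nhds z]
      (fun y => (f₂ y : ℂ)) + fun y => ((Real.log (‖h₂ y‖ ^ 2) : ℝ) : ℂ) := by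
    filter_upwards [h, hh₁.continuousAt.eventually_ne h₁z, hh₂.continuousAt.eventually_ne h₂z]
      with y hy h1 h2
    have := congrArg Real.log hy
    rw [Real.log_mul (by positivity) (by positivity), Real.log_mul (by positivity) (by positivity),
      Real.log_exp, Real.log_exp] at this
    simp only [Pi.add_apply, ← Complex.ofReal_add]
    congr 1
    linarith
  have hpp : ∀ {f l : Cn n → ℂ}, ContDiffAt ℝ 2 f z → ContDiffAt ℝ 2 l z → ∀ v w,
      pd (-Complex.I) v (pd Complex.I w (f + l)) z =
        pd (-Complex.I) v (pd Complex.I w f) z + pd (-Complex.I) v (pd Complex.I w l) z := by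
    intro f l hf hl v w
    have hev : pd Complex.I w (f + l) =ᶠ[nhds z] pd Complex.I w f + pd Complex.I w l := by
      filter_upwards [hf.eventually (by norm_num), hl.eventually (by norm_num)] with y h1 h2
      exact pd_add (h1.differentiableAt (by norm_num)) (h2.differentiableAt (by norm_num))
    rw [pd, hev.fderiv_eq (𝕜 := ℝ), ← pd, pd_add
      ((contDiffAt_pd (m' := 1) hf (by norm_num)).differentiableAt (by norm_num))
      ((contDiffAt_pd (m' := 1) hl (by norm_num)).differentiableAt (by norm_num))]
  have hv : ∀ v w, pd (-Complex.I) v (pd Complex.I w fun y => (f₁ y : ℂ)) z =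
      pd (-Complex.I) v (pd Complex.I w fun y => (f₂ y : ℂ)) z := by
    intro v w
    have h1 := hpp hg₁ hl₁ v w
    have h2 := hpp hg₂ hl₂ v w
    rw [pd_pd_log_normSq hh₁ h₁z, add_zero] at h1
    rw [pd_pd_log_normSq hh₂ h₂z, add_zero] at h2
    have hev' : pd Complex.I w ((fun y => (f₁ y : ℂ)) +
        (fun y => ((Real.log (‖h₁ y‖ ^ 2) : ℝ) : ℂ))) =ᶠ[nhds z]
        pd Complex.I w ((fun y => (f₂ y : ℂ)) + fun y => ((Real.log (‖h₂ y‖ ^ 2) : ℝ) : ℂ)) :=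
      hev.eventuallyEq_nhds.mono fun y hy => by rw [pd, hy.fderiv_eq (𝕜 := ℝ), ← pd]
    rw [← h1, ← h2, pd, hev'.fderiv_eq (𝕜 := ℝ), ← pd]
  ext v
  rw [flatD_flatD_zeroFormFlat hg₁, flatD_flatD_zeroFormFlat hg₂, hv, hv]

end FlatLevi

theorem natCast_le_infty (m : ℕ) : (m : WithTop ℕ∞) ≤ ∞ :=
  WithTop.coe_le_coe.2 (le_top (a := (m : ℕ∞)))

/-! ### The form `i∂∂̄f` on a manifold, and gluing it from local potentials. -/

section Levi

variable {n k : ℕ} {X X' : Type*}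
  [TopologicalSpace X] [ChartedSpace (Cn n) X]
  [TopologicalSpace X'] [ChartedSpace (Cn n) X']

/-- A real function as a form of degree zero. -/
noncomputable def zeroForm (f : X → ℝ) : DForm n X 0 := fun x =>
  ContinuousAlternatingMap.constOfIsEmpty ℝ (TangentSpace 𝓘(ℂ, Cn n) x) (Fin 0) (f x : ℂ)

/-- The form `i ∂∂̄ f`. -/
noncomputable def leviForm (f : X → ℝ) : DForm n X 2 := fun x =>
  Complex.I • formD (-Complex.I) (formD Complex.I (zeroForm (n := n) f)) x

theorem chartRep_zeroForm (f : X → ℝ) (c : OpenPartialHomeomorph X (Cn n)) :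
    chartRep c (zeroForm f) = zeroFormFlat fun z => (f (c.symm z) : ℂ) := rfl

theorem smoothFormAt_zeroForm_of_chart {f : X → ℝ} {c : OpenPartialHomeomorph X (Cn n)}
    (hc : c ∈ IsManifold.maximalAtlas 𝓘(ℂ, Cn n) ω X) {x : X} (hx : x ∈ c.source)
    (h : ContDiffAt ℝ ∞ (fun z => f (c.symm z)) (c x)) : SmoothFormAt (n := n) (zeroForm f) x :=
  smoothFormAt_of_chart hc hx
    (contDiffAt_zeroFormFlat (Complex.ofRealCLM.contDiff.contDiffAt.comp (c x) h))

theorem SmoothFormAt.contDiffAt {f : X → ℝ} {x : X} (h : SmoothFormAt (n := n) (zeroForm f) x)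
    {c : OpenPartialHomeomorph X (Cn n)} (hc : c ∈ IsManifold.maximalAtlas 𝓘(ℂ, Cn n) ω X)
    (hx : x ∈ c.source) : ContDiffAt ℝ ∞ (fun z => f (c.symm z)) (c x) := by
  have h1 := contDiffAt_of_zeroFormFlat (h c hc hx)
  exact Complex.reCLM.contDiff.contDiffAt.comp (c x) h1

theorem chartRep_formPow (η : DForm n X 2) (c : OpenPartialHomeomorph X (Cn n)) (z : Cn n)
    (k : ℕ) : chartRep c (formPow η k) z = wedgePow (chartRep c η z) k :=
  wedgePow_compContinuousLinearMap (V := Cn n) (V' := Cn n) (η (c.symm z)) _ k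

theorem formPow_pullForm (μ : X' → X) (η : DForm n X 2) (k : ℕ) :
    formPow (pullForm μ η) k = pullForm μ (formPow η k) := by
  funext x
  exact (wedgePow_compContinuousLinearMap (V := Cn n) (V' := Cn n) (η (μ x)) _ k).symm

theorem SmoothFormAt.formPow {η : DForm n X 2} {x : X} (h : SmoothFormAt η x) (k : ℕ) :
    SmoothFormAt (formPow η k) x := by
  intro c hc hx
  rw [funext fun z => chartRep_formPow η c z k]
  exact contDiffAt_wedgePow (h c hc hx) k

theorem SmoothFormAt.smul {η : DForm n X k} {x : X} (h : SmoothFormAt η x) (a : ℂ) :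
    SmoothFormAt (fun x => a • η x) x := fun c hc hx => (h c hc hx).const_smul a

theorem SmoothFormAt.add {η θ : DForm n X k} {x : X} (h : SmoothFormAt η x)
    (h' : SmoothFormAt θ x) : SmoothFormAt (fun x => η x + θ x) x :=
  fun c hc hx => (h c hc hx).add (h' c hc hx)

theorem chartRep_congr {η θ : DForm n X k} {x : X} (h : ∀ᶠ y in nhds x, η y = θ y)
    {c : OpenPartialHomeomorph X (Cn n)} (hx : x ∈ c.source) :
    chartRep c η =ᶠ[nhds (c x)] chartRep c θ := by
  have := (c.continuousAt_symm (c.map_source hx)).eventually (by rwa [c.left_inv hx])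
  filter_upwards [this] with z hz
  rw [chartRep, chartRep, hz]

theorem SmoothFormAt.congr {η θ : DForm n X k} {x : X} (h : SmoothFormAt θ x)
    (he : ∀ᶠ y in nhds x, η y = θ y) : SmoothFormAt η x := fun c hc hx =>
  (h c hc hx).congr_of_eventuallyEq (chartRep_congr he hx)

theorem chartRep_leviForm [IsManifold 𝓘(ℂ, Cn n) ω X] {f : X → ℝ}
    {c : OpenPartialHomeomorph X (Cn n)} (hc : c ∈ IsManifold.maximalAtlas 𝓘(ℂ, Cn n) ω X) {x : X}
    (hx : x ∈ c.source) (hf : ∀ᶠ y in nhds x, SmoothFormAt (n := n) (zeroForm f) y) :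
    chartRep c (leviForm f) (c x) = Complex.I • flatD (-Complex.I) (flatD Complex.I
      (zeroFormFlat fun z => (f (c.symm z) : ℂ))) (c x) := by
  have h : chartRep c (leviForm f) (c x) = Complex.I •
    chartRep c (formD (-Complex.I) (formD Complex.I (zeroForm f))) (c x) := rfl
  rw [h, chartRep_formD_formD hc hx hf, chartRep_zeroForm]

theorem chartRep_leviForm_eventuallyEq [IsManifold 𝓘(ℂ, Cn n) ω X] {f : X → ℝ}
    {c : OpenPartialHomeomorph X (Cn n)} (hc : c ∈ IsManifold.maximalAtlas 𝓘(ℂ, Cn n) ω X) {x : X}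
    (hx : x ∈ c.source) (hf : ∀ᶠ y in nhds x, SmoothFormAt (n := n) (zeroForm f) y) :
    chartRep c (leviForm f) =ᶠ[nhds (c x)] fun z => Complex.I • flatD (-Complex.I)
      (flatD Complex.I (zeroFormFlat fun z => (f (c.symm z) : ℂ))) z := by
  have h1 := (c.continuousAt_symm (c.map_source hx)).eventually
    (by rw [c.left_inv hx]; exact hf.eventually_nhds)
  filter_upwards [h1, c.open_target.mem_nhds (c.map_source hx)] with z hz hzt
  have := chartRep_leviForm hc (c.map_target hzt) hz
  rwa [c.right_inv hzt] at this

theorem smoothFormAt_leviForm [IsManifold 𝓘(ℂ, Cn n) ω X] {f : X → ℝ} {x : X}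
    (hf : ∀ᶠ y in nhds x, SmoothFormAt (n := n) (zeroForm f) y) :
    SmoothFormAt (n := n) (leviForm f) x :=
  (SmoothFormAt.formD (hf.eventually_nhds.mono fun _ hy => SmoothFormAt.formD hy)).smul _

/-- From `∂∂ = 0`, and from `∂̄∂∂̄ = -∂∂̄∂̄ = 0`. -/
theorem flatD_chartRep_leviForm [IsManifold 𝓘(ℂ, Cn n) ω X] {f : X → ℝ} {x : X}
    (hf : ∀ᶠ y in nhds x, SmoothFormAt (n := n) (zeroForm f) y)
    {c : OpenPartialHomeomorph X (Cn n)} (hc : c ∈ IsManifold.maximalAtlas 𝓘(ℂ, Cn n) ω X)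
    (hx : x ∈ c.source) {d : ℂ} (hd : d = -Complex.I ∨ d = Complex.I) :
    flatD d (chartRep c (leviForm f)) (c x) = 0 := by
  set g : Cn n → ℂ := fun z => (f (c.symm z) : ℂ) with hg_def
  have hg : ContDiffAt ℝ 4 (zeroFormFlat g) (c x) :=
    (hf.self_of_nhds c hc hx).of_le (natCast_le_infty 4)
  have h1 : ContDiffAt ℝ 3 (flatD Complex.I (zeroFormFlat g)) (c x) :=
    contDiffAt_flatD hg (by norm_num)
  have h2 : ContDiffAt ℝ 2 (flatD (-Complex.I) (flatD Complex.I (zeroFormFlat g))) (c x) :=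
    contDiffAt_flatD h1 (by norm_num)
  rw [flatD_congr (chartRep_leviForm_eventuallyEq hc hx hf),
    flatD_const_smul _ (h2.differentiableAt (by norm_num))]
  have h0 : flatD d (flatD (-Complex.I) (flatD Complex.I (zeroFormFlat g))) (c x) = 0 := by
    rcases hd with rfl | rfl
    · exact flatD_flatD_self (h1.of_le (by norm_num))
    · rw [flatD_flatD_swap (h1.of_le (by norm_num))]
      have h3 : flatD Complex.I (flatD Complex.I (zeroFormFlat g)) =ᶠ[nhds (c x)] fun _ => 0 := by
        filter_upwards [(hg.eventually (by simp))] with y hy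
        exact flatD_flatD_self (hy.of_le (by norm_num))
      rw [flatD_congr h3, flatD_constForm, neg_zero]
  rw [h0]
  ext v
  simp

/-- `f` is smooth near `x` and `log Ψ - f = log |h|²` near `x` for a holomorphic function `h`. -/
def IsPotentialAt (n : ℕ) {X : Type*} [TopologicalSpace X] [ChartedSpace (Cn n) X] (Ψ f : X → ℝ)
    (x : X) : Prop :=
  ∃ h : X → ℂ, ∀ᶠ y in nhds x, SmoothFormAt (n := n) (zeroForm f) y ∧
    ContMDiffAt 𝓘(ℂ, Cn n) 𝓘(ℂ, ℂ) ω h y ∧ Ψ y = ‖h y‖ ^ 2 * Real.exp (f y)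

theorem IsPotentialAt.smooth {Ψ f : X → ℝ} {x : X} (h : IsPotentialAt n Ψ f x) :
    ∀ᶠ y in nhds x, SmoothFormAt (n := n) (zeroForm f) y :=
  h.choose_spec.mono fun _ hy => hy.1

theorem IsPotentialAt.eventually {Ψ f : X → ℝ} {x : X} (h : IsPotentialAt n Ψ f x) :
    ∀ᶠ y in nhds x, IsPotentialAt n Ψ f y :=
  h.choose_spec.eventually_nhds.mono fun _ hy => ⟨h.choose, hy⟩

/-- Where `Ψ` is nonzero so are the two holomorphic factors, and the potentials differ by a
pluriharmonic function. Both forms are continuous, so the equality extends across the zeros of `Ψ`,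
whose complement is dense. -/
theorem leviForm_eq_of_isPotentialAt [IsManifold 𝓘(ℂ, Cn n) ω X] {Ψ f₁ f₂ : X → ℝ} {x : X}
    (hΨ : Dense {y | Ψ y ≠ 0}) (h₁ : IsPotentialAt n Ψ f₁ x) (h₂ : IsPotentialAt n Ψ f₂ x) :
    leviForm (n := n) f₁ x = leviForm f₂ x := by
  have hc := IsManifold.chart_mem_maximalAtlas (I := 𝓘(ℂ, Cn n)) (n := ω) x
  have hx := mem_chart_source (Cn n) x
  set c := chartAt (Cn n) x
  obtain ⟨k₁, hk₁⟩ := h₁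
  obtain ⟨k₂, hk₂⟩ := h₂
  have hf₁ : ∀ᶠ y in nhds x, SmoothFormAt (n := n) (zeroForm f₁) y := hk₁.mono fun _ h => h.1
  have hf₂ : ∀ᶠ y in nhds x, SmoothFormAt (n := n) (zeroForm f₂) y := hk₂.mono fun _ h => h.1
  suffices hs : chartRep c (leviForm f₁) (c x) = chartRep c (leviForm f₂) (c x) by
    ext v
    refine (form_eq_chartRep _ hc hx v).trans (Eq.trans ?_ (form_eq_chartRep _ hc hx v).symm)
    rw [hs]
  have hcont : ∀ {f : X → ℝ}, (∀ᶠ y in nhds x, SmoothFormAt (n := n) (zeroForm f) y) →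
      ContinuousAt (fun y => chartRep c (leviForm f) (c y)) x := fun hf =>
    ContinuousAt.comp (f := c) ((smoothFormAt_leviForm hf) c hc hx).continuousAt
      (c.continuousAt hx)
  have hev : ∀ᶠ y in nhds x, Ψ y ≠ 0 →
      chartRep c (leviForm f₁) (c y) = chartRep c (leviForm f₂) (c y) := by
    filter_upwards [hk₁.eventually_nhds, hk₂.eventually_nhds, c.open_source.mem_nhds hx]
      with y h1 h2 hy hΨy
    rw [chartRep_leviForm hc hy (h1.mono fun _ h => h.1),
      chartRep_leviForm hc hy (h2.mono fun _ h => h.1)]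
    congr 1
    have hsm : ∀ {f : X → ℝ}, SmoothFormAt (n := n) (zeroForm f) y →
        ContDiffAt ℝ 2 (fun z => f (c.symm z)) (c y) := fun hf =>
      (hf.contDiffAt hc hy).of_le (natCast_le_infty 2)
    have hhol : ∀ {k : X → ℂ}, ContMDiffAt 𝓘(ℂ, Cn n) 𝓘(ℂ, ℂ) ω k y →
        ContDiffAt ℂ ω (fun z => k (c.symm z)) (c y) := by
      intro k hk
      rw [← contMDiffAt_iff_contDiffAt]
      have hs := contMDiffAt_symm_of_mem_maximalAtlas hc (c.map_source hy)
      exact ContMDiffAt.comp (c y) (by rwa [c.left_inv hy]) hs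
    have hs1 := h1.self_of_nhds
    have hs2 := h2.self_of_nhds
    have hn1 : k₁ y ≠ 0 := by
      intro h0; rw [hs1.2.2, h0] at hΨy; simp at hΨy
    have hn2 : k₂ y ≠ 0 := by
      intro h0; rw [hs2.2.2, h0] at hΨy; simp at hΨy
    refine flatLevi_eq_of_log_normSq (hsm hs1.1) (hsm hs2.1) (hhol hs1.2.1) (hhol hs2.2.1)
      (by rwa [c.left_inv hy]) (by rwa [c.left_inv hy]) ?_
    have hcs := (c.continuousAt_symm (c.map_source hy))
    rw [ContinuousAt, c.left_inv hy] at hcs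
    filter_upwards [hcs.eventually h1, hcs.eventually h2] with z hz1 hz2
    rw [← hz1.2.2, hz2.2.2]
  have hne : (nhdsWithin x {y | Ψ y ≠ 0}).NeBot := mem_closure_iff_nhdsWithin_neBot.1 (hΨ x)
  exact tendsto_nhds_unique_of_eventuallyEq (l := nhdsWithin x {y | Ψ y ≠ 0})
    ((hcont hf₁).tendsto.mono_left nhdsWithin_le_nhds)
    ((hcont hf₂).tendsto.mono_left nhdsWithin_le_nhds) (eventually_nhdsWithin_iff.2 hev)

/-- Local potentials of `log Ψ` define a global form. -/
theorem exists_form_of_isPotentialAt [IsManifold 𝓘(ℂ, Cn n) ω X] {Ψ : X → ℝ}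
    (hΨ : Dense {y | Ψ y ≠ 0}) (hpot : ∀ x, ∃ f, IsPotentialAt n Ψ f x) :
    ∃ θ : DForm n X 2, ∀ x f, IsPotentialAt n Ψ f x → ∀ᶠ y in nhds x, θ y = leviForm f y := by
  choose F hF using hpot
  -- The value at each point uses a potential chosen at that point. A potential at `x` remains one
  -- at nearby points, so uniqueness identifies the values there.
  refine ⟨fun x => leviForm (F x) x, fun x f hf => ?_⟩
  filter_upwards [hf.eventually] with y hy
  exact leviForm_eq_of_isPotentialAt hΨ (hF y) hy

theorem leviForm_apply [IsManifold 𝓘(ℂ, Cn n) ω X] {f : X → ℝ} {x : X}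
    (hf : ∀ᶠ y in nhds x, SmoothFormAt (n := n) (zeroForm f) y)
    {c : OpenPartialHomeomorph X (Cn n)} (hc : c ∈ IsManifold.maximalAtlas 𝓘(ℂ, Cn n) ω X)
    (hx : x ∈ c.source) (v : Fin 2 → Cn n) :
    chartRep c (leviForm f) (c x) v =
      ((1 / 2 * (fderiv ℝ (fderiv ℝ fun z => f (c.symm z)) (c x) (Complex.I • v 0) (v 1) -
        fderiv ℝ (fderiv ℝ fun z => f (c.symm z)) (c x) (v 0) (Complex.I • v 1)) : ℝ) : ℂ) := by
  rw [chartRep_leviForm hc hx hf]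
  exact flatLevi_apply ((hf.self_of_nhds.contDiffAt hc hx).of_le (natCast_le_infty 2)) v

end Levi

/-! ### Assumption `(*)` on manifolds. -/

section Star

variable {n k : ℕ} {X X' : Type*}
  [TopologicalSpace X] [ChartedSpace (Cn n) X] [IsManifold 𝓘(ℂ, Cn n) ω X]
  [TopologicalSpace X'] [ChartedSpace (Cn n) X'] [IsManifold 𝓘(ℂ, Cn n) ω X']

theorem del_delbar_eq_zero_iff {η : DForm n X k}
    {c : OpenPartialHomeomorph X (Cn n)}
    (hc : c ∈ IsManifold.maximalAtlas 𝓘(ℂ, Cn n) ω X) {x : X} (hx : x ∈ c.source)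
    (hη : ∀ᶠ y in nhds x, SmoothFormAt η y) :
    del (delbar η) x = 0 ↔ flatD (-Complex.I) (flatD Complex.I (chartRep c η)) (c x) = 0 := by
  rw [del_eq, delbar_eq, ← chartRep_formD_formD hc hx hη]
  constructor
  · intro h
    have : chartRep c (formD (-Complex.I) (formD Complex.I η)) (c x) =
      (formD (-Complex.I) (formD Complex.I η) (c.symm (c x))).compContinuousLinearMap
      ((mfderiv 𝓘(ℂ, Cn n) 𝓘(ℂ, Cn n) c.symm (c x)).restrictScalars ℝ) := rfl
    rw [this, c.left_inv hx, h]
    rfl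
  · exact form_eq_zero_of_chartRep hc hx

theorem del_delbar_pullForm_eq_zero {μ : X' → X} (hμ : ContMDiff 𝓘(ℂ, Cn n) 𝓘(ℂ, Cn n) ω μ)
    {η : DForm n X k} (hη : ∀ x, SmoothFormAt η x) (h : del (delbar η) = 0) :
    del (delbar (pullForm μ η)) = 0 := by
  funext x
  have hc := IsManifold.chart_mem_maximalAtlas (I := 𝓘(ℂ, Cn n)) (n := ω) x
  have hx := mem_chart_source (Cn n) x
  have he := IsManifold.chart_mem_maximalAtlas (I := 𝓘(ℂ, Cn n)) (n := ω) (μ x)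
  have hy := mem_chart_source (Cn n) (μ x)
  refine (del_delbar_eq_zero_iff hc hx (Filter.Eventually.of_forall fun y =>
    (hη (μ y)).pullForm hμ)).2 ?_
  have h0 := (del_delbar_eq_zero_iff he hy (Filter.Eventually.of_forall hη)).1 (congrFun h (μ x))
  set c := chartAt (Cn n) x
  set e := chartAt (Cn n) (μ x)
  have hx' : c x ∈ c.target := c.map_source hx
  have hyc : μ (c.symm (c x)) ∈ e.source := by rwa [c.left_inv hx]
  have hev := eventually_mem_source hx' (hμ (c.symm (c x))).continuousAt hyc
  have hτ : ∀ᶠ z in nhds (c x), ContDiffAt ℂ ω (fun y => e (μ (c.symm y))) z :=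
    hev.mono fun z hz => contDiffAt_chart hc he hz.1 (hμ _) hz.2
  have hsm : ∀ z, z ∈ c.target → μ (c.symm z) ∈ e.source →
      ContDiffAt ℝ ∞ (chartRep e η) (e (μ (c.symm z))) := fun z _ hz2 => hη _ e he hz2
  have h1 : chartRep c (pullForm μ η) =ᶠ[nhds (c x)] fun z =>
      (chartRep e η (e (μ (c.symm z)))).compContinuousLinearMap
        (fderiv ℝ (fun y => e (μ (c.symm y))) z) :=
    hev.mono fun z hz => chartRep_pullForm η hc he hz.1 (hμ _) hz.2
  have h2 : flatD Complex.I (chartRep c (pullForm μ η)) =ᶠ[nhds (c x)] fun z =>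
      (flatD Complex.I (chartRep e η) (e (μ (c.symm z)))).compContinuousLinearMap
        (fderiv ℝ (fun y => e (μ (c.symm y))) z) := by
    filter_upwards [h1.eventuallyEq_nhds, hev, hτ] with z hz1 hz2 hz3
    rw [flatD_congr hz1]
    exact flatD_pullback ((hsm z hz2.1 hz2.2).differentiableAt (by simp)) (hz3.of_le (by simp))
  have h3 : DifferentiableAt ℝ (flatD Complex.I (chartRep e η)) (e (μ (c.symm (c x)))) :=
    (contDiffAt_flatD (m' := 1) (hsm _ hx' hyc) (natCast_le_infty (1 + 1))).differentiableAt
      (by norm_num)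
  rw [flatD_congr h2]
  refine (flatD_pullback (τ := fun y => e (μ (c.symm y))) h3
    (hτ.self_of_nhds.of_le (by simp))).trans ?_
  rw [c.left_inv hx, h0]
  rfl

/-- The metrics `C μ^*η + θ` with `θ` closed satisfy assumption `(*)` if `η` does. -/
theorem satisfiesStar_smul_pullForm_add {μ : X' → X}
    (hμ : ContMDiff 𝓘(ℂ, Cn n) 𝓘(ℂ, Cn n) ω μ) {η : DForm n X 2} (hη : IsSmoothForm η)
    (hstar : SatisfiesStar η) {θ : DForm n X' 2} (hθ : ∀ x, SmoothFormAt θ x)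
    (hclosed : ∀ (c : OpenPartialHomeomorph X' (Cn n)),
      c ∈ IsManifold.maximalAtlas 𝓘(ℂ, Cn n) ω X' → ∀ x ∈ c.source, ∀ d : ℂ,
        d = -Complex.I ∨ d = Complex.I → flatD d (chartRep c θ) (c x) = 0) (C : ℂ) :
    SatisfiesStar (fun x => C • pullForm μ η x + θ x) := by
  intro k hk hkn
  have hηs := isSmoothForm_iff.1 hη
  have hpull : ∀ x, SmoothFormAt (pullForm μ η) x := fun x => (hηs (μ x)).pullForm hμ
  funext x
  have hc := IsManifold.chart_mem_maximalAtlas (I := 𝓘(ℂ, Cn n)) (n := ω) x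
  have hx := mem_chart_source (Cn n) x
  set c := chartAt (Cn n) x
  have h2 : ∀ {η : DForm n X' 2} {y}, SmoothFormAt η y → y ∈ c.source →
      ContDiffAt ℝ 2 (chartRep c η) (c y) := fun h hy => (h c hc hy).of_le (natCast_le_infty 2)
  refine (del_delbar_eq_zero_iff hc hx (Filter.Eventually.of_forall fun y =>
    (((hpull y).smul C).add (hθ y)).formPow k)).2 ?_
  have hrep : chartRep c (formPow (fun x => C • pullForm μ η x + θ x) k) = fun z =>
      wedgePow (C • chartRep c (pullForm μ η) z + chartRep c θ z) k :=
    funext fun z => chartRep_formPow _ c z k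
  rw [hrep]
  -- Here `m = n - 1`, the largest exponent covered by `(*)`.
  refine flatD_flatD_wedgePow_add_eq_zero (h2 (hpull x) hx) (h2 (hθ x) hx) C hk
    (Nat.le_sub_of_add_le hkn) ?_ (hclosed c hc x hx _ (Or.inl rfl)) ?_
  · intro j hj hjn
    have h3 := del_delbar_pullForm_eq_zero hμ (fun x => (hηs x).formPow j)
      (hstar j hj (by omega))
    rw [← formPow_pullForm] at h3
    have h4 := (del_delbar_eq_zero_iff hc hx (Filter.Eventually.of_forall fun y =>
      (hpull y).formPow j)).1 (congrFun h3 x)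
    rwa [funext fun z => chartRep_formPow (pullForm μ η) c z j] at h4
  · filter_upwards [c.open_target.mem_nhds (c.map_source hx)] with z hz
    have := hclosed c hc (c.symm z) (c.map_target hz) _ (Or.inr rfl)
    rwa [c.right_inv hz] at this

/-- Only `n = 1` falls outside `(*)`: there the exponent is `0`, and `η^0` is the constant `1`. -/
theorem SatisfiesStar.isGauduchon {η : DForm n X 2} (h : SatisfiesStar η) : IsGauduchon η := by
  intro k hk
  rcases Nat.eq_zero_or_pos k with rfl | hk0
  · have h0 : ∀ (c : OpenPartialHomeomorph X (Cn n)), chartRep c (formPow η 0) = fun _ =>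
        ContinuousAlternatingMap.constOfIsEmpty ℝ (Cn n) (Fin 0) (1 : ℂ) := fun c => rfl
    have hsm : ∀ x, SmoothFormAt (formPow η 0) x := fun x c _ _ => by
      rw [h0]; exact contDiffAt_const
    funext x
    refine (del_delbar_eq_zero_iff (IsManifold.chart_mem_maximalAtlas (I := 𝓘(ℂ, Cn n)) (n := ω) x)
      (mem_chart_source (Cn n) x) (Filter.Eventually.of_forall hsm)).2 ?_
    rw [h0, funext (flatD_constForm (c := Complex.I) _), flatD_constForm]
  · exact h k hk0 hk.le

end Star

/-! ### Smooth dependence of integrals on parameters. -/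

section ParametricIntegral

variable {E F : Type*} [NormedAddCommGroup E] [NormedSpace ℝ E] [FiniteDimensional ℝ E]
  [NormedAddCommGroup F] [NormedSpace ℝ F]

theorem hasFDerivAt_integral_of_contDiff {H : E × ℝ → F} (hH : ContDiff ℝ 1 H) (u : E) :
    HasFDerivAt (fun u => ∫ t in (0 : ℝ)..1, H (u, t))
      (∫ t in (0 : ℝ)..1, (fderiv ℝ H (u, t)).comp (ContinuousLinearMap.inl ℝ E ℝ)) u := by
  have hc : Continuous fun q : E × ℝ => (fderiv ℝ H q).comp (ContinuousLinearMap.inl ℝ E ℝ) :=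
    (hH.continuous_fderiv (by norm_num)).clm_comp continuous_const
  obtain ⟨M, hM⟩ := ((isCompact_closedBall u 1).prod (isCompact_Icc (a := (0 : ℝ))
    (b := 1))).exists_bound_of_continuousOn hc.continuousOn
  refine intervalIntegral.hasFDerivAt_integral_of_dominated_of_fderiv_le (bound := fun _ => M)
    (F' := fun x t => (fderiv ℝ H (x, t)).comp (ContinuousLinearMap.inl ℝ E ℝ))
    (Metric.closedBall_mem_nhds u one_pos) (Filter.Eventually.of_forall fun x => ?_) ?_ ?_ ?_ ?_ ?_
  · exact (hH.continuous.comp (by fun_prop : Continuous fun t : ℝ => (x, t))).aestronglyMeasurable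
  · exact (hH.continuous.comp (by fun_prop : Continuous fun t : ℝ => (u, t))).intervalIntegrable _ _
  · exact (hc.comp (by fun_prop : Continuous fun t : ℝ => (u, t))).aestronglyMeasurable
  · refine Filter.Eventually.of_forall fun t ht x hx => hM (x, t) ⟨hx, ?_⟩
    rw [Set.uIoc_of_le zero_le_one] at ht
    exact ⟨ht.1.le, ht.2⟩
  · exact continuous_const.intervalIntegrable _ _
  · refine Filter.Eventually.of_forall fun t _ x _ => ?_
    exact ((hH.differentiable (by norm_num)) (x, t)).hasFDerivAt.comp x (hasFDerivAt_prodMk_left x t)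

/-- Induction on the order, with `H` varying: differentiating under the integral in the direction
`y` gives an integral of the same kind, for the derivative of `H` in the direction `(y, 0)`. -/
theorem contDiff_integral {H : E × ℝ → F} (hH : ContDiff ℝ ∞ H) :
    ContDiff ℝ ∞ fun u => ∫ t in (0 : ℝ)..1, H (u, t) := by
  rw [contDiff_infty]
  intro m
  induction m generalizing H with
  | zero =>
    exact contDiff_zero.2 (intervalIntegral.continuous_parametric_intervalIntegral_of_continuous'
      (f := fun u t => H (u, t)) hH.continuous 0 1)
  | succ m ih =>
    have h1 : ContDiff ℝ 1 H := hH.of_le (by exact_mod_cast natCast_le_infty 1)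
    refine contDiff_succ_iff_fderiv_apply.2
      ⟨fun u => (hasFDerivAt_integral_of_contDiff h1 u).differentiableAt,
        fun h => absurd h (WithTop.natCast_ne_top _), fun y => ?_⟩
    have h2 : (fun u => fderiv ℝ (fun u => ∫ t in (0 : ℝ)..1, H (u, t)) u y) =
        fun u => ∫ t in (0 : ℝ)..1, fderiv ℝ H (u, t) (y, 0) := by
      funext u
      rw [(hasFDerivAt_integral_of_contDiff h1 u).fderiv,
        ContinuousLinearMap.intervalIntegral_apply]
      · rfl
      · exact (((h1.continuous_fderiv (by norm_num)).comp
          (by fun_prop : Continuous fun t : ℝ => (u, t))).clm_comp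
            continuous_const).intervalIntegrable _ _
    rw [h2]
    exact ih (H := fun q => fderiv ℝ H q (y, 0))
      ((hH.fderiv_right (m := ∞) (by simp)).clm_apply contDiff_const)

end ParametricIntegral

/-! ### Division of a holomorphic function by a coordinate. -/

section Division

variable {n : ℕ}

/-- The projection of `ℂⁿ` onto the hyperplane `u_k = 0`. -/
noncomputable def hyperplaneProj (k : Fin n) (u : Cn n) : Cn n :=
  u - u k • EuclideanSpace.single k (1 : ℂ)

theorem contDiff_hyperplaneProj (k : Fin n) : ContDiff ℝ ∞ (hyperplaneProj (n := n) k) := by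
  unfold hyperplaneProj
  fun_prop

theorem hyperplaneProj_apply_self (k : Fin n) (u : Cn n) : hyperplaneProj k u k = 0 := by
  simp [hyperplaneProj]

theorem hyperplaneProj_of_eq_zero {k : Fin n} {u : Cn n} (hu : u k = 0) :
    hyperplaneProj k u = u := by
  simp [hyperplaneProj, hu]

/-- A bump function extends the germ to a globally smooth function, as required for the parametric
integral; holomorphy is kept only near the point. -/
theorem exists_contDiff_eq_near {F : Cn n → ℂ} {u : Cn n} (hF : ContDiffAt ℂ ω F u) :
    ∃ F' : Cn n → ℂ, ContDiff ℝ ∞ F' ∧ ∀ᶠ y in nhds u, F' y = F y := by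
  have h1 : ∀ᶠ y in nhds u, ContDiffAt ℝ ∞ F y := by
    filter_upwards [hF.eventually (by simp)] with y hy
    exact (hy.restrict_scalars ℝ).of_le (by simp)
  obtain ⟨r, hr, hb⟩ := Metric.eventually_nhds_iff_ball.1 h1
  let χ : ContDiffBump u := ⟨r / 3, r / 2, by positivity, by linarith⟩
  refine ⟨fun y => χ y • F y, contDiff_iff_contDiffAt.2 fun y => ?_, ?_⟩
  · by_cases hy : y ∈ Metric.ball u r
    · exact χ.contDiffAt.smul (hb y hy)
    · have : (fun y => χ y • F y) =ᶠ[nhds y] fun _ => 0 := by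
        have hy' : y ∉ tsupport χ := fun h => hy (by
          rw [χ.tsupport_eq] at h
          exact Metric.closedBall_subset_ball (by change r / 2 < r; linarith) h)
        filter_upwards [(isClosed_tsupport _).isOpen_compl.mem_nhds hy'] with z hz
        rw [image_eq_zero_of_notMem_tsupport hz, zero_smul]
      exact contDiffAt_const.congr_of_eventuallyEq this
  · filter_upwards [χ.eventuallyEq_one] with y hy
    rw [hy]; simp

/-- A holomorphic function that vanishes on the hyperplane `u_k = 0` is the product of `u_k` and of
a smooth function. -/
theorem exists_eq_mul_of_eq_zero_on_hyperplane {F : Cn n → ℂ} {u : Cn n} {k : Fin n}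
    (hF : ContDiffAt ℂ ω F u) (hu : u k = 0) (h0 : ∀ᶠ y in nhds u, y k = 0 → F y = 0) :
    ∃ G : Cn n → ℂ, ContDiff ℝ ∞ G ∧ (∀ᶠ y in nhds u, F y = y k * G y) ∧
      ∀ᶠ y in nhds u, y k = 0 → G y = fderiv ℂ F y (EuclideanSpace.single k 1) := by
  obtain ⟨F', hF', hFF'⟩ := exists_contDiff_eq_near hF
  have hev : ∀ᶠ y in nhds u, F' =ᶠ[nhds y] F ∧ DifferentiableAt ℂ F y ∧ (y k = 0 → F y = 0) := by
    filter_upwards [hFF'.eventually_nhds, hF.eventually (by simp), h0] with y h1 h2 h3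
    exact ⟨h1, h2.differentiableAt (by simp), h3⟩
  obtain ⟨r, hr, hb⟩ := Metric.eventually_nhds_iff_ball.1 hev
  have hfd : ∀ y ∈ Metric.ball u r, fderiv ℝ F' y = (fderiv ℂ F y).restrictScalars ℝ := by
    intro y hy
    rw [(hb y hy).1.fderiv_eq (𝕜 := ℝ), (hb y hy).2.1.fderiv_restrictScalars ℝ]
  have hPc : ∀ᶠ y in nhds u, hyperplaneProj k y ∈ Metric.ball u r := by
    refine (contDiff_hyperplaneProj k).continuous.continuousAt.eventually ?_
    rw [hyperplaneProj_of_eq_zero hu]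
    exact Metric.ball_mem_nhds u hr
  -- Hadamard's lemma: the quotient is the average of the `k`-th derivative over the segment from
  -- the projection of `y` on the hyperplane to `y`.
  refine ⟨fun y => ∫ t in (0 : ℝ)..1, fderiv ℝ F'
      (hyperplaneProj k y + t • (y - hyperplaneProj k y)) (EuclideanSpace.single k 1),
    contDiff_integral (H := fun q : Cn n × ℝ => fderiv ℝ F'
      (hyperplaneProj k q.1 + q.2 • (q.1 - hyperplaneProj k q.1)) (EuclideanSpace.single k 1)) ?_,
    ?_, ?_⟩
  · have hP := (contDiff_hyperplaneProj k).comp (contDiff_fst (𝕜 := ℝ) (E := Cn n) (F := ℝ)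
      (n := ∞))
    exact ((hF'.fderiv_right (m := ∞) (by simp)).comp
      (hP.add (contDiff_snd.smul (contDiff_fst.sub hP)))).clm_apply contDiff_const
  · filter_upwards [hPc, Metric.ball_mem_nhds u hr] with y hPy hy
    have hseg : ∀ t ∈ Set.Icc (0 : ℝ) 1,
        hyperplaneProj k y + t • (y - hyperplaneProj k y) ∈ Metric.ball u r := fun t ht =>
      (convex_ball u r).add_smul_sub_mem hPy hy ht
    have hder : ∀ t ∈ Set.uIcc (0 : ℝ) 1, HasDerivAt
        (fun t : ℝ => F' (hyperplaneProj k y + t • (y - hyperplaneProj k y)))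
        (y k * fderiv ℝ F' (hyperplaneProj k y + t • (y - hyperplaneProj k y))
          (EuclideanSpace.single k 1)) t := by
      intro t ht
      rw [Set.uIcc_of_le zero_le_one] at ht
      have hl : HasDerivAt (fun t : ℝ => hyperplaneProj k y + t • (y - hyperplaneProj k y))
          (y - hyperplaneProj k y) t := by
        simpa using ((hasDerivAt_id t).smul_const (y - hyperplaneProj k y)).const_add
          (hyperplaneProj k y)
      have := ((hF'.differentiable (by simp)) (hyperplaneProj k y +
        t • (y - hyperplaneProj k y))).hasFDerivAt.comp_hasDerivAt t hl
      -- The increment is a complex multiple of the `k`-th basis vector; complex linearity of the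
      -- derivative of `F` lets the factor `y k` come out.
      have e1 : y - hyperplaneProj k y = y k • EuclideanSpace.single k (1 : ℂ) := by
        simp [hyperplaneProj]
      refine this.congr_deriv ?_
      rw [hfd _ (hseg t ht)]
      change fderiv ℂ F _ (y - hyperplaneProj k y) = _
      conv_lhs => arg 2; rw [e1]
      exact map_smul _ _ _
    have hcont : Continuous fun t : ℝ => y k * fderiv ℝ F'
        (hyperplaneProj k y + t • (y - hyperplaneProj k y)) (EuclideanSpace.single k 1) := by
      refine continuous_const.mul (((hF'.continuous_fderiv (by simp)).comp ?_).clm_apply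
        continuous_const)
      fun_prop
    have hint := intervalIntegral.integral_eq_sub_of_hasDerivAt hder (hcont.intervalIntegrable 0 1)
    rw [intervalIntegral.integral_const_mul] at hint
    have hP0 : F' (hyperplaneProj k y) = 0 := by
      rw [(hb _ hPy).1.eq_of_nhds]
      exact (hb _ hPy).2.2 (hyperplaneProj_apply_self k y)
    simp only [one_smul, zero_smul, add_zero, add_sub_cancel, hP0, sub_zero] at hint
    rw [hint, (hb y hy).1.eq_of_nhds]
  · filter_upwards [Metric.ball_mem_nhds u hr] with y hy hk
    simp only [hyperplaneProj_of_eq_zero hk, sub_self, smul_zero, add_zero, hfd y hy]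
    simp

end Division

/-! ### Strict subharmonicity of the logarithm of a sum of squares of affine functions. -/

section Positivity

variable {E : Type*} [NormedAddCommGroup E] [NormedSpace ℝ E]

/-- Along the line this is `(log q)'' = (q'' q - q'²) / q²` at `t = 0`, for `q = A + Bt + Dt²`. -/
theorem fderiv_fderiv_apply_of_log_quadratic {f : E → ℝ} {u v : E} (hf : ContDiffAt ℝ 2 f u)
    {A B D : ℝ} (hA : 0 < A)
    (h : ∀ᶠ t in nhds (0 : ℝ), f (u + t • v) = Real.log (A + B * t + D * t ^ 2)) :
    fderiv ℝ (fderiv ℝ f) u v v = (2 * D * A - B ^ 2) / A ^ 2 := by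
  have hline : ∀ t : ℝ, HasDerivAt (fun t : ℝ => u + t • v) v t := fun t => by
    simpa using ((hasDerivAt_id t).smul_const v).const_add u
  have hq : ∀ t : ℝ, HasDerivAt (fun t => A + B * t + D * t ^ 2) (B + D * (2 * t)) t := fun t => by
    have h1 : HasDerivAt (fun t : ℝ => B * t) B t := by
      simpa using (hasDerivAt_id t).const_mul B
    have h2 : HasDerivAt (fun t : ℝ => D * t ^ 2) (D * (2 * t)) t := by
      simpa using (hasDerivAt_pow 2 t).const_mul D
    exact (h1.const_add A).add h2
  have hqpos : ∀ᶠ t in nhds (0 : ℝ), A + B * t + D * t ^ 2 ≠ 0 := by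
    refine (hq 0).continuousAt.eventually_ne ?_
    simpa using hA.ne'
  have hfev : ∀ᶠ t in nhds (0 : ℝ), DifferentiableAt ℝ f (u + t • v) := by
    have : ContinuousAt (fun t : ℝ => u + t • v) 0 := (hline 0).continuousAt
    refine this.eventually ?_
    simp only [zero_smul, add_zero]
    filter_upwards [hf.eventually (by norm_num)] with y hy
    exact hy.differentiableAt (by norm_num)
  have h1 : (fun t : ℝ => fderiv ℝ f (u + t • v) v) =ᶠ[nhds 0]
      fun t => (B + D * (2 * t)) / (A + B * t + D * t ^ 2) := by
    filter_upwards [h.eventually_nhds, hqpos, hfev] with t ht hqt hft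
    have e1 : HasDerivAt (fun t : ℝ => f (u + t • v)) (fderiv ℝ f (u + t • v) v) t :=
      hft.hasFDerivAt.comp_hasDerivAt t (hline t)
    have e2 : HasDerivAt (fun t : ℝ => Real.log (A + B * t + D * t ^ 2))
        ((B + D * (2 * t)) / (A + B * t + D * t ^ 2)) t := (hq t).log hqt
    exact e1.unique (e2.congr_of_eventuallyEq ht)
  have hd2 : DifferentiableAt ℝ (fderiv ℝ f) (u + (0 : ℝ) • v) := by
    simpa using (hf.fderiv_right (m := 1) (by norm_num)).differentiableAt (by norm_num)
  have h2 : HasDerivAt (fun t : ℝ => fderiv ℝ f (u + t • v) v)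
      (fderiv ℝ (fderiv ℝ f) (u + (0 : ℝ) • v) v v) 0 := by
    have h5 : HasFDerivAt (fun y => fderiv ℝ f y v) ((ContinuousLinearMap.apply ℝ ℝ v).comp
        (fderiv ℝ (fderiv ℝ f) (u + (0 : ℝ) • v))) (u + (0 : ℝ) • v) :=
      (ContinuousLinearMap.apply ℝ ℝ v).hasFDerivAt.comp _ hd2.hasFDerivAt
    exact h5.comp_hasDerivAt 0 (hline 0)
  have hB : HasDerivAt (fun t : ℝ => B + D * (2 * t)) (D * 2) 0 := by
    simpa using (((hasDerivAt_id (0 : ℝ)).const_mul 2).const_mul D).const_add B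
  have hq0 : A + B * (0 : ℝ) + D * (0 : ℝ) ^ 2 ≠ 0 := by simpa using hA.ne'
  have h3 := (hB.fun_div (hq 0) hq0).congr_of_eventuallyEq h1
  have h4 := h2.unique h3
  rw [zero_smul, add_zero] at h4
  rw [h4]
  simp only [mul_zero, add_zero, ne_eq, OfNat.ofNat_ne_zero, not_false_eq_true, zero_pow]
  ring

/-- The strict Cauchy-Schwarz inequality for vectors that are not proportional because the first one
has a nonzero component where the second one vanishes, and the second one is not zero. -/
theorem norm_sq_sum_lt {ι : Type*} {s : Finset ι} {w : ι → ℝ} {α β : ι → ℂ} (hw : ∀ a ∈ s, 0 ≤ w a)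
    {a b : ι} (ha : a ∈ s) (hwa : 0 < w a) (hαa : α a ≠ 0) (hβa : β a = 0) (hb : b ∈ s)
    (hwb : 0 < w b) (hβb : β b ≠ 0) :
    ‖∑ i ∈ s, (w i : ℂ) * ((starRingEnd ℂ) (α i) * β i)‖ ^ 2 <
      (∑ i ∈ s, w i * ‖α i‖ ^ 2) * ∑ i ∈ s, w i * ‖β i‖ ^ 2 := by
  set A := ∑ i ∈ s, w i * ‖α i‖ ^ 2
  set D := ∑ i ∈ s, w i * ‖β i‖ ^ 2
  set B := ∑ i ∈ s, (w i : ℂ) * ((starRingEnd ℂ) (α i) * β i)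
  have hA : 0 < A := Finset.sum_pos' (fun i hi => mul_nonneg (hw i hi) (by positivity))
    ⟨a, ha, by positivity⟩
  -- Lagrange's identity: up to the factor `A`, the defect in Cauchy-Schwarz is the squared length
  -- of `A β - B α`, so it remains to find one nonzero component.
  have key : ∑ i ∈ s, w i * ‖A * β i - B * α i‖ ^ 2 = A * (A * D - ‖B‖ ^ 2) := by
    have e : ∀ z : ℂ, ((‖z‖ ^ 2 : ℝ) : ℂ) = z * (starRingEnd ℂ) z := fun z => by
      rw [Complex.mul_conj, Complex.normSq_eq_norm_sq]
    have hB' : (starRingEnd ℂ) B = ∑ i ∈ s, (w i : ℂ) * (α i * (starRingEnd ℂ) (β i)) := by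
      simp [B, map_sum]
    have hAc : (A : ℂ) = ∑ i ∈ s, (w i : ℂ) * (α i * (starRingEnd ℂ) (α i)) := by
      simp only [A, Complex.ofReal_sum, Complex.ofReal_mul, e]
    have hDc : (D : ℂ) = ∑ i ∈ s, (w i : ℂ) * (β i * (starRingEnd ℂ) (β i)) := by
      simp only [D, Complex.ofReal_sum, Complex.ofReal_mul, e]
    have : ((∑ i ∈ s, w i * ‖A * β i - B * α i‖ ^ 2 : ℝ) : ℂ) =
        ((A * (A * D - ‖B‖ ^ 2) : ℝ) : ℂ) := by
      have e2 : ∀ i ∈ s, (w i : ℂ) * ((‖A * β i - B * α i‖ ^ 2 : ℝ) : ℂ) =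
          (A : ℂ) ^ 2 * ((w i : ℂ) * (β i * (starRingEnd ℂ) (β i))) -
          A * (starRingEnd ℂ) B * ((w i : ℂ) * ((starRingEnd ℂ) (α i) * β i)) -
          A * B * ((w i : ℂ) * (α i * (starRingEnd ℂ) (β i))) +
          B * (starRingEnd ℂ) B * ((w i : ℂ) * (α i * (starRingEnd ℂ) (α i))) := by
        intro i _
        rw [e]
        simp only [map_sub, map_mul, Complex.conj_ofReal]
        ring
      simp only [Complex.ofReal_sum, Complex.ofReal_mul]
      rw [Finset.sum_congr rfl e2, Finset.sum_add_distrib, Finset.sum_sub_distrib,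
        Finset.sum_sub_distrib, ← Finset.mul_sum, ← Finset.mul_sum, ← Finset.mul_sum,
        ← Finset.mul_sum, ← hAc, ← hDc, ← hB']
      rw [Complex.ofReal_sub, e]
      push_cast
      change _ - _ * B - _ + _ = _
      ring
    exact_mod_cast this
  have hpos : 0 < ∑ i ∈ s, w i * ‖A * β i - B * α i‖ ^ 2 := by
    refine Finset.sum_pos' (fun i hi => mul_nonneg (hw i hi) (by positivity)) ?_
    -- If `B = 0`, the component at `b` is `A β_b`; otherwise the component at `a` is `-B α_a`.
    by_cases hB0 : B = 0
    · refine ⟨b, hb, ?_⟩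
      have : (A : ℂ) * β b - B * α b ≠ 0 := by
        rw [hB0, zero_mul, sub_zero]
        exact mul_ne_zero (by exact_mod_cast hA.ne') hβb
      positivity
    · refine ⟨a, ha, ?_⟩
      have : (A : ℂ) * β a - B * α a ≠ 0 := by
        rw [hβa, mul_zero, zero_sub]
        exact neg_ne_zero.2 (mul_ne_zero hB0 hαa)
      positivity
  rw [key] at hpos
  have := (mul_pos_iff_of_pos_left hA).1 hpos
  linarith

/-- The logarithm of a sum of squares of affine functions on a complex line is strictly
subharmonic, unless these functions are proportional. -/
theorem laplacian_log_sum_norm_sq_pos [NormedSpace ℂ E] [IsScalarTower ℝ ℂ E] {f : E → ℝ} {u v : E}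
    (hf : ContDiffAt ℝ 2 f u) {ι : Type*} {s : Finset ι} {w : ι → ℝ} {α β : ι → ℂ}
    (h : ∀ᶠ ζ in nhds (0 : ℂ), f (u + ζ • v) = Real.log (∑ i ∈ s, w i * ‖α i + ζ * β i‖ ^ 2))
    (hw : ∀ a ∈ s, 0 ≤ w a) {a b : ι} (ha : a ∈ s) (hwa : 0 < w a) (hαa : α a ≠ 0) (hβa : β a = 0)
    (hb : b ∈ s) (hwb : 0 < w b) (hβb : β b ≠ 0) :
    0 < fderiv ℝ (fderiv ℝ f) u v v +
      fderiv ℝ (fderiv ℝ f) u (Complex.I • v) (Complex.I • v) := by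
  have hlt := norm_sq_sum_lt hw ha hwa hαa hβa hb hwb hβb
  set A := ∑ i ∈ s, w i * ‖α i‖ ^ 2
  set D := ∑ i ∈ s, w i * ‖β i‖ ^ 2
  set B := ∑ i ∈ s, (w i : ℂ) * ((starRingEnd ℂ) (α i) * β i)
  have hA : 0 < A := Finset.sum_pos' (fun i hi => mul_nonneg (hw i hi) (by positivity))
    ⟨a, ha, by positivity⟩
  have hexp : ∀ ζ : ℂ, ∑ i ∈ s, w i * ‖α i + ζ * β i‖ ^ 2 =
      A + 2 * (ζ * B).re + D * ‖ζ‖ ^ 2 := by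
    intro ζ
    rw [show 2 * (ζ * B).re = ∑ i ∈ s, w i * (2 * (ζ * ((starRingEnd ℂ) (α i) * β i)).re) by
      rw [Finset.mul_sum, Complex.re_sum, Finset.mul_sum]
      refine Finset.sum_congr rfl fun i _ => ?_
      rw [mul_left_comm ζ, Complex.re_ofReal_mul]
      ring, Finset.sum_mul, ← Finset.sum_add_distrib, ← Finset.sum_add_distrib]
    refine Finset.sum_congr rfl fun i _ => ?_
    rw [← Complex.normSq_eq_norm_sq, ← Complex.normSq_eq_norm_sq, ← Complex.normSq_eq_norm_sq,
      ← Complex.normSq_eq_norm_sq, Complex.normSq_add, Complex.normSq_mul]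
    have : (α i * (starRingEnd ℂ) (ζ * β i)).re = (ζ * ((starRingEnd ℂ) (α i) * β i)).re := by
      rw [← Complex.conj_re]
      congr 1
      simp only [map_mul, Complex.conj_conj]
      ring
    rw [this]
    ring
  have hdir : ∀ c : ℂ, ‖c‖ = 1 → fderiv ℝ (fderiv ℝ f) u (c • v) (c • v) =
      (2 * D * A - (2 * (c * B).re) ^ 2) / A ^ 2 := by
    intro c hc
    refine fderiv_fderiv_apply_of_log_quadratic hf hA ?_
    have hcont : ContinuousAt (fun t : ℝ => (t : ℂ) * c) 0 := by fun_prop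
    have := hcont.eventually (by simpa using h)
    filter_upwards [this] with t ht
    rw [show t • c • v = ((t : ℂ) * c) • v by
      rw [← smul_assoc, Complex.real_smul], ht, hexp, norm_mul, hc, Complex.norm_real, mul_one,
      Real.norm_eq_abs, sq_abs, mul_assoc, Complex.re_ofReal_mul]
    congr 1
    ring
  -- The directions `1` and `i` see `Re B` and `-Im B`, so the two second derivatives add up to `4
  -- (A D - |B|²) / A²`.
  have h1 := hdir 1 (by simp)
  have h2 := hdir Complex.I (by simp)
  rw [one_smul, one_mul] at h1
  rw [h1, h2, ← add_div]
  have hB : ‖B‖ ^ 2 = B.re ^ 2 + B.im ^ 2 := by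
    rw [← Complex.normSq_eq_norm_sq, Complex.normSq_apply]; ring
  have : (Complex.I * B).re = -B.im := by simp
  rw [this]
  refine div_pos ?_ (by positivity)
  nlinarith

end Positivity

/-! ### Perturbation of a semipositive form. -/

section Compactness

variable {T E : Type*} [TopologicalSpace T] [NormedAddCommGroup E] [NormedSpace ℝ E]
  [FiniteDimensional ℝ E]

/-- A semipositive quadratic form becomes positive after the addition of a small multiple of a
form that is positive on its kernel. -/
theorem eventually_add_mul_pos {A B : T → E → ℝ} {x : T}
    (hA : ∀ w, ContinuousAt (fun q : T × E => A q.1 q.2) (x, w))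
    (hB : ∀ w, ContinuousAt (fun q : T × E => B q.1 q.2) (x, w))
    (hAs : ∀ (r : ℝ) y w, A y (r • w) = r ^ 2 * A y w)
    (hBs : ∀ (r : ℝ) y w, B y (r • w) = r ^ 2 * B y w)
    (hA0 : ∀ y w, 0 ≤ A y w) (hAB : ∀ w, w ≠ 0 → A x w = 0 → 0 < B x w) :
    ∀ᶠ q : ℝ × T in nhds (0, x), 0 < q.1 → ∀ w, w ≠ 0 → 0 < A q.2 w + q.1 * B q.2 w := by
  -- By homogeneity the compact unit sphere suffices. At a vector with `A > 0`, continuity absorbs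
  -- the small perturbation; at one with `A = 0`, positivity of `B` persists nearby and `A ≥ 0` does
  -- the rest.
  have h : ∀ᶠ q : ℝ × T in nhds (0, x), ∀ w ∈ Metric.sphere (0 : E) 1,
      0 < q.1 → 0 < A q.2 w + q.1 * B q.2 w := by
    refine (isCompact_sphere (0 : E) 1).eventually_forall_of_forall_eventually fun w hw => ?_
    have hw0 : w ≠ 0 := fun h => by simp [h] at hw
    have hp : ContinuousAt (fun q : (ℝ × T) × E => (q.1.2, q.2)) ((0, x), w) := by fun_prop
    have hA' : ContinuousAt (fun q : (ℝ × T) × E => A q.1.2 q.2) ((0, x), w) :=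
      ContinuousAt.comp (f := fun q : (ℝ × T) × E => (q.1.2, q.2))
        (g := fun q : T × E => A q.1 q.2) (hA w) hp
    have hB' : ContinuousAt (fun q : (ℝ × T) × E => B q.1.2 q.2) ((0, x), w) :=
      ContinuousAt.comp (f := fun q : (ℝ × T) × E => (q.1.2, q.2))
        (g := fun q : T × E => B q.1 q.2) (hB w) hp
    rcases (hA0 x w).lt_or_eq with hpos | hzero
    · have hs : ContinuousAt (fun q : (ℝ × T) × E => A q.1.2 q.2 + q.1.1 * B q.1.2 q.2)
          ((0, x), w) := hA'.add ((by fun_prop : ContinuousAt (fun q : (ℝ × T) × E => q.1.1)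
            ((0, x), w)).mul hB')
      filter_upwards [hs.eventually_const_lt (by simpa using hpos)] with q hq _ using hq
    · filter_upwards [hB'.eventually_const_lt (hAB w hw0 hzero.symm)] with q hq hq0
      have := hA0 q.1.2 q.2
      have := mul_pos hq0 hq
      linarith
  filter_upwards [h] with q hq hq0 w hw
  have hn : 0 < ‖w‖ := norm_pos_iff.2 hw
  have h1 := hq (‖w‖⁻¹ • w) (by simp [norm_smul, hn.ne']) hq0
  have h2 : w = ‖w‖ • (‖w‖⁻¹ • w) := by rw [smul_smul, mul_inv_cancel₀ hn.ne', one_smul]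
  rw [h2, hAs, hBs]
  have := mul_pos (pow_pos hn 2) h1
  linarith

end Compactness

/-! ### The blow-down map in affine coordinates. -/

section BlowDown

variable {n : ℕ}

/-- The blow-down map in the `k`-th standard affine chart. -/
noncomputable def blowDown (S : Finset (Fin n)) (k : S) (u : Cn n) : Cn n := (affineChart S k u).1

theorem blowDown_apply (S : Finset (Fin n)) (k : S) (u : Cn n) (i : Fin n) :
    blowDown S k u i = if i ∈ S ∧ i ≠ k then u k * u i else u i := rfl

theorem blowDown_apply_self (S : Finset (Fin n)) (k : S) (u : Cn n) : blowDown S k u k = u k := by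
  simp [blowDown_apply]

theorem blowDown_eq_zero {S : Finset (Fin n)} {k : S} {u : Cn n} (hu : u k = 0) {i : Fin n}
    (hi : i ∈ S) : blowDown S k u i = 0 := by
  rw [blowDown_apply]
  split_ifs with h
  · rw [hu, zero_mul]
  · rw [not_and_not_right] at h
    rw [h hi, hu]

theorem contDiff_blowDown (S : Finset (Fin n)) (k : S) : ContDiff ℂ ω (blowDown S k) := by
  rw [contDiff_euclidean]
  intro i
  simp only [blowDown_apply]
  split_ifs <;> fun_prop

theorem fderiv_blowDown (S : Finset (Fin n)) (k : S) (u w : Cn n) (i : Fin n) :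
    fderiv ℂ (blowDown S k) u w i = if i ∈ S ∧ i ≠ k then u k * w i + w k * u i else w i := by
  have h1 := ((EuclideanSpace.proj (𝕜 := ℂ) i).hasFDerivAt.comp u
    (((contDiff_blowDown S k).differentiable (by simp)) u).hasFDerivAt).fderiv
  have h2 : fderiv ℂ (blowDown S k) u w i = fderiv ℂ (fun u => blowDown S k u i) u w :=
    (congrArg (fun T : Cn n →L[ℂ] ℂ => T w) h1).symm
  have hp : ∀ a : Fin n, HasFDerivAt (fun u : Cn n => u a) (EuclideanSpace.proj (𝕜 := ℂ) a) u :=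
    fun a => (EuclideanSpace.proj (𝕜 := ℂ) a : Cn n →L[ℂ] ℂ).hasFDerivAt
  rw [h2]
  simp only [blowDown_apply]
  split_ifs
  · rw [((hp k).fun_mul (hp i)).fderiv]
    simp [mul_comm]
  · rw [(hp i).fderiv]
    rfl

end BlowDown

/-! ### The local factorization of the centre function on the blow-up. -/

section LocalPotential

variable {n : ℕ} {J : Type*} [Fintype J] {S : Finset (Fin n)} {k : S} {u : Cn n}

/-- A weighted sum of squared norms of functions that vanish on the centre, pulled back to an affine
chart of the blow-up, is the product of the squared norm of the equation of the exceptional divisor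
and of a positive function whose logarithm is strictly subharmonic along the fibres. -/
theorem exists_local_potential {S' : J → Finset (Fin n)} {T : J → Cn n → Cn n} {χ : J → Cn n → ℝ}
    (hu : u k = 0) (hχ0 : ∀ j z, 0 ≤ χ j z)
    (hχ : ∀ j, ∀ᶠ z in nhds (blowDown S k u), ContDiffAt ℝ ∞ (χ j) z)
    (hT : ∀ j, (∀ᶠ z in nhds (blowDown S k u), χ j z = 0) ∨
      (ContDiffAt ℂ ω (T j) (blowDown S k u) ∧
        ∀ᶠ z in nhds (blowDown S k u), (∀ i ∈ S, z i = 0) → ∀ i ∈ S' j, T j z i = 0))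
    {j₀ : J} (hj₀ : 0 < χ j₀ (blowDown S k u)) (hS : S' j₀ = S)
    (hT₀ : ∀ᶠ z in nhds (blowDown S k u), T j₀ z = z) :
    ∃ g : Cn n → ℝ, (∀ᶠ y in nhds u, ContDiffAt ℝ ∞ g y) ∧ 0 < g u ∧
      (∀ᶠ y in nhds u, ∑ j, χ j (blowDown S k y) * ∑ i ∈ S' j, ‖T j (blowDown S k y) i‖ ^ 2 =
        ‖y k‖ ^ 2 * g y) ∧
      ∀ w : Cn n, w ≠ 0 → w k = 0 → (∀ i, i ∉ S → w i = 0) →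
        0 < fderiv ℝ (fderiv ℝ fun y => Real.log (g y)) u w w +
          fderiv ℝ (fderiv ℝ fun y => Real.log (g y)) u (Complex.I • w) (Complex.I • w) := by
  have hβ := contDiff_blowDown S k
  have hβc : ContinuousAt (blowDown S k) u := hβ.continuous.continuousAt
  -- `G` is the quotient of the `i`-th component of `T j ∘ blowDown` by `y k`. On the fibre through
  -- `u` it equals the `k`-th derivative, computed by the chain rule. The conditions on `χ` cover
  -- the indices for which `T j` is arbitrary because its weight vanishes nearby.
  have hG : ∀ j i, ∃ G : Cn n → ℂ, ContDiff ℝ ∞ G ∧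
      (i ∈ S' j → ∀ᶠ y in nhds u, χ j (blowDown S k y) * ‖T j (blowDown S k y) i‖ ^ 2 =
        ‖y k‖ ^ 2 * (χ j (blowDown S k y) * ‖G y‖ ^ 2)) ∧
      (i ∈ S' j → ∀ᶠ y in nhds u, blowDown S k y = blowDown S k u → χ j (blowDown S k u) ≠ 0 →
        G y = fderiv ℂ (fun z => T j z i) (blowDown S k u)
          (fderiv ℂ (blowDown S k) y (EuclideanSpace.single (k : Fin n) 1))) := by
    intro j i
    by_cases hi : i ∈ S' j
    swap
    · exact ⟨0, contDiff_const, fun h => absurd h hi, fun h => absurd h hi⟩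
    rcases hT j with h0 | ⟨hTj, hT0⟩
    · refine ⟨0, contDiff_const, fun _ => ?_, fun _ =>
        Filter.Eventually.of_forall fun y _ hy => absurd h0.self_of_nhds hy⟩
      filter_upwards [hβc.eventually h0] with y hy
      simp [hy]
    · have hTi : ContDiffAt ℂ ω (fun z => T j z i) (blowDown S k u) :=
        (contDiffAt_euclidean.1 hTj) i
      have hF : ContDiffAt ℂ ω (fun y => T j (blowDown S k y) i) u :=
        hTi.comp u hβ.contDiffAt
      obtain ⟨G, hGs, hGe, hGd⟩ := exists_eq_mul_of_eq_zero_on_hyperplane hF hu (by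
        filter_upwards [hβc.eventually hT0] with y hy hk
        exact hy (fun i hi => blowDown_eq_zero hk hi) i hi)
      refine ⟨G, hGs, fun _ => ?_, fun _ => ?_⟩
      · filter_upwards [hGe] with y hy
        rw [hy, norm_mul]
        ring
      · filter_upwards [hGd] with y hy hyu _
        have hk : y k = 0 := by
          rw [← blowDown_apply_self S k y, hyu, blowDown_apply_self, hu]
        rw [hy hk]
        have hd : DifferentiableAt ℂ (fun z => T j z i) (blowDown S k y) := by
          rw [hyu]; exact hTi.differentiableAt (by simp)
        have := (hd.hasFDerivAt.comp y (((hβ.differentiable (by simp)) y).hasFDerivAt)).fderiv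
        rw [hyu] at this
        exact congrArg (fun L : Cn n →L[ℂ] ℂ => L (EuclideanSpace.single (k : Fin n) 1)) this
  choose G hGs hGe hGd using hG
  have hgs : ∀ᶠ y in nhds u,
      ContDiffAt ℝ ∞ (fun y => ∑ j, χ j (blowDown S k y) * ∑ i ∈ S' j, ‖G j i y‖ ^ 2) y := by
    filter_upwards [hβc.eventually (Filter.eventually_all.2 hχ)] with y hy
    refine ContDiffAt.sum fun j _ => ContDiffAt.mul ?_ (ContDiffAt.sum fun i _ => ?_)
    · exact (hy j).comp y ((hβ.restrict_scalars ℝ).of_le (by simp)).contDiffAt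
    · exact (hGs j i).contDiffAt.norm_sq ℝ
  have hT₀i : ∀ i, fderiv ℂ (fun z => T j₀ z i) (blowDown S k u) = EuclideanSpace.proj i := by
    intro i
    have : (fun z => T j₀ z i) =ᶠ[nhds (blowDown S k u)] fun z => z i := by
      filter_upwards [hT₀] with z hz
      rw [hz]
    rw [this.fderiv_eq (𝕜 := ℂ)]
    exact (EuclideanSpace.proj (𝕜 := ℂ) i : Cn n →L[ℂ] ℂ).hasFDerivAt.fderiv
  set a := fderiv ℂ (blowDown S k) u (EuclideanSpace.single (k : Fin n) 1) with ha
  have hak : a k = 1 := by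
    rw [ha, fderiv_blowDown]
    simp
  have hkS : (k : Fin n) ∈ S' j₀ := hS ▸ k.2
  have hGk : G j₀ k u = 1 := by
    rw [(hGd j₀ k hkS).self_of_nhds rfl hj₀.ne', hT₀i, ← ha]
    exact hak
  have hgu : 0 < ∑ j, χ j (blowDown S k u) * ∑ i ∈ S' j, ‖G j i u‖ ^ 2 := by
    refine Finset.sum_pos' (fun j _ => mul_nonneg (hχ0 _ _) (by positivity))
      ⟨j₀, Finset.mem_univ _, mul_pos hj₀ (Finset.sum_pos' (fun _ _ => by positivity)
        ⟨k, hkS, ?_⟩)⟩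
    rw [hGk]
    norm_num
  refine ⟨fun y => ∑ j, χ j (blowDown S k y) * ∑ i ∈ S' j, ‖G j i y‖ ^ 2, hgs, hgu, ?_, ?_⟩
  · have : ∀ᶠ y in nhds u, ∀ j i, i ∈ S' j →
        χ j (blowDown S k y) * ‖T j (blowDown S k y) i‖ ^ 2 =
          ‖y k‖ ^ 2 * (χ j (blowDown S k y) * ‖G j i y‖ ^ 2) :=
      Filter.eventually_all.2 fun j => Filter.eventually_all.2 fun i =>
        Filter.eventually_imp_distrib_left.2 (hGe j i)
    filter_upwards [this] with y hy
    rw [Finset.mul_sum]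
    refine Finset.sum_congr rfl fun j _ => ?_
    rw [Finset.mul_sum, Finset.mul_sum, Finset.mul_sum]
    exact Finset.sum_congr rfl fun i hi => hy j i hi
  · intro w hw hwk hwS
    -- The direction `w` is tangent to the fibre: the blow-down map, and with it every weight `χ j`,
    -- is constant along this complex line.
    have hline : ∀ ζ : ℂ, blowDown S k (u + ζ • w) = blowDown S k u := by
      intro ζ
      ext i
      rw [blowDown_apply, blowDown_apply]
      split_ifs with h
      · simp [hu, hwk]
      · have : w i = 0 := by
          by_cases hi : i ∈ S
          · rw [not_and_not_right] at h
            rw [h hi, hwk]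
          · exact hwS i hi
        simp [this]
    -- This makes each weighted quotient `G` affine in `ζ`, with constant term from `a` and slope
    -- from `w`.
    have hder : ∀ ζ : ℂ, fderiv ℂ (blowDown S k) (u + ζ • w)
        (EuclideanSpace.single (k : Fin n) 1) = a + ζ • w := by
      intro ζ
      ext i
      rw [PiLp.add_apply, ha, fderiv_blowDown, fderiv_blowDown]
      split_ifs with h
      · simp [h.2, hu, hwk]
      · have : w i = 0 := by
          by_cases hi : i ∈ S
          · rw [not_and_not_right] at h
            rw [h hi, hwk]
          · exact hwS i hi
        simp [this]
    obtain ⟨i₀, hi₀⟩ : ∃ i, w i ≠ 0 := by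
      by_contra! h
      exact hw (by ext i; exact h i)
    have hi₀S : i₀ ∈ S' j₀ := by
      rw [hS]
      by_contra h
      exact hi₀ (hwS i₀ h)
    -- Nonproportionality comes from the chart `j₀`, where `T` is the identity: the component `k`
    -- has constant term `1` and slope `w k = 0`, while the component `i₀` has slope `w i₀ ≠ 0`.
    refine laplacian_log_sum_norm_sq_pos (ι := Σ _ : J, Fin n) (s := Finset.univ.sigma S')
      (w := fun q => χ q.1 (blowDown S k u))
      (α := fun q => fderiv ℂ (fun z => T q.1 z q.2) (blowDown S k u) a)
      (β := fun q => fderiv ℂ (fun z => T q.1 z q.2) (blowDown S k u) w)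
      (a := ⟨j₀, k⟩) (b := ⟨j₀, i₀⟩)
      ((hgs.self_of_nhds.log hgu.ne').of_le (by exact_mod_cast natCast_le_infty 2)) ?_
      (fun q _ => hχ0 _ _) (Finset.mem_sigma.2 ⟨Finset.mem_univ _, hkS⟩) hj₀ ?_ ?_
      (Finset.mem_sigma.2 ⟨Finset.mem_univ _, hi₀S⟩) hj₀ ?_
    · have hlc : ContinuousAt (fun ζ : ℂ => u + ζ • w) 0 := by fun_prop
      have : ∀ᶠ ζ in nhds (0 : ℂ), ∀ j i, i ∈ S' j → χ j (blowDown S k u) ≠ 0 →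
          G j i (u + ζ • w) = fderiv ℂ (fun z => T j z i) (blowDown S k u) (a + ζ • w) := by
        refine Filter.eventually_all.2 fun j => Filter.eventually_all.2 fun i =>
          Filter.eventually_imp_distrib_left.2 fun hi => ?_
        have := hlc.eventually (by simpa using hGd j i hi)
        filter_upwards [this] with ζ hζ h0
        rw [hζ (hline ζ) h0, hder]
      filter_upwards [this] with ζ hζ
      congr 1
      rw [Finset.sum_sigma]
      refine Finset.sum_congr rfl fun j _ => ?_
      rw [hline, Finset.mul_sum]
      refine Finset.sum_congr rfl fun i hi => ?_
      by_cases h0 : χ j (blowDown S k u) = 0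
      · simp [h0]
      · rw [hζ j i hi h0, map_add, map_smul, smul_eq_mul]
    · rw [hT₀i]
      exact ne_of_eq_of_ne hak one_ne_zero
    · rw [hT₀i]
      exact hwk
    · rw [hT₀i]
      exact hi₀

end LocalPotential

/-! ### Affine charts of a blow-up and charts adapted to the centre. -/

section AffineCharts

variable {n : ℕ} {X X' : Type*}
  [TopologicalSpace X] [ChartedSpace (Cn n) X]
  [TopologicalSpace X'] [ChartedSpace (Cn n) X']

/-- The standard affine charts cover the standard blow-up. -/
theorem exists_affineChart_eq {S : Finset (Fin n)} {q : Cn n × ℙ ℂ (S → ℂ)}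
    (hq : q ∈ stdBlowUp S) : ∃ k u, affineChart S k u = q := by
  obtain ⟨z, ℓ⟩ := q
  induction ℓ using Projectivization.ind with
  | h w hw =>
    obtain ⟨k, hk⟩ : ∃ k, w k ≠ 0 := by
      by_contra! h
      exact hw (funext h)
    change (fun i : S => z i) ∈ (Projectivization.mk ℂ w hw).submodule at hq
    rw [Projectivization.submodule_mk, Submodule.mem_span_singleton] at hq
    obtain ⟨r, hr⟩ := hq
    have hz : ∀ i : S, z i = r * w i := fun i => (congrFun hr i).symm
    -- The affine coordinates are the ratios `w_i / w_k` for `i ∈ S` other than `k`, and the base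
    -- coordinates otherwise.
    let u : Cn n := WithLp.toLp 2 fun i =>
      if h : i ∈ S ∧ i ≠ k then w ⟨i, h.1⟩ / w k else z i
    have huk : u k = z k := by simp [u]
    refine ⟨k, u, Prod.ext ?_ ?_⟩
    · ext i
      change blowDown S k u i = z i
      rw [blowDown_apply, huk]
      by_cases h : i ∈ S ∧ i ≠ k
      · have hui : u i = w ⟨i, h.1⟩ / w k := by simp [u, h]
        rw [if_pos h, hui, hz k, hz ⟨i, h.1⟩]
        field_simp
      · rw [if_neg h]
        simp [u, h]
    · refine (Projectivization.mk_eq_mk_iff' ℂ _ _ _ _).2 ⟨(w k)⁻¹, ?_⟩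
      funext i
      by_cases h : i = k
      · subst h
        simp [affineDir, hk]
      · have h' : (i : Fin n) ∈ S ∧ (i : Fin n) ≠ k := ⟨i.2, fun h2 => h (Subtype.ext h2)⟩
        have hui : u i = w i / w k := by simp [u, h]
        simp [affineDir, h, hui, div_eq_inv_mul]

/-- The chart `e` is adapted to the blow-up `μ` of `X` along `Y`, which is given in it by the
vanishing of the coordinates with indices in `S`. -/
structure IsAdapted (μ : X' → X) (Y : Set X) (e : OpenPartialHomeomorph X (Cn n))
    (S : Finset (Fin n)) : Prop where
  mem_atlas : e ∈ IsManifold.maximalAtlas 𝓘(ℂ, Cn n) ω X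
  mem_iff : ∀ x ∈ e.source, x ∈ Y ↔ ∀ i ∈ S, e x i = 0
  exists_chart : ∀ p, μ p ∈ e.source → ∃ k : S,
    ∃ c ∈ IsManifold.maximalAtlas 𝓘(ℂ, Cn n) ω X', p ∈ c.source ∧
      ∀ q ∈ c.source, μ q ∈ e.source ∧ e (μ q) = blowDown S k (c q)

theorem IsBlowUp.exists_isAdapted {μ : X' → X} {Y : Set X} (h : IsBlowUp (n := n) μ Y) {y : X}
    (hy : y ∈ Y) : ∃ e S, y ∈ e.source ∧ IsAdapted (n := n) μ Y e S := by
  obtain ⟨e, he, S, -, hye, hYe, Φ, hΦ, hΦ1, hc⟩ := h.local_model y hy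
  refine ⟨e, S, hye, he, hYe, fun p hp => ?_⟩
  obtain ⟨hb, hbt⟩ := hΦ.mapsTo hp
  obtain ⟨k, u, hu⟩ := exists_affineChart_eq hb
  obtain ⟨c, hcA, hcs, hct, hcΦ⟩ := hc k
  have huc : u ∈ c.target := by
    rw [hct, Set.mem_ofPred_eq, hu]
    exact hbt
  -- Injectivity of `Φ` over the chart domain identifies `p` with the point that has these affine
  -- coordinates.
  have hpu : c.symm u = p :=
    hΦ.injOn (hcs (c.map_target huc)) hp ((hcΦ u huc).trans hu)
  refine ⟨k, c, hcA, hpu ▸ c.map_target huc, fun q hq => ⟨hcs hq, ?_⟩⟩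
  have := hΦ1 q (hcs hq)
  rw [← this, ← c.left_inv hq, hcΦ _ (c.map_source hq), c.left_inv hq]
  rfl

end AffineCharts

/-! ### The global function with zero set the centre, and its potentials on the blow-up. -/

section AdaptedPartition

variable {n : ℕ} {X X' : Type*}
  [TopologicalSpace X] [ChartedSpace (Cn n) X]
  [TopologicalSpace X'] [ChartedSpace (Cn n) X']

/-- Partitions of unity live on the underlying real smooth manifold. -/
theorem isManifold_real [IsManifold 𝓘(ℂ, Cn n) ω X] : IsManifold 𝓘(ℝ, Cn n) ∞ X := by
  refine isManifold_of_contDiffOn _ _ _ fun e e' he he' z hz => ?_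
  have hc := IsManifold.subset_maximalAtlas (I := 𝓘(ℂ, Cn n)) (n := ω) he
  have hc' := IsManifold.subset_maximalAtlas (I := 𝓘(ℂ, Cn n)) (n := ω) he'
  simp only [mfld_simps] at hz
  have := contDiffAt_chart (μ := id) hc hc' hz.1 contMDiffAt_id hz.2
  exact ((this.restrict_scalars ℝ).of_le (by simp)).contDiffWithinAt

theorem smoothFormAt_zeroForm_of_contMDiff [IsManifold 𝓘(ℂ, Cn n) ω X] {f : X → ℝ}
    (hf : ContMDiff 𝓘(ℝ, Cn n) 𝓘(ℝ, ℝ) ∞ f) (x : X) : SmoothFormAt (n := n) (zeroForm f) x := by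
  have h := (contMDiffAt_iff.1 (hf x)).2
  simp only [mfld_simps, contDiffWithinAt_univ] at h
  exact smoothFormAt_zeroForm_of_chart
    (IsManifold.chart_mem_maximalAtlas (I := 𝓘(ℂ, Cn n)) (n := ω) x)
    (mem_chart_source (Cn n) x) h

/-- A smooth partition of unity by functions `χ j` with supports in adapted charts and a function
`χ₀` with support off the centre. -/
structure IsAdaptedPartition (μ : X' → X) (Y : Set X) {J : Type*} [Fintype J]
    (e : J → OpenPartialHomeomorph X (Cn n)) (S : J → Finset (Fin n)) (χ₀ : X → ℝ)
    (χ : J → X → ℝ) : Prop where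
  adapted : ∀ j, IsAdapted μ Y (e j) (S j)
  nonneg₀ : ∀ x, 0 ≤ χ₀ x
  nonneg : ∀ j x, 0 ≤ χ j x
  smooth₀ : ∀ x, SmoothFormAt (n := n) (zeroForm χ₀) x
  smooth : ∀ j x, SmoothFormAt (n := n) (zeroForm (χ j)) x
  tsupport₀ : tsupport χ₀ ⊆ Yᶜ
  tsupport : ∀ j, tsupport (χ j) ⊆ (e j).source
  sum_eq_one : ∀ x, χ₀ x + ∑ j, χ j x = 1

theorem IsBlowUp.exists_isAdaptedPartition [T2Space X] [CompactSpace X]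
    [IsManifold 𝓘(ℂ, Cn n) ω X] {μ : X' → X} {Y : Set X} (h : IsBlowUp (n := n) μ Y) :
    ∃ (t : Finset Y) (e : t → OpenPartialHomeomorph X (Cn n)) (S : t → Finset (Fin n))
      (χ₀ : X → ℝ) (χ : t → X → ℝ), IsAdaptedPartition μ Y e S χ₀ χ := by
  have : IsManifold 𝓘(ℝ, Cn n) ∞ X := isManifold_real
  choose e S he hA using fun y : Y => h.exists_isAdapted y.2
  obtain ⟨t, ht⟩ := h.isClosed_center.isCompact.elim_finite_subcover (fun y => (e y).source)
    (fun y => (e y).open_source) fun y hy => Set.mem_iUnion.2 ⟨⟨y, hy⟩, he ⟨y, hy⟩⟩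
  -- The index `none` stands for the complement of the centre; the remaining members are finitely
  -- many adapted charts covering the compact centre.
  let U : Option t → Set X := fun o => o.elim Yᶜ fun j => (e j).source
  obtain ⟨f, hf⟩ := SmoothPartitionOfUnity.exists_isSubordinate 𝓘(ℝ, Cn n) isClosed_univ U
    (by
      rintro (_ | j)
      · exact h.isClosed_center.isOpen_compl
      · exact (e j).open_source)
    (fun x _ => by
      by_cases hx : x ∈ Y
      · obtain ⟨y, hy, hxy⟩ := Set.mem_iUnion₂.1 (ht hx)
        exact Set.mem_iUnion.2 ⟨some ⟨y, hy⟩, hxy⟩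
      · exact Set.mem_iUnion.2 ⟨none, hx⟩)
  refine ⟨t, fun j => e j, fun j => S j, f none, fun j => f (some j), fun j => hA j, f.nonneg none,
    fun j => f.nonneg (some j), smoothFormAt_zeroForm_of_contMDiff (f none).contMDiff,
    fun j => smoothFormAt_zeroForm_of_contMDiff (f (some j)).contMDiff, hf none,
    fun j => hf (some j), fun x => ?_⟩
  have := f.sum_eq_one (Set.mem_univ x)
  rwa [finsum_eq_sum_of_fintype, Fintype.sum_option] at this

variable {J : Type*} [Fintype J] {μ : X' → X} {Y : Set X}
  {e : J → OpenPartialHomeomorph X (Cn n)} {S : J → Finset (Fin n)} {χ₀ : X → ℝ} {χ : J → X → ℝ}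

/-- The sum of the squared norms of the equations of the centre in the charts of an adapted
partition, glued by the partition. -/
noncomputable def centreFunction (e : J → OpenPartialHomeomorph X (Cn n)) (S : J → Finset (Fin n))
    (χ₀ : X → ℝ) (χ : J → X → ℝ) (x : X) : ℝ :=
  χ₀ x + ∑ j, χ j x * ∑ i ∈ S j, ‖e j x i‖ ^ 2

namespace IsAdaptedPartition

theorem mem_source (h : IsAdaptedPartition μ Y e S χ₀ χ) {j : J} {x : X} (hx : χ j x ≠ 0) :
    x ∈ (e j).source :=
  h.tsupport j (subset_tsupport _ hx)

theorem eq_zero_of_mem (h : IsAdaptedPartition μ Y e S χ₀ χ) {x : X} (hx : x ∈ Y) : χ₀ x = 0 := by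
  by_contra h0
  exact h.tsupport₀ (subset_tsupport _ h0) hx

theorem exists_pos_of_mem (h : IsAdaptedPartition μ Y e S χ₀ χ) {x : X} (hx : x ∈ Y) :
    ∃ j, 0 < χ j x := by
  by_contra! h0
  have h1 := h.sum_eq_one x
  rw [h.eq_zero_of_mem hx, zero_add] at h1
  have := Finset.sum_nonpos fun j (_ : j ∈ Finset.univ) => h0 j
  linarith

theorem centreFunction_nonneg (h : IsAdaptedPartition μ Y e S χ₀ χ) (x : X) :
    0 ≤ centreFunction e S χ₀ χ x :=
  add_nonneg (h.nonneg₀ x) (Finset.sum_nonneg fun j _ => mul_nonneg (h.nonneg j x) (by positivity))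

/-- All summands are nonnegative, and the weights sum to `1`. Where a chart has nonzero weight, its
sum of squares vanishes exactly on `Y`, while `χ₀` vanishes on `Y`. -/
theorem centreFunction_ne_zero (h : IsAdaptedPartition μ Y e S χ₀ χ) {x : X} :
    centreFunction e S χ₀ χ x ≠ 0 ↔ x ∉ Y := by
  refine ⟨fun h0 hx => h0 ?_, fun hx h0 => ?_⟩
  · rw [centreFunction, h.eq_zero_of_mem hx, zero_add]
    refine Finset.sum_eq_zero fun j _ => ?_
    by_cases hj : χ j x = 0
    · rw [hj, zero_mul]
    · rw [Finset.sum_eq_zero fun i hi => ?_, mul_zero]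
      rw [((h.adapted j).mem_iff x (h.mem_source hj)).1 hx i hi]
      simp
  · have hs : ∀ j ∈ Finset.univ, 0 ≤ χ j x * ∑ i ∈ S j, ‖e j x i‖ ^ 2 := fun j _ =>
      mul_nonneg (h.nonneg j x) (by positivity)
    obtain ⟨h1, h2⟩ := (add_eq_zero_iff_of_nonneg (h.nonneg₀ x) (Finset.sum_nonneg hs)).1 h0
    have h3 : ∀ j, χ j x = 0 := by
      intro j
      by_contra hj
      refine hx (((h.adapted j).mem_iff x (h.mem_source hj)).2 fun i hi => ?_)
      have h4 := (Finset.sum_eq_zero_iff_of_nonneg hs).1 h2 j (Finset.mem_univ j)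
      have h5 := (Finset.sum_eq_zero_iff_of_nonneg fun i _ => by positivity).1
        ((mul_eq_zero.1 h4).resolve_left hj) i hi
      simpa using h5
    have := h.sum_eq_one x
    simp [h1, h3] at this

theorem smoothFormAt_centreFunction [IsManifold 𝓘(ℂ, Cn n) ω X]
    (h : IsAdaptedPartition μ Y e S χ₀ χ) (x : X) :
    SmoothFormAt (n := n) (zeroForm (centreFunction e S χ₀ χ)) x := by
  have hc := IsManifold.chart_mem_maximalAtlas (I := 𝓘(ℂ, Cn n)) (n := ω) x
  have hx := mem_chart_source (Cn n) x
  refine smoothFormAt_zeroForm_of_chart hc hx (((h.smooth₀ x).contDiffAt hc hx).add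
    (ContDiffAt.sum fun j _ => ?_))
  -- Outside its domain `e j` carries no information, but near a point off the support the weight
  -- makes the summand zero.
  by_cases hj : x ∈ _root_.tsupport (χ j)
  · refine ((h.smooth j x).contDiffAt hc hx).mul (ContDiffAt.sum fun i _ => ?_)
    have := contDiffAt_chart (μ := id) hc (h.adapted j).mem_atlas ((chartAt (Cn n) x).map_source hx)
      contMDiffAt_id (by rw [(chartAt (Cn n) x).left_inv hx]; exact h.tsupport j hj)
    exact (((contDiffAt_euclidean.1 this i).restrict_scalars ℝ).of_le (by simp)).norm_sq ℝ
  · have h0 : ∀ᶠ z in nhds (chartAt (Cn n) x x), χ j ((chartAt (Cn n) x).symm z) = 0 := by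
      refine ((chartAt (Cn n) x).continuousAt_symm
        ((chartAt (Cn n) x).map_source hx)).eventually (p := fun y => χ j y = 0) ?_
      rw [(chartAt (Cn n) x).left_inv hx]
      filter_upwards [(isClosed_tsupport _).isOpen_compl.mem_nhds hj] with y hy
      exact image_eq_zero_of_notMem_tsupport hy
    refine (contDiffAt_const (c := (0 : ℝ))).congr_of_eventuallyEq ?_
    filter_upwards [h0] with z hz
    rw [hz, zero_mul]

end IsAdaptedPartition

theorem SmoothFormAt.log [IsManifold 𝓘(ℂ, Cn n) ω X] {f : X → ℝ} {x : X}
    (h : SmoothFormAt (n := n) (zeroForm f) x) (hx : f x ≠ 0) :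
    SmoothFormAt (n := n) (zeroForm fun y => Real.log (f y)) x := by
  have hc := IsManifold.chart_mem_maximalAtlas (I := 𝓘(ℂ, Cn n)) (n := ω) x
  have hxc := mem_chart_source (Cn n) x
  refine smoothFormAt_zeroForm_of_chart hc hxc ((h.contDiffAt hc hxc).log ?_)
  rwa [(chartAt (Cn n) x).left_inv hxc]

/-- The values of `i ∂∂̄ f` on tangent vectors. -/
theorem leviForm_apply_tangent [IsManifold 𝓘(ℂ, Cn n) ω X] {f : X → ℝ} {x : X}
    (hf : ∀ᶠ y in nhds x, SmoothFormAt (n := n) (zeroForm f) y)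
    {c : OpenPartialHomeomorph X (Cn n)} (hc : c ∈ IsManifold.maximalAtlas 𝓘(ℂ, Cn n) ω X)
    (hx : x ∈ c.source) {d : Cn n →L[ℂ] Cn n}
    (hd : d = mfderiv 𝓘(ℂ, Cn n) 𝓘(ℂ, Cn n) c x) (v w : Cn n) :
    (leviForm f x : Cn n [⋀^Fin 2]→L[ℝ] ℂ) ![v, w] =
      ((1 / 2 * (fderiv ℝ (fderiv ℝ fun z => f (c.symm z)) (c x) (Complex.I • d v) (d w) -
        fderiv ℝ (fderiv ℝ fun z => f (c.symm z)) (c x) (d v) (Complex.I • d w)) : ℝ) : ℂ) := by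
  subst hd
  exact (form_eq_chartRep (leviForm f) hc hx ![v, w]).trans (leviForm_apply hf hc hx _)

theorem contMDiff_coordinate {c : OpenPartialHomeomorph X (Cn n)}
    (hc : c ∈ IsManifold.maximalAtlas 𝓘(ℂ, Cn n) ω X) {x : X} (hx : x ∈ c.source) (i : Fin n) :
    ContMDiffAt 𝓘(ℂ, Cn n) 𝓘(ℂ, ℂ) ω (fun y => c y i) x := by
  have h1 : ContMDiffAt 𝓘(ℂ, Cn n) 𝓘(ℂ, ℂ) ω (fun z : Cn n => z i) (c x) :=
    (show ContDiff ℂ ω fun z : Cn n => z i by fun_prop).contMDiff.contMDiffAt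
  exact h1.comp x (contMDiffAt_of_mem_maximalAtlas hc hx)

namespace IsAdaptedPartition

/-- Off the centre `Ψ` is smooth and positive, so `h = 1` works. -/
theorem isPotentialAt_log [IsManifold 𝓘(ℂ, Cn n) ω X] [IsManifold 𝓘(ℂ, Cn n) ω X']
    (h : IsAdaptedPartition μ Y e S χ₀ χ) (hY : IsClosed Y)
    (hμ : ContMDiff 𝓘(ℂ, Cn n) 𝓘(ℂ, Cn n) ω μ) {p : X'} (hp : μ p ∉ Y) :
    IsPotentialAt n (fun q => centreFunction e S χ₀ χ (μ q))
      (fun q => Real.log (centreFunction e S χ₀ χ (μ q))) p := by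
  refine ⟨fun _ => 1, ?_⟩
  filter_upwards [hμ.continuous.continuousAt.eventually (hY.isOpen_compl.mem_nhds hp)] with q hq
  have h0 := h.centreFunction_ne_zero.2 hq
  have hs : SmoothFormAt (n := n) (zeroForm fun q => centreFunction e S χ₀ χ (μ q)) q :=
    (h.smoothFormAt_centreFunction (μ q)).pullForm hμ
  refine ⟨hs.log h0, contMDiffAt_const, ?_⟩
  rw [Real.exp_log (lt_of_le_of_ne (h.centreFunction_nonneg _) h0.symm)]
  simp

/-- The potential is `log g`, with `g` the cofactor of `|u_k|²` in an affine chart `c`; the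
holomorphic factor is the coordinate `u_k`, the equation of the exceptional divisor. -/
theorem exists_potential_of_mem [IsManifold 𝓘(ℂ, Cn n) ω X] [IsManifold 𝓘(ℂ, Cn n) ω X']
    (h : IsAdaptedPartition μ Y e S χ₀ χ) (hμ : ContMDiff 𝓘(ℂ, Cn n) 𝓘(ℂ, Cn n) ω μ) {p : X'}
    (hp : μ p ∈ Y) :
    ∃ f, IsPotentialAt n (fun q => centreFunction e S χ₀ χ (μ q)) f p ∧
      ∀ v : Cn n, v ≠ 0 → (mfderiv 𝓘(ℂ, Cn n) 𝓘(ℂ, Cn n) μ p : Cn n →L[ℂ] Cn n) v = 0 →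
        0 < ((leviForm f p : Cn n [⋀^Fin 2]→L[ℝ] ℂ) ![v, Complex.I • v]).re := by
  obtain ⟨j₀, hj₀⟩ := h.exists_pos_of_mem hp
  have hps := h.mem_source hj₀.ne'
  have hA := (h.adapted j₀).mem_atlas
  obtain ⟨k, c, hc, hpc, hcμ⟩ := (h.adapted j₀).exists_chart p hps
  have hβ : blowDown (S j₀) k (c p) = e j₀ (μ p) := (hcμ p hpc).2.symm
  have hu : c p k = 0 := by
    rw [← blowDown_apply_self (S j₀) k, hβ]
    exact ((h.adapted j₀).mem_iff _ hps).1 hp k k.2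
  have hmt : e j₀ (μ p) ∈ (e j₀).target := (e j₀).map_source hps
  have hsymm : ContinuousAt (e j₀).symm (e j₀ (μ p)) := (e j₀).continuousAt_symm hmt
  have hinv : (e j₀).symm (e j₀ (μ p)) = μ p := (e j₀).left_inv hps
  obtain ⟨g, hgs, hg0, hge, hgpos⟩ := exists_local_potential (S := S j₀) (k := k) (u := c p)
    (S' := S) (T := fun j z => e j ((e j₀).symm z)) (χ := fun j z => χ j ((e j₀).symm z)) hu
    (fun j z => h.nonneg j _)
    (fun j => by
      rw [hβ]
      filter_upwards [(e j₀).open_target.mem_nhds hmt] with z hz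
      have := (h.smooth j ((e j₀).symm z)).contDiffAt hA ((e j₀).map_target hz)
      rwa [(e j₀).right_inv hz] at this)
    (fun j => by
      rw [hβ]
      by_cases hj : μ p ∈ _root_.tsupport (χ j)
      · refine Or.inr ⟨contDiffAt_chart (μ := id) hA (h.adapted j).mem_atlas hmt contMDiffAt_id
          (by rw [hinv]; exact h.tsupport j hj), ?_⟩
        have h1 : ∀ᶠ z in nhds (e j₀ (μ p)), (e j₀).symm z ∈ (e j).source := by
          refine hsymm.eventually ?_
          rw [hinv]
          exact (e j).open_source.mem_nhds (h.tsupport j hj)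
        filter_upwards [h1, (e j₀).open_target.mem_nhds hmt] with z hz hzt hz0
        refine ((h.adapted j).mem_iff _ hz).1 (((h.adapted j₀).mem_iff _
          ((e j₀).map_target hzt)).2 fun i hi => ?_)
        rw [(e j₀).right_inv hzt]
        exact hz0 i hi
      · refine Or.inl (hsymm.eventually (p := fun y => χ j y = 0) ?_)
        rw [hinv]
        filter_upwards [(isClosed_tsupport _).isOpen_compl.mem_nhds hj] with y hy
        exact image_eq_zero_of_notMem_tsupport hy)
    (j₀ := j₀) (by rw [hβ, hinv]; exact hj₀) rfl
    (by
      rw [hβ]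
      filter_upwards [(e j₀).open_target.mem_nhds hmt] with z hz
      exact (e j₀).right_inv hz)
  have hcc : ContinuousAt c p := c.continuousAt hpc
  -- Near the centre `χ₀` vanishes, so only the sums of squares to which `exists_local_potential`
  -- applies remain.
  have hχ₀ : ∀ᶠ q in nhds p, χ₀ (μ q) = 0 := by
    have hn : μ p ∉ _root_.tsupport χ₀ := fun hn => h.tsupport₀ hn hp
    filter_upwards [hμ.continuous.continuousAt.eventually
      ((isClosed_tsupport _).isOpen_compl.mem_nhds hn)] with q hq
    exact image_eq_zero_of_notMem_tsupport hq
  have hgpos' : ∀ᶠ y in nhds (c p), 0 < g y :=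
    hgs.self_of_nhds.continuousAt.eventually_const_lt hg0
  have hfc : ∀ q ∈ c.source, (fun z => Real.log (g (c (c.symm z)))) =ᶠ[nhds (c q)]
      fun z => Real.log (g z) := by
    intro q hq
    filter_upwards [c.open_target.mem_nhds (c.map_source hq)] with z hz
    rw [c.right_inv hz]
  have hpot : IsPotentialAt n (fun q => centreFunction e S χ₀ χ (μ q))
      (fun q => Real.log (g (c q))) p := by
    refine ⟨fun q => c q k, ?_⟩
    filter_upwards [c.open_source.mem_nhds hpc, hcc.eventually hgs, hcc.eventually hge,
      hcc.eventually hgpos', hχ₀] with q hqc hqs hqe hqpos hq0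
    refine ⟨smoothFormAt_zeroForm_of_chart hc hqc
      ((hqs.log hqpos.ne').congr_of_eventuallyEq (hfc q hqc)), contMDiff_coordinate hc hqc k, ?_⟩
    obtain ⟨h1, h2⟩ := hcμ q hqc
    rw [Real.exp_log hqpos, ← hqe, ← h2, (e j₀).left_inv h1, centreFunction, hq0, zero_add]
  refine ⟨fun q => Real.log (g (c q)), hpot, fun v hv hμv => ?_⟩
  let d : Cn n →L[ℂ] Cn n := mfderiv 𝓘(ℂ, Cn n) 𝓘(ℂ, Cn n) c p
  have hdv : d v ≠ 0 := by
    intro h0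
    have h1 := mfderiv_symm_comp_chart hc hpc v
    let d' : Cn n →L[ℂ] Cn n := mfderiv 𝓘(ℂ, Cn n) 𝓘(ℂ, Cn n) c.symm (c p)
    refine hv (h1.symm.trans ?_)
    change d' (d v) = 0
    rw [h0, map_zero]
  have hfβ : fderiv ℂ (blowDown (S j₀) k) (c p) (d v) = 0 := by
    have h1 : MDifferentiableAt 𝓘(ℂ, Cn n) 𝓘(ℂ, Cn n) (e j₀) (μ p) :=
      (contMDiffAt_of_mem_maximalAtlas hA hps).mdifferentiableAt (by simp)
    have h2 : MDifferentiableAt 𝓘(ℂ, Cn n) 𝓘(ℂ, Cn n) μ p :=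
      (hμ p).mdifferentiableAt (by simp)
    have h3 : MDifferentiableAt 𝓘(ℂ, Cn n) 𝓘(ℂ, Cn n) c p :=
      (contMDiffAt_of_mem_maximalAtlas hc hpc).mdifferentiableAt (by simp)
    have h4 : MDifferentiableAt 𝓘(ℂ, Cn n) 𝓘(ℂ, Cn n) (blowDown (S j₀) k) (c p) :=
      ((contDiff_blowDown (S j₀) k).differentiable (by simp) (c p)).mdifferentiableAt
    have h5 : e j₀ ∘ μ =ᶠ[nhds p] blowDown (S j₀) k ∘ c := by
      filter_upwards [c.open_source.mem_nhds hpc] with q hq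
      exact (hcμ q hq).2
    have h6 := h5.mfderiv_eq (I := 𝓘(ℂ, Cn n)) (I' := 𝓘(ℂ, Cn n))
    rw [mfderiv_comp p h1 h2, mfderiv_comp p h4 h3, mfderiv_eq_fderiv] at h6
    have h7 := congrArg (fun T : Cn n →L[ℂ] Cn n => T v) h6
    let d' : Cn n →L[ℂ] Cn n := mfderiv 𝓘(ℂ, Cn n) 𝓘(ℂ, Cn n) (e j₀) (μ p)
    exact h7.symm.trans ((congrArg d' hμv).trans (map_zero d'))
  -- In coordinates a kernel vector has zero `k`-th component and zero components outside `S`, the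
  -- directions in which `log g` was shown to be strictly subharmonic.
  have hco : ∀ i, (if i ∈ S j₀ ∧ i ≠ k then c p k * d v i + d v k * c p i else d v i) = 0 := by
    intro i
    rw [← fderiv_blowDown, hfβ]
    rfl
  have hpos := hgpos (d v) hdv (by simpa using hco k) fun i hi => by simpa [hi] using hco i
  have hdI : d (Complex.I • v) = Complex.I • d v := d.map_smul _ _
  -- On `(v, iv)` the form `i∂∂̄f` is half the sum of the second derivatives of `f` along `dv` and
  -- `i dv`.
  rw [leviForm_apply_tangent hpot.smooth hc hpc (d := d) rfl, Complex.ofReal_re, hdI, smul_smul,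
    Complex.I_mul_I, neg_one_smul, map_neg]
  have hHe : (fun z => fderiv ℝ (fun z => Real.log (g (c (c.symm z)))) z) =ᶠ[nhds (c p)]
      fun z => fderiv ℝ (fun z => Real.log (g z)) z := by
    filter_upwards [(hfc p hpc).eventuallyEq_nhds] with z hz
    exact hz.fderiv_eq
  rw [hHe.fderiv_eq]
  linarith

end IsAdaptedPartition

end AdaptedPartition

/-! ### The metric on a single blow-up. -/

section OneBlowUp

variable {n : ℕ} {X X' : Type*}
  [TopologicalSpace X] [ChartedSpace (Cn n) X]
  [TopologicalSpace X'] [ChartedSpace (Cn n) X']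
  {J : Type*} [Fintype J] {μ : X' → X} {Y : Set X}
  {e : J → OpenPartialHomeomorph X (Cn n)} {S : J → Finset (Fin n)} {χ₀ : X → ℝ} {χ : J → X → ℝ}

/-- A point over `Y` is approached along the `k`-th affine coordinate: once that coordinate is
nonzero, so is the `k`-th coordinate of the image, which therefore leaves `Y`. -/
theorem IsAdaptedPartition.dense_compl (h : IsAdaptedPartition μ Y e S χ₀ χ) :
    Dense {p : X' | centreFunction e S χ₀ χ (μ p) ≠ 0} := by
  intro p
  by_cases hp : μ p ∈ Y
  swap
  · exact subset_closure (h.centreFunction_ne_zero.2 hp)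
  obtain ⟨j, hj⟩ := h.exists_pos_of_mem hp
  have hps := h.mem_source hj.ne'
  obtain ⟨k, c, hc, hpc, hcμ⟩ := (h.adapted j).exists_chart p hps
  have hu : c p k = 0 := by
    rw [← blowDown_apply_self (S j) k, ← (hcμ p hpc).2]
    exact ((h.adapted j).mem_iff _ hps).1 hp k k.2
  let a : ℕ → Cn n := fun m =>
    c p + ((1 / ((m : ℝ) + 1) : ℝ) : ℂ) • EuclideanSpace.single (k : Fin n) 1
  have ha : Filter.Tendsto a Filter.atTop (nhds (c p)) := by
    have h1 : Filter.Tendsto (fun m : ℕ => ((1 / ((m : ℝ) + 1) : ℝ) : ℂ)) Filter.atTop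
        (nhds ((0 : ℝ) : ℂ)) :=
      (Complex.continuous_ofReal.tendsto 0).comp tendsto_one_div_add_atTop_nhds_zero_nat
    have h2 := (h1.smul_const (EuclideanSpace.single (k : Fin n) (1 : ℂ))).const_add (c p)
    rwa [Complex.ofReal_zero, zero_smul, add_zero] at h2
  have hsymm := (c.continuousAt_symm (c.map_source hpc)).tendsto.comp ha
  rw [c.left_inv hpc] at hsymm
  refine mem_closure_of_tendsto hsymm ?_
  filter_upwards [ha.eventually (c.open_target.mem_nhds (c.map_source hpc))] with m hm
  refine h.centreFunction_ne_zero.2 fun hY => ?_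
  obtain ⟨h1, h2⟩ := hcμ _ (c.map_target hm)
  have h3 := ((h.adapted j).mem_iff _ h1).1 hY k k.2
  rw [h2, blowDown_apply_self, c.right_inv hm] at h3
  simp only [a, PiLp.add_apply, PiLp.smul_apply, hu, zero_add, PiLp.single_apply,
    if_true, smul_eq_mul, mul_one] at h3
  have h4 : (1 / ((m : ℝ) + 1) : ℝ) ≠ 0 := by positivity
  exact h4 (by exact_mod_cast h3)

/-- A closed real form of type `(1, 1)` on the blow-up that is positive on the vectors tangent to
the fibres. -/
theorem IsBlowUp.exists_relative_form [T2Space X] [CompactSpace X] [IsManifold 𝓘(ℂ, Cn n) ω X]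
    [IsManifold 𝓘(ℂ, Cn n) ω X'] (h : IsBlowUp (n := n) μ Y) :
    ∃ θ : DForm n X' 2, (∀ x, ∃ f : X' → ℝ,
      (∀ᶠ y in nhds x, SmoothFormAt (n := n) (zeroForm f) y) ∧
        ∀ᶠ y in nhds x, θ y = leviForm f y) ∧
      ∀ x (v : Cn n), v ≠ 0 → (mfderiv 𝓘(ℂ, Cn n) 𝓘(ℂ, Cn n) μ x : Cn n →L[ℂ] Cn n) v = 0 →
        0 < ((θ x : Cn n [⋀^Fin 2]→L[ℝ] ℂ) ![v, Complex.I • v]).re := by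
  obtain ⟨t, e, S, χ₀, χ, hP⟩ := h.exists_isAdaptedPartition
  have hpot : ∀ x, ∃ f, IsPotentialAt n (fun q => centreFunction e S χ₀ χ (μ q)) f x := by
    intro x
    by_cases hx : μ x ∈ Y
    · obtain ⟨f, hf, -⟩ := hP.exists_potential_of_mem h.holomorphic hx
      exact ⟨f, hf⟩
    · exact ⟨_, hP.isPotentialAt_log h.isClosed_center h.holomorphic hx⟩
  obtain ⟨θ, hθ⟩ := exists_form_of_isPotentialAt hP.dense_compl hpot
  refine ⟨θ, fun x => ?_, fun x v hv hμv => ?_⟩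
  · obtain ⟨f, hf⟩ := hpot x
    exact ⟨f, hf.smooth, hθ x f hf⟩
  · by_cases hx : μ x ∈ Y
    · obtain ⟨f, hf, hpos⟩ := hP.exists_potential_of_mem h.holomorphic hx
      rw [(hθ x f hf).self_of_nhds]
      exact hpos v hv hμv
    · have hl := h.isLocalDiffeomorphOn_compl ⟨x, hx⟩
      have hinj := (hl.mfderivToContinuousLinearEquiv (by simp)).injective
      exact absurd (hinj (hμv.trans
        (map_zero (hl.mfderivToContinuousLinearEquiv (by simp))).symm)) hv

theorem continuousAt_form_apply {α : Cn n → Cn n [⋀^Fin 2]→L[ℝ] ℂ} {z : Cn n}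
    (hα : ContinuousAt α z) (w : Cn n) :
    ContinuousAt (fun q : Cn n × Cn n => (α q.1 ![q.2, Complex.I • q.2]).re) (z, w) := by
  have h1 : ContinuousAt (fun q : Cn n × Cn n => α q.1) (z, w) :=
    ContinuousAt.comp (f := fun q : Cn n × Cn n => q.1) hα continuousAt_fst
  have h2 : Continuous fun q : Cn n × Cn n => (![q.2, Complex.I • q.2] : Fin 2 → Cn n) := by
    refine continuous_pi fun i => ?_
    fin_cases i
    · exact continuous_snd
    · exact continuous_snd.const_smul Complex.I
  exact Complex.continuous_re.continuousAt.comp (h1.eval h2.continuousAt)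

theorem form_apply_smul (α : Cn n [⋀^Fin 2]→L[ℝ] ℂ) (r : ℝ) (w : Cn n) :
    (α ![r • w, Complex.I • r • w]).re = r ^ 2 * (α ![w, Complex.I • w]).re := by
  have e1 : (![r • w, Complex.I • r • w] : Fin 2 → Cn n) =
      fun i => r • (![w, Complex.I • w] : Fin 2 → Cn n) i := by
    funext i
    fin_cases i
    · rfl
    · exact smul_comm _ _ _
  have e2 := α.toMultilinearMap.map_smul_univ (fun _ => r) ![w, Complex.I • w]
  have e3 : α (fun i => r • (![w, Complex.I • w] : Fin 2 → Cn n) i) =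
      (∏ _i : Fin 2, r) • α ![w, Complex.I • w] := e2
  rw [e1, e3, Finset.prod_const, Finset.card_univ, Fintype.card_fin, Complex.smul_re, smul_eq_mul]

theorem pullForm_apply (μ : X' → X) (η : DForm n X 2) (x : X') (v w : Cn n)
    {d : Cn n →L[ℂ] Cn n} (hd : d = mfderiv 𝓘(ℂ, Cn n) 𝓘(ℂ, Cn n) μ x) :
    (pullForm μ η x : Cn n [⋀^Fin 2]→L[ℝ] ℂ) ![v, w] =
      (η (μ x) : Cn n [⋀^Fin 2]→L[ℝ] ℂ) ![d v, d w] := by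
  subst hd
  refine congrArg (η (μ x) : Cn n [⋀^Fin 2]→L[ℝ] ℂ) (funext fun i => ?_)
  fin_cases i <;> rfl

theorem form_apply_chartRep (η : DForm n X 2) {c : OpenPartialHomeomorph X (Cn n)}
    (hc : c ∈ IsManifold.maximalAtlas 𝓘(ℂ, Cn n) ω X) {x : X} (hx : x ∈ c.source) (v w : Cn n)
    {d : Cn n →L[ℂ] Cn n} (hd : d = mfderiv 𝓘(ℂ, Cn n) 𝓘(ℂ, Cn n) c x) :
    (η x : Cn n [⋀^Fin 2]→L[ℝ] ℂ) ![v, w] = chartRep c η (c x) ![d v, d w] := by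
  subst hd
  refine (form_eq_chartRep η hc hx ![v, w]).trans (congrArg (chartRep c η (c x))
    (funext fun i => ?_))
  fin_cases i <;> rfl

theorem IsHermitianMetric.nonneg {η : DForm n X 2} (hη : IsHermitianMetric η) (x : X) (v : Cn n) :
    0 ≤ ((η x : Cn n [⋀^Fin 2]→L[ℝ] ℂ) ![v, Complex.I • v]).re := by
  by_cases hv : v = 0
  · have : (η x : Cn n [⋀^Fin 2]→L[ℝ] ℂ) ![v, Complex.I • v] = 0 :=
      (η x : Cn n [⋀^Fin 2]→L[ℝ] ℂ).map_coord_zero 0 hv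
    rw [this, Complex.zero_re]
  · exact (hη.pos x v hv).le

/-- A semipositive form becomes positive after the addition of a small multiple of a form that is
positive on its kernel. -/
theorem exists_pos_add_smul [CompactSpace X'] [IsManifold 𝓘(ℂ, Cn n) ω X'] {α θ : DForm n X' 2}
    (hα : ∀ x, SmoothFormAt α x) (hθ : ∀ x, SmoothFormAt θ x)
    (hα0 : ∀ x (v : Cn n), 0 ≤ ((α x : Cn n [⋀^Fin 2]→L[ℝ] ℂ) ![v, Complex.I • v]).re)
    (hαθ : ∀ x (v : Cn n), v ≠ 0 → ((α x : Cn n [⋀^Fin 2]→L[ℝ] ℂ) ![v, Complex.I • v]).re = 0 →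
      0 < ((θ x : Cn n [⋀^Fin 2]→L[ℝ] ℂ) ![v, Complex.I • v]).re) :
    ∃ ε : ℝ, 0 < ε ∧ ∀ x (v : Cn n), v ≠ 0 →
      0 < ((α x : Cn n [⋀^Fin 2]→L[ℝ] ℂ) ![v, Complex.I • v]).re +
        ε * ((θ x : Cn n [⋀^Fin 2]→L[ℝ] ℂ) ![v, Complex.I • v]).re := by
  have key : ∀ᶠ ε in nhds (0 : ℝ), ∀ x ∈ (Set.univ : Set X'), 0 < ε → ∀ v : Cn n, v ≠ 0 →
      0 < ((α x : Cn n [⋀^Fin 2]→L[ℝ] ℂ) ![v, Complex.I • v]).re +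
        ε * ((θ x : Cn n [⋀^Fin 2]→L[ℝ] ℂ) ![v, Complex.I • v]).re := by
    refine isCompact_univ.eventually_forall_of_forall_eventually fun x _ => ?_
    have hc := IsManifold.chart_mem_maximalAtlas (I := 𝓘(ℂ, Cn n)) (n := ω) x
    have hx := mem_chart_source (Cn n) x
    set c := chartAt (Cn n) x
    -- The identity is stated for every `z`, even off the target, because `eventually_add_mul_pos`
    -- demands semipositivity at every parameter.
    have hsymm : ∀ z w : Cn n, ∃ v : Cn n, (w ≠ 0 → z ∈ c.target → v ≠ 0) ∧
        ∀ η : DForm n X' 2, chartRep c η z ![w, Complex.I • w] =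
          (η (c.symm z) : Cn n [⋀^Fin 2]→L[ℝ] ℂ) ![v, Complex.I • v] := by
      intro z w
      let d' : Cn n →L[ℂ] Cn n := mfderiv 𝓘(ℂ, Cn n) 𝓘(ℂ, Cn n) c.symm z
      have hdI : d' (Complex.I • w) = Complex.I • d' w := d'.map_smul _ _
      refine ⟨d' w, fun hw hz h0 => hw ?_, fun η => ?_⟩
      · let d : Cn n →L[ℂ] Cn n := mfderiv 𝓘(ℂ, Cn n) 𝓘(ℂ, Cn n) c (c.symm z)
        have h1 := mfderiv_chart_comp_symm hc hc hz (c.map_target hz) w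
        have h2 : (fun y => c (c.symm y)) =ᶠ[nhds z] id := by
          filter_upwards [c.open_target.mem_nhds hz] with y hy
          exact c.right_inv hy
        rw [h2.fderiv_eq (𝕜 := ℝ), fderiv_id] at h1
        refine h1.symm.trans ?_
        change d (d' w) = 0
        rw [h0, map_zero]
      · rw [← hdI]
        refine congrArg (η (c.symm z) : Cn n [⋀^Fin 2]→L[ℝ] ℂ) (funext fun i => ?_)
        fin_cases i <;> rfl
    have h1 := eventually_add_mul_pos (x := c x)
      (A := fun z w => (chartRep c α z ![w, Complex.I • w]).re)
      (B := fun z w => (chartRep c θ z ![w, Complex.I • w]).re)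
      (continuousAt_form_apply (hα x c hc hx).continuousAt)
      (continuousAt_form_apply (hθ x c hc hx).continuousAt)
      (fun r z w => form_apply_smul _ r w) (fun r z w => form_apply_smul _ r w) ?_ ?_
    · have h2 : Filter.Tendsto (fun q : ℝ × X' => (q.1, c q.2)) (nhds (0, x)) (nhds (0, c x)) :=
        (continuousAt_fst (p := ((0 : ℝ), x))).prodMk
          (ContinuousAt.comp (f := Prod.snd) (x := ((0 : ℝ), x)) (c.continuousAt hx)
            continuousAt_snd)
      have h3 : ∀ᶠ q : ℝ × X' in nhds (0, x), q.2 ∈ c.source :=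
        continuousAt_snd.eventually (c.open_source.mem_nhds hx)
      filter_upwards [h2.eventually h1, h3] with q hq hqc hq0 v hv
      let d : Cn n →L[ℂ] Cn n := mfderiv 𝓘(ℂ, Cn n) 𝓘(ℂ, Cn n) c q.2
      let d' : Cn n →L[ℂ] Cn n := mfderiv 𝓘(ℂ, Cn n) 𝓘(ℂ, Cn n) c.symm (c q.2)
      have hdv : d v ≠ 0 := by
        intro h0
        refine hv ((mfderiv_symm_comp_chart hc hqc v).symm.trans ?_)
        change d' (d v) = 0
        rw [h0, map_zero]
      have hdI : d (Complex.I • v) = Complex.I • d v := d.map_smul _ _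
      rw [form_apply_chartRep α hc hqc _ _ (d := d) rfl,
        form_apply_chartRep θ hc hqc _ _ (d := d) rfl, hdI]
      exact hq hq0 (d v) hdv
    · intro z w
      obtain ⟨v, -, hv⟩ := hsymm z w
      simp only [hv]
      exact hα0 _ v
    · intro w hw h0
      obtain ⟨v, hv0, hv⟩ := hsymm (c x) w
      simp only [hv] at h0 ⊢
      exact hαθ _ v (hv0 hw (c.map_source hx)) h0
  obtain ⟨ε, hε, hε0⟩ := ((key.filter_mono nhdsWithin_le_nhds).and
    (self_mem_nhdsWithin (s := Set.Ioi (0 : ℝ)))).exists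
  exact ⟨ε, hε0, fun x v hv => hε x (Set.mem_univ x) hε0 v hv⟩

/-- The blow-up of a compact complex manifold with a Hermitian metric that satisfies `(*)` carries
such a metric as well. -/
theorem IsBlowUp.exists_isHermitianMetric_satisfiesStar [T2Space X] [CompactSpace X]
    [IsManifold 𝓘(ℂ, Cn n) ω X] [CompactSpace X'] [IsManifold 𝓘(ℂ, Cn n) ω X']
    (h : IsBlowUp (n := n) μ Y) {η : DForm n X 2} (hη : IsHermitianMetric η)
    (hstar : SatisfiesStar η) : ∃ η' : DForm n X' 2, IsHermitianMetric η' ∧ SatisfiesStar η' := by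
  obtain ⟨θ, hθ, hpos⟩ := h.exists_relative_form
  have hθs : ∀ x, SmoothFormAt θ x := fun x => by
    obtain ⟨f, hf, hθf⟩ := hθ x
    exact (smoothFormAt_leviForm hf).congr hθf
  have hαs : ∀ x, SmoothFormAt (pullForm μ η) x := fun x =>
    (isSmoothForm_iff.1 hη.smooth (μ x)).pullForm h.holomorphic
  have hα : ∀ x (v : Cn n), (pullForm μ η x : Cn n [⋀^Fin 2]→L[ℝ] ℂ) ![v, Complex.I • v] =
      (η (μ x) : Cn n [⋀^Fin 2]→L[ℝ] ℂ)
        ![(mfderiv 𝓘(ℂ, Cn n) 𝓘(ℂ, Cn n) μ x : Cn n →L[ℂ] Cn n) v,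
          Complex.I • (mfderiv 𝓘(ℂ, Cn n) 𝓘(ℂ, Cn n) μ x : Cn n →L[ℂ] Cn n) v] := by
    intro x v
    let d : Cn n →L[ℂ] Cn n := mfderiv 𝓘(ℂ, Cn n) 𝓘(ℂ, Cn n) μ x
    have hdI : d (Complex.I • v) = Complex.I • d v := d.map_smul _ _
    refine (pullForm_apply μ η x v (Complex.I • v) (d := d) rfl).trans ?_
    rw [hdI]
    rfl
  -- If `μ^*η` vanishes on `(v, iv)`, then `dμ v = 0` since `η` is positive, and `θ` is positive on
  -- such `v`.
  obtain ⟨ε, hε, hεpos⟩ := exists_pos_add_smul hαs hθs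
    (fun x v => by rw [hα]; exact hη.nonneg _ _)
    (fun x v hv h0 => hpos x v hv (by
      by_contra hd
      rw [hα] at h0
      exact (hη.pos (μ x) _ hd).ne' h0))
  -- The positive form `μ^*η + ε θ` is rescaled so that `θ` appears with coefficient `1`, the shape
  -- treated by `satisfiesStar_smul_pullForm_add`.
  refine ⟨fun x => ((ε⁻¹ : ℝ) : ℂ) • pullForm μ η x + θ x, ⟨?_, ?_, ?_, ?_⟩,
    satisfiesStar_smul_pullForm_add h.holomorphic hη.smooth hstar hθs ?_ _⟩
  · exact isSmoothForm_iff.2 fun x => ((hαs x).smul _).add (hθs x)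
  · intro x v
    have hv : v = ![v 0, v 1] := by
      funext i
      fin_cases i <;> rfl
    obtain ⟨f, hf, hθf⟩ := hθ x
    have e1 : ((θ x : Cn n [⋀^Fin 2]→L[ℝ] ℂ) v).im = 0 := by
      rw [hθf.self_of_nhds, hv]
      refine (congrArg Complex.im (leviForm_apply_tangent hf
        (IsManifold.chart_mem_maximalAtlas (I := 𝓘(ℂ, Cn n)) (n := ω) x)
        (mem_chart_source (Cn n) x) rfl (v 0) (v 1))).trans (Complex.ofReal_im _)
    have e2 : ((pullForm μ η x : Cn n [⋀^Fin 2]→L[ℝ] ℂ) v).im = 0 := hη.real (μ x) _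
    change (((ε⁻¹ : ℝ) : ℂ) * (pullForm μ η x : Cn n [⋀^Fin 2]→L[ℝ] ℂ) v +
      (θ x : Cn n [⋀^Fin 2]→L[ℝ] ℂ) v).im = 0
    rw [Complex.add_im, Complex.im_ofReal_mul, e1, e2, mul_zero, add_zero]
  · intro x v w
    obtain ⟨f, hf, hθf⟩ := hθ x
    let d : Cn n →L[ℂ] Cn n := mfderiv 𝓘(ℂ, Cn n) 𝓘(ℂ, Cn n) μ x
    let d' : Cn n →L[ℂ] Cn n := mfderiv 𝓘(ℂ, Cn n) 𝓘(ℂ, Cn n) (chartAt (Cn n) x) x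
    have hd : ∀ v : Cn n, d (Complex.I • v) = Complex.I • d v := fun v => d.map_smul _ _
    have hd' : ∀ v : Cn n, d' (Complex.I • v) = Complex.I • d' v := fun v => d'.map_smul _ _
    have hlevi := leviForm_apply_tangent hf
      (IsManifold.chart_mem_maximalAtlas (I := 𝓘(ℂ, Cn n)) (n := ω) x)
      (mem_chart_source (Cn n) x) (d := d') rfl
    have e1 : ∀ v w : Cn n, (θ x : Cn n [⋀^Fin 2]→L[ℝ] ℂ) ![Complex.I • v, Complex.I • w] =
        (θ x : Cn n [⋀^Fin 2]→L[ℝ] ℂ) ![v, w] := by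
      intro v w
      rw [hθf.self_of_nhds, hlevi, hlevi, hd', hd', smul_smul, smul_smul, Complex.I_mul_I,
        neg_one_smul, neg_one_smul, map_neg, map_neg, neg_apply]
      congr 1
      ring
    have e2 : ∀ v w : Cn n,
        (pullForm μ η x : Cn n [⋀^Fin 2]→L[ℝ] ℂ) ![Complex.I • v, Complex.I • w] =
          (pullForm μ η x : Cn n [⋀^Fin 2]→L[ℝ] ℂ) ![v, w] := by
      intro v w
      rw [pullForm_apply μ η x _ _ (d := d) rfl, pullForm_apply μ η x _ _ (d := d) rfl, hd, hd]
      exact hη.type_one_one (μ x) (d v) (d w)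
    exact congrArg₂ (fun a b : ℂ => ((ε⁻¹ : ℝ) : ℂ) * a + b) (e2 v w) (e1 v w)
  · intro x v hv
    have h1 := hεpos x v hv
    change 0 < (((ε⁻¹ : ℝ) : ℂ) * (pullForm μ η x : Cn n [⋀^Fin 2]→L[ℝ] ℂ) ![v, Complex.I • v] +
      (θ x : Cn n [⋀^Fin 2]→L[ℝ] ℂ) ![v, Complex.I • v]).re
    rw [Complex.add_re, Complex.re_ofReal_mul]
    have h2 := mul_pos (inv_pos.2 hε) h1
    rwa [mul_add, inv_mul_cancel_left₀ hε.ne'] at h2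
  · intro c hc x hx d hd
    obtain ⟨f, hf, hθf⟩ := hθ x
    rw [flatD_congr (chartRep_congr hθf hx)]
    exact flatD_chartRep_leviForm hf hc hx hd

end OneBlowUp

end HermitianBlowUp

theorem mainTheorem6 {n N : ℕ} (X : Fin (N + 1) → Type*)
    [∀ j, TopologicalSpace (X j)] [∀ j, T2Space (X j)] [∀ j, CompactSpace (X j)]
    [∀ j, ChartedSpace (HermitianBlowUp.Cn n) (X j)]
    [∀ j, IsManifold 𝓘(ℂ, HermitianBlowUp.Cn n) ω (X j)]
    (Y : ∀ j : Fin N, Set (X j.castSucc))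
    (μ : ∀ j : Fin N, X j.succ → X j.castSucc)
    (hμ : ∀ j : Fin N, HermitianBlowUp.IsBlowUp (n := n) (μ j) (Y j))
    (hX : ∃ η : HermitianBlowUp.DForm n (X 0) 2,
      HermitianBlowUp.IsHermitianMetric η ∧ HermitianBlowUp.SatisfiesStar η) :
    ∃ η : HermitianBlowUp.DForm n (X (Fin.last N)) 2,
      HermitianBlowUp.IsHermitianMetric η ∧ HermitianBlowUp.IsGauduchon η ∧
        HermitianBlowUp.SatisfiesStar η := by
  have key : ∀ j : Fin (N + 1), ∃ η : HermitianBlowUp.DForm n (X j) 2,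
      HermitianBlowUp.IsHermitianMetric η ∧ HermitianBlowUp.SatisfiesStar η := by
    intro j
    induction j using Fin.induction with
    | zero => exact hX
    | succ j ih =>
      obtain ⟨η, hη, hstar⟩ := ih
      exact (hμ j).exists_isHermitianMetric_satisfiesStar hη hstar
  obtain ⟨η, hη, hstar⟩ := key (Fin.last N)
  exact ⟨η, hη, hstar.isGauduchon, hstar⟩
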